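/- Let $d\in\mathbb N$, and let $\lambda\in C^\infty(\mathbb R^d)$ be a probability density with $\lambda>0$ everywhere. Let $\mathcal P_+$ be the set of smooth, strictly positive probability densities on $\mathbb R^d$ with finite second moment, and let $C^\infty_{c,0}$ be the set of $h\in C_c^\infty(\mathbb R^d)$ with $\int h\,dx=0$. A *$C^1$ energy* $(D,F,\delta F)$ consists of a domain $D\subseteq\mathcal P_+$ (the densities of finite energy) that is stable under $\rho\mapsto\rho+h$ whenever $h\in C^\infty_{c,0}$ and $\rho+h>0$, a functional $F$, real-valued on $D$, and its $L^2$ first variation $\delta F=\frac{\delta F}{\delta\rho}$, that is, functions $\delta F(\rho)\in C^1(\mathbb R^d)$ for $\rho\in D$ with $$\frac{d}{d\varepsilon}\Big|_{\varepsilon=0}F(\rho+\varepsilon h)=\int \delta F(\rho)\,h\,dx\qquad(h\in C^\infty_{c,0}),$$ such that $\delta F(\rho_n)\to\delta F(\rho)$ locally uniformly whenever $\rho_n,\rho\in D$, $\rho_n\to\rho$ in $C^\infty_{loc}$ and the second moments of $\rho_n$ converge to that of $\rho$. Let $(D,\mathcal F_R,\frac{\delta}{\delta\rho}\mathcal F_R)$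 be a $C^1$ energy, $\mathcal F_Q(\rho)=\int|\nabla\log\rho|^2\rho\,dx$, $\mathcal F=\mathcal F_R+\frac18\mathcal F_Q$, $D'=\{\rho\in D:\mathcal F_Q(\rho)<\infty\}$, and $$\frac{\delta}{\delta\rho}\mathcal F(\rho)=\frac{\delta}{\delta\rho}\mathcal F_R(\rho)+\frac18\big(-2\Delta\log\rho-|\nabla\log\rho|^2\big).$$ Let $\mathcal O$ be the set of smooth diffeomorphisms $T$ of $\mathbb R^d$ with $T\in L^2(\lambda)$, let $\mathcal T\mathcal O=C^\infty(\mathbb R^d;\mathbb R^d)\cap L^2(\lambda)$ be its tangent space at each point, let $T_\sharp\lambda=(\lambda\circ T^{-1})\,|\det D T^{-1}|$, $\mathcal G(\sigma_1,\sigma_2)=\int\sigma_1^\top\sigma_2\,\lambda\,dz$, and $$\mathbb L(T,\sigma)=\tfrac12\mathcal G(\sigma,\sigma)-\mathcal F(T_\sharp\lambda),\qquad \mathbb H(T,\Lambda)=\tfrac12\mathcal G\big(\tfrac1\lambda\Lambda,\tfrac1\lambda\Lambda\big)+\mathcal F(T_\sharp\lambda).$$ Fix $t_0>0$ and densities $\rho_0,\rho_{t_0}$.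 A *path* is a map $T_t(z)$, smooth on $[0,t_0]\times\mathbb R^d$, with $T_t\in\mathcal O$, $\dot T_t\in\mathcal T\mathcal O$, $T_{t\sharp}\lambda\in D'$ for all $t\in[0,t_0]$, with $t\mapsto\mathcal G(\dot T_t,\dot T_t)$ and $t\mapsto\mathcal F(T_{t\sharp}\lambda)$ integrable on $[0,t_0]$, and with $T_{0\sharp}\lambda=\rho_0$, $T_{t_0\sharp}\lambda=\rho_{t_0}$. Its action is $\mathcal I(T)=\int_0^{t_0}\mathbb L(T_t,\dot T_t)\,dt$. A path $T$ is a *critical point* if $\frac{d}{d\varepsilon}\mathcal I(Y^\varepsilon)=0$ at $\varepsilon=0$ for every family $Y^\varepsilon_t(z)$, smooth in $(\varepsilon,t,z)$, with $Y^0=T$, such that $Y^\varepsilon$ is a path with the same endpoint densities for all small $|\varepsilon|$ and $Y^\varepsilon_t(z)=T_t(z)$ for $z$ outside a compact set independent of $\varepsilon$ and $t$. Then the following hold. 1. $\frac{\delta}{\delta\rho}\mathcal F$ is the $L^2$ first variation of $\mathcal F$; more precisely, $(D',\mathcal F,\frac{\delta}{\delta\rho}\mathcal F)$ is a $C^1$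 energy. 2. Every critical point $T$ satisfies, for all $t\in[0,t_0]$ and $z\in\mathbb R^d$, $$\ddot T(z)=-\nabla_x\frac{\delta}{\delta\rho}\mathcal F(T_\sharp\lambda)\,(T(z)).\qquad(\ast)$$ 3. For every path $T$ and every time-dependent map $\Lambda$ on $[0,t_0]\times\mathbb R^d$, the first-order system $$\dot T=\tfrac1\lambda\Lambda,\qquad \dot\Lambda=-\lambda\;\nabla_x\frac{\delta}{\delta\rho}\mathcal F(T_\sharp\lambda)\circ T$$ holds on $[0,t_0]$ if and only if $\Lambda=\lambda\dot T$ and $T$ satisfies $(\ast)$. 4. For $T\in\mathcal O$ and $\sigma\in\mathcal T\mathcal O$, the momentum is $\frac{\partial\mathbb L}{\partial\sigma}(T,\sigma)=\lambda\sigma$, i.e. $\frac{d}{d\varepsilon}\mathbb L(T,\sigma+\varepsilon\tau)|_{\varepsilon=0}=\int(\lambda\sigma)^\top\tau\,dz$ for $\tau\in\mathcal T\mathcal O$, and $\mathbb H(T,\lambda\sigma)=\mathcal G(\sigma,\sigma)-\mathbb L(T,\sigma)$. 5. The system in 3 is the Hamiltonian system $\dot T=\frac{\delta\mathbb H}{\delta\Lambda}$,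 $\dot\Lambda=-\frac{\delta\mathbb H}{\delta T}$: for $T\in\mathcal O$ with $T_\sharp\lambda\in D'$ and $\frac1\lambda\Lambda\in\mathcal T\mathcal O$, one has $\frac{\delta\mathbb H}{\delta\Lambda}=\frac1\lambda\Lambda$ (tested on all $M$ with $\frac1\lambda M\in\mathcal T\mathcal O$) and $\frac{\delta\mathbb H}{\delta T}=\lambda\,\nabla_x\frac{\delta}{\delta\rho}\mathcal F(T_\sharp\lambda)\circ T$ (tested on all $S\in C_c^\infty(\mathbb R^d;\mathbb R^d)$). 6. If $T$ is a critical point, there is $\Phi:[0,t_0]\times\mathbb R^d\to\mathbb R$, smooth in $x$, with $\dot T_t=\nabla\Phi_t\circ T_t$, such that $(\rho,\Phi)$ with $\rho_t=T_{t\sharp}\lambda$ solves on $[0,t_0]$ the Wasserstein Hamiltonian flow $$\partial_t\rho=\frac{\delta}{\delta\Phi}\mathcal H(\rho,\Phi),\quad \partial_t\Phi=-\frac{\delta}{\delta\rho}\mathcal H(\rho,\Phi),\qquad \mathcal H(\rho,\Phi)=\tfrac12\int|\nabla\Phi|^2\rho\,dx+\mathcal F(\rho)$$ (the variation in $\Phi$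 tested on $C_c^\infty(\mathbb R^d)$, the one in $\rho$ on $C^\infty_{c,0}$), and the Madelung system $$\partial_t\rho+\nabla\cdot(\rho\nabla\Phi)=0,\qquad \partial_t\Phi+\tfrac12|\nabla\Phi|^2=-\frac{\delta}{\delta\rho}\mathcal F_R(\rho)+\frac12\frac{\Delta\sqrt\rho}{\sqrt\rho}.$$ -/

import Mathlib

open MeasureTheory Set Filter Topology
open scoped ContDiff Gradient RealInnerProductSpace

noncomputable section

/-- Euclidean space of dimension `d`. -/
abbrev E (d : ℕ) : Type := EuclideanSpace ℝ (Fin d)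

namespace WHF

variable {d : ℕ}

/-! ### Densities, functionals of densities and their first variations -/

/-- Smooth, strictly positive probability densities with finite second moment. -/
structure IsDensity (ρ : E d → ℝ) : Prop where
  smooth : ContDiff ℝ ∞ ρ
  pos : ∀ x, 0 < ρ x
  integrable : Integrable ρ
  mass : ∫ x, ρ x = 1
  moment : Integrable (fun x => ‖x‖ ^ 2 * ρ x)

/-- Smooth compactly supported functions. -/
def testFun (d : ℕ) : Set (E d → ℝ) := {h | ContDiff ℝ ∞ h ∧ HasCompactSupport h}

/-- Smooth compactly supported functions of integral zero (the admissible perturbations of a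
probability density). -/
def testFunZero (d : ℕ) : Set (E d → ℝ) := {h | h ∈ testFun d ∧ ∫ x, h x = 0}

/-- `g` is an `L²` first variation at `u` of the functional `G`, tested on directions in `S`:
`d/dε G(u + ε h) = ∫ g h dx` at `ε = 0`. -/
def IsFirstVariation (S : Set (E d → ℝ)) (G : (E d → ℝ) → ℝ) (u g : E d → ℝ) : Prop :=
  ∀ h ∈ S, HasDerivAt (fun ε : ℝ => G (fun x => u x + ε * h x)) (∫ x, g x * h x) 0

/-- Convergence of densities: all derivatives converge locally uniformly, and the second moments
converge. -/
def DensityTendsto (r : ℕ → E d → ℝ) (ρ : E d → ℝ) : Prop :=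
  (∀ k : ℕ, TendstoLocallyUniformly (fun n => iteratedFDeriv ℝ k (r n)) (iteratedFDeriv ℝ k ρ)
    atTop) ∧
  Tendsto (fun n => ∫ x, ‖x‖ ^ 2 * r n x) atTop (𝓝 (∫ x, ‖x‖ ^ 2 * ρ x))

/-- `F` is a continuously differentiable energy functional with finite-energy domain `D`, and
`δF ρ` is its `L²` first variation at `ρ`. -/
structure IsEnergy (D : Set (E d → ℝ)) (F : (E d → ℝ) → ℝ) (δF : (E d → ℝ) → E d → ℝ) :
    Prop where
  isDensity : ∀ ρ ∈ D, IsDensity ρ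
  perturb : ∀ ρ ∈ D, ∀ h ∈ testFunZero d, (∀ x, 0 < ρ x + h x) → (fun x => ρ x + h x) ∈ D
  contDiff : ∀ ρ ∈ D, ContDiff ℝ 1 (δF ρ)
  variation : ∀ ρ ∈ D, IsFirstVariation (testFunZero d) F ρ (δF ρ)
  continuity : ∀ (r : ℕ → E d → ℝ) (ρ : E d → ℝ), (∀ n, r n ∈ D) → ρ ∈ D →
    DensityTendsto r ρ → TendstoLocallyUniformly (fun n => δF (r n)) (δF ρ) atTop

/-- The Fisher information `∫ |∇ log ρ|² ρ dx`. -/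
def fisher (ρ : E d → ℝ) : ℝ := ∫ x, ‖∇ (fun y => Real.log (ρ y)) x‖ ^ 2 * ρ x

/-- The functions whose Fisher information is finite. -/
def finiteFisher (d : ℕ) : Set (E d → ℝ) :=
  {ρ | Integrable (fun x => ‖∇ (fun y => Real.log (ρ y)) x‖ ^ 2 * ρ x)}

/-- The quantum potential `- 2 Δ log ρ - |∇ log ρ|²`. -/
def fisherVariation (ρ : E d → ℝ) (x : E d) : ℝ :=
  -2 * Laplacian.laplacian (fun y => Real.log (ρ y)) x - ‖∇ (fun y => Real.log (ρ y)) x‖ ^ 2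

/-- `F = F_R + (1/8) F_Q`. -/
def energy (FR : (E d → ℝ) → ℝ) (ρ : E d → ℝ) : ℝ := FR ρ + 1 / 8 * fisher ρ

/-- `δF/δρ = δF_R/δρ + (1/8) δF_Q/δρ`. -/
def energyVariation (δFR : (E d → ℝ) → E d → ℝ) (ρ : E d → ℝ) (x : E d) : ℝ :=
  δFR ρ x + 1 / 8 * fisherVariation ρ x

/-! ### The space of diffeomorphisms -/

/-- Smooth diffeomorphisms of `ℝ^d`. -/
def IsDiffeo (T : E d → E d) : Prop :=
  ContDiff ℝ ∞ T ∧ ∃ S : E d → E d,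
    ContDiff ℝ ∞ S ∧ Function.LeftInverse S T ∧ Function.RightInverse S T

/-- The push-forward density `λ(T⁻¹ x) |det D(T⁻¹)(x)|`. -/
def push (T : E d → E d) (lam : E d → ℝ) (x : E d) : ℝ :=
  lam (Function.invFun T x) * |(fderiv ℝ (Function.invFun T) x).det|

/-- `σ ∈ C^∞ ∩ L²(λ)`. -/
def IsTangent (lam : E d → ℝ) (σ : E d → E d) : Prop :=
  ContDiff ℝ ∞ σ ∧ Integrable (fun z => ‖σ z‖ ^ 2 * lam z)

/-- The space `𝒪`: diffeomorphisms in `L²(λ)`. -/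
def InO (lam : E d → ℝ) (T : E d → E d) : Prop :=
  IsDiffeo T ∧ Integrable (fun z => ‖T z‖ ^ 2 * lam z)

/-- The metric `𝒢(σ₁, σ₂) = ∫ σ₁ᵀ σ₂ λ dz`, which does not depend on the base point. -/
def metric (lam : E d → ℝ) (σ₁ σ₂ : E d → E d) : ℝ := ∫ z, ⟪σ₁ z, σ₂ z⟫ * lam z

/-- The Lagrangian. -/
def lagrangian (F : (E d → ℝ) → ℝ) (lam : E d → ℝ) (T σ : E d → E d) : ℝ :=
  1 / 2 * metric lam σ σ - F (push T lam)

/-- The Hamiltonian on pairs (map, momentum). -/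
def hamiltonian (F : (E d → ℝ) → ℝ) (lam : E d → ℝ) (T Λ : E d → E d) : ℝ :=
  1 / 2 * metric lam (fun z => (lam z)⁻¹ • Λ z) (fun z => (lam z)⁻¹ • Λ z) + F (push T lam)

/-- Time derivative of a time-dependent map. -/
def vel (T : ℝ → E d → E d) (t : ℝ) (z : E d) : E d := deriv (fun s => T s z) t

/-- Smooth paths in `𝒪` over `[0, t₀]` with finite action and prescribed endpoint densities. As
usual, smoothness on `[0, t₀] × ℝ^d` means being the restriction of a smooth map on `ℝ × ℝ^d`;
the values for `t ∉ [0, t₀]` play no role. -/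
structure IsPath (D : Set (E d → ℝ)) (F : (E d → ℝ) → ℝ) (lam : E d → ℝ) (t₀ : ℝ)
    (ρ₀ ρ₁ : E d → ℝ) (T : ℝ → E d → E d) : Prop where
  smooth : ContDiff ℝ ∞ (fun p : ℝ × E d => T p.1 p.2)
  inO : ∀ t ∈ Icc 0 t₀, InO lam (T t)
  tangent : ∀ t ∈ Icc 0 t₀, IsTangent lam (vel T t)
  finite : ∀ t ∈ Icc 0 t₀, push (T t) lam ∈ D
  kinetic : IntervalIntegrable (fun t => metric lam (vel T t) (vel T t)) volume 0 t₀
  potential : IntervalIntegrable (fun t => F (push (T t) lam)) volume 0 t₀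
  left : push (T 0) lam = ρ₀
  right : push (T t₀) lam = ρ₁

/-- The action functional. -/
def action (F : (E d → ℝ) → ℝ) (lam : E d → ℝ) (t₀ : ℝ) (T : ℝ → E d → E d) : ℝ :=
  ∫ t in (0 : ℝ)..t₀, lagrangian F lam (T t) (vel T t)

/-- A smooth one-parameter variation of the path `T`, with compact support in space, through paths
that have the same endpoint densities. -/
structure IsPathVariation (D : Set (E d → ℝ)) (F : (E d → ℝ) → ℝ) (lam : E d → ℝ) (t₀ : ℝ)
    (ρ₀ ρ₁ : E d → ℝ) (T : ℝ → E d → E d) (Y : ℝ → ℝ → E d → E d) : Prop where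
  smooth : ContDiff ℝ ∞ (fun p : ℝ × ℝ × E d => Y p.1 p.2.1 p.2.2)
  base : ∀ t ∈ Icc 0 t₀, Y 0 t = T t
  support : ∃ K : Set (E d), IsCompact K ∧ ∀ ε, ∀ t ∈ Icc 0 t₀, ∀ z, z ∉ K → Y ε t z = T t z
  path : ∀ᶠ ε in 𝓝 (0 : ℝ), IsPath D F lam t₀ ρ₀ ρ₁ (Y ε)

/-- Critical points of the action among the paths with the given endpoint densities. -/
def IsCritical (D : Set (E d → ℝ)) (F : (E d → ℝ) → ℝ) (lam : E d → ℝ) (t₀ : ℝ)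
    (ρ₀ ρ₁ : E d → ℝ) (T : ℝ → E d → E d) : Prop :=
  IsPath D F lam t₀ ρ₀ ρ₁ T ∧
    ∀ Y, IsPathVariation D F lam t₀ ρ₀ ρ₁ T Y → HasDerivAt (fun ε => action F lam t₀ (Y ε)) 0 0

/-! ### The equations -/

/-- `T̈(z) = - ∇ (δF/δρ)(T_♯ λ)(T(z))` on `[0, t₀]`. -/
def SolvesSecondOrder (δF : (E d → ℝ) → E d → ℝ) (lam : E d → ℝ) (t₀ : ℝ)
    (T : ℝ → E d → E d) : Prop :=
  ∀ t ∈ Icc 0 t₀, ∀ z, vel (vel T) t z = -∇ (δF (push (T t) lam)) (T t z)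

/-- `Ṫ = Λ / λ`, `Λ̇ = - λ ∇ (δF/δρ)(T_♯ λ) ∘ T` on `[0, t₀]`. -/
def SolvesFirstOrder (δF : (E d → ℝ) → E d → ℝ) (lam : E d → ℝ) (t₀ : ℝ)
    (T Λ : ℝ → E d → E d) : Prop :=
  ∀ t ∈ Icc 0 t₀, ∀ z, vel T t z = (lam z)⁻¹ • Λ t z ∧
    HasDerivWithinAt (fun s => Λ s z) (-(lam z • ∇ (δF (push (T t) lam)) (T t z))) (Icc 0 t₀) t

/-- The Hamiltonian `ℋ(ρ, Φ) = ½ ∫ |∇Φ|² ρ dx + F(ρ)` on density space. -/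
def densityHamiltonian (F : (E d → ℝ) → ℝ) (ρ Φ : E d → ℝ) : ℝ :=
  (∫ x, 1 / 2 * ‖∇ Φ x‖ ^ 2 * ρ x) + F ρ

/-- The Wasserstein Hamiltonian flow `∂ₜ ρ = δH/δΦ`, `∂ₜ Φ = - δH/δρ` on `[0, t₀]`. -/
def SolvesWHF (H : (E d → ℝ) → (E d → ℝ) → ℝ) (t₀ : ℝ) (ρ Φ : ℝ → E d → ℝ) : Prop :=
  ∀ t ∈ Icc 0 t₀, ∃ ρ' Φ' : E d → ℝ,
    (∀ x, HasDerivWithinAt (fun s => ρ s x) (ρ' x) (Icc 0 t₀) t) ∧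
    (∀ x, HasDerivWithinAt (fun s => Φ s x) (Φ' x) (Icc 0 t₀) t) ∧
    IsFirstVariation (testFun d) (fun φ => H (ρ t) φ) (Φ t) ρ' ∧
    IsFirstVariation (testFunZero d) (fun r => H r (Φ t)) (ρ t) (fun x => -Φ' x)

/-- Divergence of a vector field. -/
def divergence (v : E d → E d) (x : E d) : ℝ := LinearMap.trace ℝ (E d) (fderiv ℝ v x).toLinearMap

/-- The Madelung system `∂ₜ ρ + ∇·(ρ ∇Φ) = 0`,
`∂ₜ Φ + ½ |∇Φ|² = - δF_R/δρ + ½ Δ√ρ / √ρ` on `[0, t₀]`. -/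
def SolvesMadelung (δFR : (E d → ℝ) → E d → ℝ) (t₀ : ℝ) (ρ Φ : ℝ → E d → ℝ) : Prop :=
  ∀ t ∈ Icc 0 t₀, ∀ x,
    HasDerivWithinAt (fun s => ρ s x) (-divergence (fun y => ρ t y • ∇ (Φ t) y) x)
      (Icc 0 t₀) t ∧
    HasDerivWithinAt (fun s => Φ s x)
      (-(1 / 2 * ‖∇ (Φ t) x‖ ^ 2) - δFR (ρ t) x +
        1 / 2 * (Laplacian.laplacian (fun y => √(ρ t y)) x / √(ρ t x)))
      (Icc 0 t₀) t

end WHF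

end

noncomputable section

namespace WHF

variable {d : ℕ}

/-! ### Tools from analysis -/

/-! The Fisher part is a direct computation: a test perturbation changes `∫ |∇ρ|²/ρ` only on a
compact set, and one integration by parts produces `-2 Δ log ρ - |∇ log ρ|²`
(`isFirstVariation_fisher`).

The second order equation is an Euler–Lagrange equation. The obstacle is that an energy is
differentiable only along straight segments `ρ + ε h`, while varying a map moves its push-forward
density along a curved path. The chain rule `IsEnergy.hasDerivAt_comp` overcomes this: join the
densities by segments, apply the mean value theorem on each, and use that the first variation is
jointly continuous on the two-parameter family of densities so obtained. The continuity axiom also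
asks for convergence of second moments; along a path these are continuous because the displacement
is controlled by the time-integrated kinetic energy (`norm_sub_sq_le`). Differentiating the action
and integrating by parts in time gives `IsDiffeoVariation.eq_of_isCritical`, with boundary terms at
both ends. Variations `T + ε χ(t) η(z)` with `χ` supported inside `(0, t₀)` remove the boundary
terms and yield the equation. Equivalence with the first order system and the Legendre transform are
then algebra, since the metric is a fixed quadratic form.

That the velocity is a gradient comes from the boundary term. Only the endpoint densities are
prescribed, so `T` may be composed on the right with maps preserving `λ`. Such relabellings leave
every density, hence the potential energy, unchanged, and criticality says that the initial velocity
pairs to zero with the field they generate (`IsCritical.metric_fderiv_eq_zero`). To obtain enough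
relabellings explicitly, a map acting along one direction first turns `λ` into Lebesgue measure near
a point; in the new coordinates small twists, which rotate concentric spheres by a radius-dependent
angle, preserve Lebesgue measure. Vanishing of all small circulations forces the curl of the
pulled-back initial velocity to vanish (`inner_fderiv_eq_of_integral_eq_zero`).

The acceleration is a gradient in space, so this symmetry persists in time
(`inner_fderiv_vel_symm_of_gradient`) and the Eulerian velocity `v` has a symmetric derivative. The
Poincaré lemma gives a potential at time zero; subtracting the time integral of the Bernoulli
function `½ |v|² + δF` gives a potential at all times that satisfies the Hamilton–Jacobi equation
with no stray function of time (`IsCritical.exists_potential`). The continuity equation holds for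
any flow (`hasDerivWithinAt_push`), and `laplacian_sqrt_div` rewrites the quantum potential in the
form used by Madelung. -/

/-- Locally uniform convergence to a continuous limit is the same as continuous convergence. In this
form the limit laws for sums, products and quotients apply directly. -/
theorem tendstoLocallyUniformly_iff_tendsto_prod {ι α β : Type*} [TopologicalSpace α]
    [UniformSpace β] {F : ι → α → β} {f : α → β} {p : Filter ι} (hf : Continuous f) :
    TendstoLocallyUniformly F f p ↔
      ∀ x, Tendsto (fun q : ι × α => F q.1 q.2) (p ×ˢ 𝓝 x) (𝓝 (f x)) := by
  rw [tendstoLocallyUniformly_iff_forall_tendsto]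
  refine forall_congr' fun x => ?_
  have h : Tendsto (fun q : ι × α => f q.2) (p ×ˢ 𝓝 x) (𝓝 (f x)) :=
    hf.continuousAt.tendsto.comp tendsto_snd
  refine ⟨fun H => h.congr_uniformity H, fun H => ?_⟩
  have := h.prodMk_nhds H
  exact this.mono_right (nhds_le_uniformity _)

/-- Differentiation under the integral sign over a compact set. -/
theorem hasDerivAt_setIntegral_of_isCompact {X : Type*} [TopologicalSpace X] [T2Space X]
    [TopologicalSpace.PseudoMetrizableSpace X] [MeasurableSpace X] [BorelSpace X]
    {μ : Measure X} [IsFiniteMeasureOnCompacts μ] {K : Set X} (hK : IsCompact K) {J : Set ℝ}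
    {e : ℝ} (hJ : J ∈ 𝓝 e) {f f' : ℝ → X → ℝ} (hf : ∀ s ∈ J, ContinuousOn (f s) K)
    (hf' : ContinuousOn (fun q : ℝ × X => f' q.1 q.2) (J ×ˢ K))
    (hd : ∀ s ∈ J, ∀ x ∈ K, HasDerivAt (fun r => f r x) (f' s x) s) :
    HasDerivAt (fun s => ∫ x in K, f s x ∂μ) (∫ x in K, f' e x ∂μ) e := by
  -- Shrinking to a closed ball makes the parameter set times `K` compact, so a constant dominates
  -- the derivative.
  obtain ⟨δ, hδ, hδJ⟩ := Metric.nhds_basis_closedBall.mem_iff.1 hJ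
  have hc : IsCompact (Metric.closedBall e δ ×ˢ K) := (isCompact_closedBall e δ).prod hK
  obtain ⟨C, hC⟩ := hc.exists_bound_of_continuousOn (hf'.mono (prod_mono hδJ subset_rfl))
  have hmeas : ∀ g : X → ℝ, ContinuousOn g K → AEStronglyMeasurable g (μ.restrict K) :=
    fun g hg => hg.aestronglyMeasurable_of_isCompact hK hK.measurableSet
  refine (hasDerivAt_integral_of_dominated_loc_of_deriv_le (s := Metric.closedBall e δ)
    (bound := fun _ => C) (Metric.closedBall_mem_nhds e hδ) ?_ ?_ ?_ ?_ ?_ ?_).2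
  · filter_upwards [hJ] with s hs using hmeas _ (hf s hs)
  · exact (hf e (mem_of_mem_nhds hJ)).integrableOn_compact hK
  · refine hmeas _ (hf'.comp (f := fun x => (e, x)) (by fun_prop) fun x hx => ?_)
    exact ⟨mem_of_mem_nhds hJ, hx⟩
  · refine (ae_restrict_iff' hK.measurableSet).2 (Eventually.of_forall fun x hx s hs => ?_)
    exact hC (s, x) ⟨hs, hx⟩
  · exact integrableOn_const hK.measure_lt_top.ne
  · refine (ae_restrict_iff' hK.measurableSet).2 (Eventually.of_forall fun x hx s hs => ?_)
    exact hd s (hδJ hs) x hx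

/-! ### Slices and partial derivatives of smooth functions on `U ×ˢ univ` -/

section Partial

variable {P V W : Type*} [NormedAddCommGroup P] [NormedSpace ℝ P] [NormedAddCommGroup V]
  [NormedSpace ℝ V] [NormedAddCommGroup W] [NormedSpace ℝ W]

/-- The second factor is the whole space, so a derivative relative to the product restricts to a
genuine derivative on each slice. In the applications `U` contains the closed interval `[0, t₀]` as
a factor, where only one-sided derivatives in time make sense. -/
theorem hasFDerivAt_snd_of_prod_univ {U : Set P} {f : P × V → W}
    (hf : ContDiffOn ℝ ∞ f (U ×ˢ univ)) {q : P × V} (hq : q ∈ U ×ˢ (univ : Set V)) :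
    HasFDerivAt (fun y => f (q.1, y))
      ((fderivWithin ℝ f (U ×ˢ univ) q).comp (ContinuousLinearMap.inr ℝ P V)) q.2 := by
  have h1 : HasFDerivWithinAt f (fderivWithin ℝ f (U ×ˢ univ) q) (U ×ˢ univ) (q.1, q.2) :=
    ((hf q hq).differentiableWithinAt (by simp)).hasFDerivWithinAt
  have h2 : HasFDerivWithinAt (fun y : V => (q.1, y)) (ContinuousLinearMap.inr ℝ P V) univ q.2 :=
    (hasFDerivAt_prodMk_right q.1 q.2).hasFDerivWithinAt
  exact hasFDerivWithinAt_univ.1 (h1.comp q.2 h2 fun y _ => ⟨hq.1, mem_univ _⟩)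

theorem contDiffOn_fderiv_snd {U : Set P} (hU : UniqueDiffOn ℝ U) {f : P × V → W}
    (hf : ContDiffOn ℝ ∞ f (U ×ˢ univ)) :
    ContDiffOn ℝ ∞ (fun q : P × V => fderiv ℝ (fun y => f (q.1, y)) q.2) (U ×ˢ univ) := by
  have h := hf.fderivWithin (hU.prod uniqueDiffOn_univ) (m := ∞) (by simp)
  refine ContDiffOn.congr (f := fun q => (fderivWithin ℝ f (U ×ˢ univ) q).comp
    (ContinuousLinearMap.inr ℝ P V)) ?_ fun q hq => (hasFDerivAt_snd_of_prod_univ hf hq).fderiv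
  exact h.clm_comp contDiffOn_const

theorem contDiffOn_iteratedFDeriv_snd {U : Set P} (hU : UniqueDiffOn ℝ U) {f : P × V → W}
    (hf : ContDiffOn ℝ ∞ f (U ×ˢ univ)) (k : ℕ) :
    ContDiffOn ℝ ∞ (fun q : P × V => iteratedFDeriv ℝ k (fun y => f (q.1, y)) q.2)
      (U ×ˢ univ) := by
  induction k with
  | zero =>
    refine ((continuousMultilinearCurryFin0 ℝ V W).symm.contDiff.comp_contDiffOn hf).congr ?_
    intro q _
    simp [iteratedFDeriv_zero_eq_comp]
  | succ k ih =>
    refine ((continuousMultilinearCurryLeftEquiv ℝ (fun _ : Fin (k + 1) => V) W).symm.contDiff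
      |>.comp_contDiffOn (contDiffOn_fderiv_snd hU ih)).congr ?_
    intro q _
    simp [iteratedFDeriv_succ_eq_comp_left]

theorem hasDerivWithinAt_fst_of_prod_univ {U : Set ℝ} {f : ℝ × V → W}
    (hf : ContDiffOn ℝ ∞ f (U ×ˢ univ)) {q : ℝ × V} (hq : q ∈ U ×ˢ (univ : Set V)) :
    HasDerivWithinAt (fun s => f (s, q.2)) (fderivWithin ℝ f (U ×ˢ univ) q (1, 0)) U q.1 := by
  have h1 : HasFDerivWithinAt f (fderivWithin ℝ f (U ×ˢ univ) q) (U ×ˢ univ) (q.1, q.2) :=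
    ((hf q hq).differentiableWithinAt (by simp)).hasFDerivWithinAt
  have h2 : HasDerivWithinAt (fun s : ℝ => (s, q.2)) ((1 : ℝ), (0 : V)) U q.1 :=
    (hasDerivWithinAt_id _ _).prodMk (hasDerivWithinAt_const _ _ _)
  exact h1.comp_hasDerivWithinAt q.1 h2 fun y hy => mk_mem_prod hy (mem_univ _)

theorem contDiffOn_derivWithin_fst {U : Set ℝ} (hU : UniqueDiffOn ℝ U) {f : ℝ × V → W}
    (hf : ContDiffOn ℝ ∞ f (U ×ˢ univ)) :
    ContDiffOn ℝ ∞ (fun q : ℝ × V => derivWithin (fun s => f (s, q.2)) U q.1) (U ×ˢ univ) := by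
  have h := hf.fderivWithin (hU.prod uniqueDiffOn_univ) (m := ∞) (by simp)
  refine ContDiffOn.congr (f := fun q => fderivWithin ℝ f (U ×ˢ univ) q (1, 0)) ?_
    fun q hq => (hasDerivWithinAt_fst_of_prod_univ hf hq).derivWithin (hU _ hq.1)
  exact h.clm_apply contDiffOn_const

theorem contDiff_deriv_fst {f : ℝ × V → W} (hf : ContDiff ℝ ∞ f) :
    ContDiff ℝ ∞ (fun q : ℝ × V => deriv (fun s => f (s, q.2)) q.1) := by
  have := contDiffOn_derivWithin_fst (V := V) (W := W) uniqueDiffOn_univ (f := f)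
    (by simpa using hf.contDiffOn)
  simpa [contDiffOn_univ] using this

theorem contDiff_fderiv_snd {f : P × V → W} (hf : ContDiff ℝ ∞ f) :
    ContDiff ℝ ∞ (fun q : P × V => fderiv ℝ (fun y => f (q.1, y)) q.2) := by
  have := contDiffOn_fderiv_snd (P := P) (V := V) (W := W) uniqueDiffOn_univ (f := f)
    (by simpa using hf.contDiffOn)
  simpa [contDiffOn_univ] using this

end Partial

/-- In the standard basis the determinant is a polynomial in the matrix entries. -/
theorem contDiff_det {n : WithTop ℕ∞} :
    ContDiff ℝ n (fun A : E d →L[ℝ] E d => A.det) := by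
  let b := (EuclideanSpace.basisFun (Fin d) ℝ).toBasis
  have h : (fun A : E d →L[ℝ] E d => A.det) = fun A => ∑ σ : Equiv.Perm (Fin d),
      (Equiv.Perm.sign σ : ℝ) * ∏ i, (A (b i)) (σ i) := by
    funext A
    rw [ContinuousLinearMap.det, ← LinearMap.det_toMatrix b, Matrix.det_apply']
    refine Finset.sum_congr rfl fun σ _ => ?_
    simp [LinearMap.toMatrix_apply, b]
  rw [h]
  refine ContDiff.sum fun σ _ => contDiff_const.mul (contDiff_prod fun i _ => ?_)
  have h1 : ContDiff ℝ n (fun A : E d →L[ℝ] E d => A (b i)) :=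
    contDiff_id.clm_apply contDiff_const
  exact (EuclideanSpace.proj (𝕜 := ℝ) (σ i)).contDiff.comp h1

/-! ### Diffeomorphisms and push-forward densities -/

theorem IsDiffeo.bijective {T : E d → E d} (hT : IsDiffeo T) : Function.Bijective T := by
  obtain ⟨_, S, _, h1, h2⟩ := hT
  exact ⟨h1.injective, h2.surjective⟩

theorem IsDiffeo.invFun_eq {T S : E d → E d} (h1 : Function.LeftInverse S T)
    (h2 : Function.RightInverse S T) : Function.invFun T = S := by
  funext x
  have := Function.leftInverse_invFun h1.injective (S x)
  rwa [h2 x] at this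

theorem IsDiffeo.contDiff_invFun {T : E d → E d} (hT : IsDiffeo T) :
    ContDiff ℝ ∞ (Function.invFun T) := by
  obtain ⟨_, S, hS, h1, h2⟩ := hT
  rwa [IsDiffeo.invFun_eq h1 h2]

theorem IsDiffeo.invFun_apply {T : E d → E d} (hT : IsDiffeo T) (z : E d) :
    Function.invFun T (T z) = z := Function.leftInverse_invFun hT.bijective.1 z

theorem IsDiffeo.apply_invFun {T : E d → E d} (hT : IsDiffeo T) (x : E d) :
    T (Function.invFun T x) = x := Function.rightInverse_invFun hT.bijective.2 x

theorem IsDiffeo.comp {T S : E d → E d} (hT : IsDiffeo T) (hS : IsDiffeo S) :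
    IsDiffeo (fun z => T (S z)) :=
  ⟨hT.1.comp hS.1, fun x => Function.invFun S (Function.invFun T x),
    hS.contDiff_invFun.comp hT.contDiff_invFun,
    fun z => by simp [hT.invFun_apply, hS.invFun_apply],
    fun z => by simp [hT.apply_invFun, hS.apply_invFun]⟩

theorem IsDiffeo.fderiv_comp_invFun {T : E d → E d} (hT : IsDiffeo T) (x : E d) :
    (fderiv ℝ T (Function.invFun T x)).comp (fderiv ℝ (Function.invFun T) x) =
      ContinuousLinearMap.id ℝ (E d) := by
  have h1 : DifferentiableAt ℝ T (Function.invFun T x) :=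
    hT.1.contDiffAt.differentiableAt (by simp)
  have h2 : DifferentiableAt ℝ (Function.invFun T) x :=
    hT.contDiff_invFun.contDiffAt.differentiableAt (by simp)
  rw [← fderiv_comp x h1 h2]
  have : T ∘ Function.invFun T = id := funext hT.apply_invFun
  rw [this, fderiv_id]

theorem IsDiffeo.invFun_comp_fderiv {T : E d → E d} (hT : IsDiffeo T) (z : E d) :
    (fderiv ℝ (Function.invFun T) (T z)).comp (fderiv ℝ T z) =
      ContinuousLinearMap.id ℝ (E d) := by
  have h1 : DifferentiableAt ℝ T z := hT.1.contDiffAt.differentiableAt (by simp)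
  have h2 : DifferentiableAt ℝ (Function.invFun T) (T z) :=
    hT.contDiff_invFun.contDiffAt.differentiableAt (by simp)
  rw [← fderiv_comp z h2 h1]
  have : Function.invFun T ∘ T = id := funext hT.invFun_apply
  rw [this, fderiv_id]

theorem IsDiffeo.fderiv_comp_invFun' {T : E d → E d} (hT : IsDiffeo T) (z : E d) :
    (fderiv ℝ T z).comp (fderiv ℝ (Function.invFun T) (T z)) =
      ContinuousLinearMap.id ℝ (E d) := by
  have := hT.fderiv_comp_invFun (T z)
  rwa [hT.invFun_apply] at this

theorem IsDiffeo.isInvertible_fderiv {T : E d → E d} (hT : IsDiffeo T) (z : E d) :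
    (fderiv ℝ T z).IsInvertible :=
  ⟨ContinuousLinearEquiv.equivOfInverse (fderiv ℝ T z) (fderiv ℝ (Function.invFun T) (T z))
    (fun v => by simpa using congrArg (fun A => A v) (hT.invFun_comp_fderiv z))
    (fun v => by simpa using congrArg (fun A => A v) (hT.fderiv_comp_invFun' z)), rfl⟩

theorem det_comp (A B : E d →L[ℝ] E d) : (A.comp B).det = A.det * B.det := by
  simp [ContinuousLinearMap.det, LinearMap.det_comp]

theorem det_clm_id : (ContinuousLinearMap.id ℝ (E d)).det = 1 := by
  simp [ContinuousLinearMap.det]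

theorem IsDiffeo.det_invFun_mul {T : E d → E d} (hT : IsDiffeo T) (x : E d) :
    (fderiv ℝ T (Function.invFun T x)).det * (fderiv ℝ (Function.invFun T) x).det = 1 := by
  rw [← det_comp, hT.fderiv_comp_invFun, det_clm_id]

theorem IsDiffeo.det_invFun_ne_zero {T : E d → E d} (hT : IsDiffeo T) (x : E d) :
    (fderiv ℝ (Function.invFun T) x).det ≠ 0 :=
  right_ne_zero_of_mul_eq_one (hT.det_invFun_mul x)

/-! ### Families of diffeomorphisms depending smoothly on a parameter -/

section Family

variable {P : Type*} [NormedAddCommGroup P] [NormedSpace ℝ P] [CompleteSpace P]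
  {T : P → E d → E d} {U : Set P}

/-- The inverses of a smooth family of diffeomorphisms form a smooth family. -/
theorem contDiffOn_invFun (hT : ContDiff ℝ ∞ fun q : P × E d => T q.1 q.2)
    (hU : ∀ p ∈ U, IsDiffeo (T p)) :
    ContDiffOn ℝ ∞ (fun q : P × E d => Function.invFun (T q.1) q.2) (U ×ˢ univ) := by
  rintro ⟨p, x⟩ ⟨hp, -⟩
  have hD := hU p hp
  set z := Function.invFun (T p) x with hz
  -- The implicit function theorem is applied to `T_p(z) - x = 0`, solved for `z` near the given
  -- point. Since `T_p` is injective, the local solution must be the inverse image.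
  let f : (P × E d) × E d → E d := fun w => T w.1.1 w.2 - w.1.2
  have hf : ContDiff ℝ ∞ f :=
    (hT.comp ((contDiff_fst.comp contDiff_fst).prodMk contDiff_snd)).sub
      (contDiff_snd.comp contDiff_fst)
  have hinr : (fderiv ℝ f ((p, x), z)).comp (ContinuousLinearMap.inr ℝ (P × E d) (E d)) =
      fderiv ℝ (T p) z := by
    have h1 : HasFDerivAt f (fderiv ℝ f ((p, x), z)) ((p, x), z) :=
      (hf.contDiffAt.differentiableAt (by simp)).hasFDerivAt
    have h2 := h1.comp z (hasFDerivAt_prodMk_right (p, x) z)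
    have h3 : HasFDerivAt (fun y => T p y - x) (fderiv ℝ (T p) z) z :=
      ((hD.1.contDiffAt.differentiableAt (by simp)).hasFDerivAt).sub_const x
    exact h2.unique h3
  have hinv : ((fderiv ℝ f ((p, x), z)).comp
      (ContinuousLinearMap.inr ℝ (P × E d) (E d))).IsInvertible := by
    rw [hinr]; exact hD.isInvertible_fderiv z
  have hfa : ContDiffAt ℝ ∞ f ((p, x), z) := hf.contDiffAt
  refine ((hfa.contDiffAt_implicitFunction (by simp) hinv).contDiffWithinAt
    (s := U ×ˢ univ)).congr_of_eventuallyEq ?_ ?_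
  · have := hfa.eventually_apply_implicitFunction (by simp) hinv
    filter_upwards [mem_nhdsWithin_of_mem_nhds this, self_mem_nhdsWithin] with q hq hqU
    have h0 : f ((p, x), z) = 0 := by simp [f, hz, hD.apply_invFun]
    rw [h0] at hq
    have hq' := sub_eq_zero.1 hq
    rw [← hq']
    exact (hU q.1 hqU.1).invFun_apply _
  · exact (hfa.implicitFunction_apply_self (by simp) hinv).symm

/-- The push-forward densities of a smooth family of diffeomorphisms form a smooth family. -/
theorem contDiffOn_push {lam : E d → ℝ} (hlam : ContDiff ℝ ∞ lam)
    (hUd : UniqueDiffOn ℝ U) (hT : ContDiff ℝ ∞ fun q : P × E d => T q.1 q.2)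
    (hU : ∀ p ∈ U, IsDiffeo (T p)) :
    ContDiffOn ℝ ∞ (fun q : P × E d => push (T q.1) lam q.2) (U ×ˢ univ) := by
  have h1 := contDiffOn_invFun hT hU
  have h2 := contDiffOn_fderiv_snd hUd h1
  refine (hlam.comp_contDiffOn h1).mul fun q hq => ?_
  exact ((contDiff_det.contDiffAt.comp_contDiffWithinAt q (h2 q hq))).abs
    ((hU q.1 hq.1).det_invFun_ne_zero q.2)

end Family

theorem IsDiffeo.contDiff_push {T : E d → E d} (hT : IsDiffeo T) {lam : E d → ℝ}
    (hlam : ContDiff ℝ ∞ lam) : ContDiff ℝ ∞ (push T lam) := by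
  refine (hlam.comp hT.contDiff_invFun).mul (contDiff_iff_contDiffAt.2 fun x => ?_)
  refine ContDiffAt.abs ?_ (hT.det_invFun_ne_zero x)
  exact (contDiff_det.comp (hT.contDiff_invFun.fderiv_right (by simp))).contDiffAt

theorem IsDiffeo.push_pos {T : E d → E d} (hT : IsDiffeo T) {lam : E d → ℝ}
    (hpos : ∀ z, 0 < lam z) (x : E d) : 0 < push T lam x :=
  mul_pos (hpos _) (abs_pos.2 (hT.det_invFun_ne_zero x))

/-- This is the change of variables formula for the inverse map. It needs neither measurability nor
integrability of `f`. -/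
theorem IsDiffeo.integral_mul_push {T : E d → E d} (hT : IsDiffeo T) (lam f : E d → ℝ) :
    ∫ x, f x * push T lam x = ∫ z, f (T z) * lam z := by
  have h := integral_image_eq_integral_abs_det_fderiv_smul volume MeasurableSet.univ
    (f := Function.invFun T) (f' := fderiv ℝ (Function.invFun T)) (fun x _ =>
      (hT.contDiff_invFun.contDiffAt.differentiableAt (by simp)).hasFDerivAt.hasFDerivWithinAt)
    (fun x _ y _ hxy => by rw [← hT.apply_invFun x, hxy, hT.apply_invFun])
    (fun z => f (T z) * lam z)
  have hr : Function.invFun T '' univ = univ := by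
    rw [image_univ, range_eq_univ]
    exact fun z => ⟨T z, hT.invFun_apply z⟩
  rw [hr, setIntegral_univ, setIntegral_univ] at h
  rw [h]
  refine integral_congr_ae (Eventually.of_forall fun x => ?_)
  simp only [push, hT.apply_invFun, smul_eq_mul]
  ring

theorem IsDiffeo.integrable_mul_push {T : E d → E d} (hT : IsDiffeo T) (lam f : E d → ℝ) :
    Integrable (fun x => f x * push T lam x) ↔ Integrable (fun z => f (T z) * lam z) := by
  have h := integrableOn_image_iff_integrableOn_abs_det_fderiv_smul volume MeasurableSet.univ
    (f := Function.invFun T) (f' := fderiv ℝ (Function.invFun T)) (fun x _ =>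
      (hT.contDiff_invFun.contDiffAt.differentiableAt (by simp)).hasFDerivAt.hasFDerivWithinAt)
    (fun x _ y _ hxy => by rw [← hT.apply_invFun x, hxy, hT.apply_invFun])
    (fun z => f (T z) * lam z)
  have hr : Function.invFun T '' univ = univ := by
    rw [image_univ, range_eq_univ]
    exact fun z => ⟨T z, hT.invFun_apply z⟩
  rw [hr, integrableOn_univ, integrableOn_univ] at h
  rw [h]
  refine integrable_congr (Eventually.of_forall fun x => ?_)
  simp only [push, hT.apply_invFun, smul_eq_mul]
  ring

/-! ### Compactly supported perturbations -/

/-- Off `K` the integrand does not move, so that part of the integral is a constant and all the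
analysis takes place on a compact set. Integrability is needed only at the base parameter. -/
theorem hasDerivAt_integral_of_eq_off_compact {X : Type*} [TopologicalSpace X] [T2Space X]
    [TopologicalSpace.PseudoMetrizableSpace X] [MeasurableSpace X] [BorelSpace X]
    {μ : Measure X} [IsFiniteMeasureOnCompacts μ] {K : Set X} (hK : IsCompact K) {J : Set ℝ}
    {e : ℝ} (hJ : J ∈ 𝓝 e) {f f' : ℝ → X → ℝ} (hf : ∀ s ∈ J, ContinuousOn (f s) K)
    (hf' : ContinuousOn (fun q : ℝ × X => f' q.1 q.2) (J ×ˢ K))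
    (hd : ∀ s ∈ J, ∀ x ∈ K, HasDerivAt (fun r => f r x) (f' s x) s)
    (hint : Integrable (f e) μ) (hoff : ∀ s ∈ J, ∀ x ∉ K, f s x = f e x)
    (hoff' : ∀ x ∉ K, f' e x = 0) :
    HasDerivAt (fun s => ∫ x, f s x ∂μ) (∫ x, f' e x ∂μ) e := by
  have h := (hasDerivAt_setIntegral_of_isCompact (μ := μ) hK hJ hf hf' hd).add_const
    (∫ x in Kᶜ, f e x ∂μ)
  rw [← setIntegral_eq_integral_of_forall_compl_eq_zero hoff']
  refine h.congr_of_eventuallyEq ?_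
  filter_upwards [hJ] with s hs
  have hc : EqOn (f s) (f e) Kᶜ := fun x hx => hoff s hs x hx
  have h1 : IntegrableOn (f s) K μ := (hf s hs).integrableOn_compact hK
  have h2 : IntegrableOn (f s) Kᶜ μ :=
    (hint.integrableOn (s := Kᶜ)).congr_fun hc.symm hK.measurableSet.compl
  have h3 : Integrable (f s) μ := by
    rw [← integrableOn_univ, ← union_compl_self K]
    exact h1.union h2
  rw [← integral_add_compl hK.measurableSet h3, setIntegral_congr_fun hK.measurableSet.compl hc]

theorem integrable_of_eq_off_compact {X : Type*} [TopologicalSpace X] [T2Space X]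
    [MeasurableSpace X] [BorelSpace X] {μ : Measure X} [IsFiniteMeasureOnCompacts μ]
    {K : Set X} (hK : IsCompact K) {f g : X → ℝ} (hf : Integrable f μ)
    (hg : Continuous g) (h : ∀ x ∉ K, g x = f x) : Integrable g μ := by
  rw [← integrableOn_univ, ← union_compl_self K]
  refine (hg.continuousOn.integrableOn_compact hK).union ?_
  exact (hf.integrableOn (s := Kᶜ)).congr_fun (fun x hx => (h x hx).symm) hK.measurableSet.compl

/-- The quotient `h / ρ` is bounded by some `|C|` on the compact support of `h`, so `|ε| (|C| + 1) <
1` keeps `1 + ε h / ρ` positive. -/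
theorem exists_forall_pos_add_mul {ρ h : E d → ℝ} (hρ : Continuous ρ) (hpos : ∀ x, 0 < ρ x)
    (hh : Continuous h) (hs : HasCompactSupport h) :
    ∃ δ > 0, ∀ ε : ℝ, |ε| < δ → ∀ x, 0 < ρ x + ε * h x := by
  obtain ⟨C, hC⟩ := hs.exists_bound_of_continuousOn (f := fun x => h x / ρ x)
    (hh.div hρ fun x => (hpos x).ne').continuousOn
  refine ⟨1 / (|C| + 1), by positivity, fun ε hε x => ?_⟩
  by_cases hx : x ∈ tsupport h
  · have h1 : |h x / ρ x| ≤ |C| := (hC x hx).trans (le_abs_self C)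
    have h2 : |ε| * (|C| + 1) < 1 := by rwa [lt_div_iff₀ (by positivity)] at hε
    have h3 : |ε * (h x / ρ x)| < 1 := by
      rw [abs_mul]
      nlinarith [abs_nonneg ε, abs_nonneg C]
    have h4 : ρ x + ε * h x = ρ x * (1 + ε * (h x / ρ x)) := by
      have := (hpos x).ne'
      field_simp
    rw [h4]
    exact mul_pos (hpos x) (by linarith [(abs_lt.1 h3).1])
  · simpa [image_eq_zero_of_notMem_tsupport hx] using hpos x

/-- A perturbation of the identity with Lipschitz constant below one is a homeomorphism, and its
derivative is invertible by the Neumann series, so the inverse is smooth. -/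
theorem isDiffeo_id_add {v : E d → E d} (hv : ContDiff ℝ ∞ v) {c : ℝ} (hc : c < 1)
    (hb : ∀ x, ‖fderiv ℝ v x‖ ≤ c) : IsDiffeo (fun x => x + v x) := by
  lift c to NNReal using (norm_nonneg _).trans (hb 0)
  have hL : LipschitzWith c v :=
    lipschitzWith_of_nnnorm_fderiv_le (hv.differentiable (by simp)) hb
  have ha : ApproximatesLinearOn (fun x => x + v x)
      ((ContinuousLinearEquiv.refl ℝ (E d) : E d ≃L[ℝ] E d) : E d →L[ℝ] E d) univ c := by
    intro x _ y _
    have := hL.dist_le_mul x y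
    rw [dist_eq_norm, dist_eq_norm] at this
    refine le_of_eq_of_le ?_ this
    congr 1
    change x + v x - (y + v y) - (x - y) = v x - v y
    abel
  -- In dimension zero the identity has norm zero rather than one, so this case is separate.
  have hcN : Subsingleton (E d) ∨
      c < ‖((ContinuousLinearEquiv.refl ℝ (E d)).symm : E d →L[ℝ] E d)‖₊⁻¹ := by
    rcases subsingleton_or_nontrivial (E d) with h | h
    · exact Or.inl h
    · right
      have : ‖((ContinuousLinearEquiv.refl ℝ (E d)).symm : E d →L[ℝ] E d)‖₊ = 1 := by
        ext; exact ContinuousLinearMap.norm_id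
      rw [this]; simpa using hc
  have hsm : ContDiff ℝ ∞ (fun x => x + v x) := contDiff_id.add hv
  let H := ha.toHomeomorph (fun x => x + v x) hcN
  have hu : ∀ x, ‖-fderiv ℝ v x‖ < 1 := fun x => by
    rw [norm_neg]
    exact lt_of_le_of_lt (hb x) hc
  refine ⟨hsm, H.symm, ?_, H.symm_apply_apply, H.apply_symm_apply⟩
  refine H.contDiff_symm (f₀' := fun x =>
    ContinuousLinearEquiv.ofUnit (Units.oneSub (-fderiv ℝ v x) (hu x))) (fun x => ?_) hsm
  have h1 : HasFDerivAt (fun x => x + v x) (ContinuousLinearMap.id ℝ (E d) + fderiv ℝ v x) x :=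
    (hasFDerivAt_id x).add (hv.contDiffAt.differentiableAt (by simp)).hasFDerivAt
  refine h1.congr_fderiv ?_
  change _ = (1 - -fderiv ℝ v x : E d →L[ℝ] E d)
  rw [sub_neg_eq_add]
  rfl

/-- A small compactly supported perturbation of a compact family of diffeomorphisms is a family
of diffeomorphisms. -/
theorem exists_forall_isDiffeo_add_smul {P : Type*} [NormedAddCommGroup P] [NormedSpace ℝ P]
    [CompleteSpace P] {T ξ : P → E d → E d} {U : Set P} (hUd : UniqueDiffOn ℝ U)
    (hUc : IsCompact U) (hT : ContDiff ℝ ∞ fun q : P × E d => T q.1 q.2)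
    (hU : ∀ p ∈ U, IsDiffeo (T p)) (hξ : ContDiff ℝ ∞ fun q : P × E d => ξ q.1 q.2)
    {K : Set (E d)} (hK : IsCompact K) (hs : ∀ p ∈ U, ∀ z ∉ K, ξ p z = 0) :
    ∃ δ > 0, ∀ ε : ℝ, |ε| < δ → ∀ p ∈ U, IsDiffeo (fun z => T p z + ε • ξ p z) := by
  -- Write `T + ε ξ = (id + ε v) ∘ T` with `v = ξ ∘ T⁻¹`. The derivative of `v` vanishes off the
  -- compact image of `U ×ˢ K`, so it is bounded uniformly in the parameter and `id + ε v` is a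
  -- diffeomorphism for small `ε`.
  let v : P × E d → E d := fun q => ξ q.1 (Function.invFun (T q.1) q.2)
  have hv : ContDiffOn ℝ ∞ v (U ×ˢ univ) :=
    hξ.comp_contDiffOn (contDiffOn_fst.prodMk (contDiffOn_invFun hT hU))
  have hDv := contDiffOn_fderiv_snd hUd hv
  have hC : IsCompact ((fun q : P × E d => (q.1, T q.1 q.2)) '' (U ×ˢ K)) :=
    (hUc.prod hK).image (continuous_fst.prodMk hT.continuous)
  obtain ⟨C, hCb⟩ := hC.exists_bound_of_continuousOn (hDv.continuousOn.mono (by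
    rintro _ ⟨q, hq, rfl⟩
    exact ⟨hq.1, mem_univ _⟩))
  have hb : ∀ p ∈ U, ∀ x, ‖fderiv ℝ (fun y => v (p, y)) x‖ ≤ |C| := by
    intro p hp x
    by_cases hx : x ∈ T p '' K
    · obtain ⟨z, hz, rfl⟩ := hx
      exact (hCb (p, T p z) ⟨(p, z), ⟨hp, hz⟩, rfl⟩).trans (le_abs_self C)
    · have hTc : Continuous (T p) := (hU p hp).1.continuous
      have ho : (T p '' K)ᶜ ∈ 𝓝 x := (hK.image hTc).isClosed.isOpen_compl.mem_nhds hx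
      have : (fun y => v (p, y)) =ᶠ[𝓝 x] fun _ => 0 := by
        filter_upwards [ho] with y hy
        refine hs p hp _ fun hmem => hy ⟨_, hmem, (hU p hp).apply_invFun y⟩
      rw [this.fderiv_eq]
      simp
  refine ⟨1 / (|C| + 1), by positivity, fun ε hε p hp => ?_⟩
  have hvp : ContDiff ℝ ∞ (fun y => v (p, y)) := by
    have hξp : ContDiff ℝ ∞ (ξ p) := hξ.comp (contDiff_const.prodMk contDiff_id)
    exact hξp.comp (hU p hp).contDiff_invFun
  have h1 : IsDiffeo (fun x => x + ε • v (p, x)) := by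
    refine isDiffeo_id_add (c := |ε| * |C|) (hvp.const_smul ε) ?_
      fun x => ?_
    · rw [lt_div_iff₀ (by positivity)] at hε
      nlinarith [abs_nonneg ε]
    · have : fderiv ℝ (fun y => ε • v (p, y)) x = ε • fderiv ℝ (fun y => v (p, y)) x :=
        fderiv_const_smul (hvp.contDiffAt.differentiableAt (by simp)) ε
      rw [this, norm_smul, Real.norm_eq_abs]
      exact mul_le_mul_of_nonneg_left (hb p hp x) (abs_nonneg _)
  have h2 := h1.comp (hU p hp)
  simpa [v, (hU p hp).invFun_apply] using h2

theorem invFun_eq_of_eq_off {T Y : E d → E d} (hT : IsDiffeo T) (hY : IsDiffeo Y)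
    {K : Set (E d)} (h : ∀ z ∉ K, Y z = T z) {x : E d} (hx : x ∉ T '' K) :
    Function.invFun Y x = Function.invFun T x := by
  have hz : Function.invFun T x ∉ K := fun hm => hx ⟨_, hm, hT.apply_invFun x⟩
  have h1 := h _ hz
  rw [hT.apply_invFun] at h1
  conv_lhs => rw [← h1]
  exact hY.invFun_apply _

/-- The push-forward involves a derivative of the inverse, so agreement of the inverses is needed on
a neighbourhood. The complement of the compact set `T '' K` is open and supplies it. -/
theorem push_eq_of_eq_off {T Y : E d → E d} (hT : IsDiffeo T) (hY : IsDiffeo Y)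
    {K : Set (E d)} (hK : IsCompact K) (h : ∀ z ∉ K, Y z = T z) (lam : E d → ℝ) {x : E d}
    (hx : x ∉ T '' K) : push Y lam x = push T lam x := by
  have ho : (T '' K)ᶜ ∈ 𝓝 x := (hK.image hT.1.continuous).isClosed.isOpen_compl.mem_nhds hx
  have he : Function.invFun Y =ᶠ[𝓝 x] Function.invFun T := by
    filter_upwards [ho] with y hy using invFun_eq_of_eq_off hT hY h hy
  simp only [push, he.fderiv_eq, he.eq_of_nhds]

theorem IsDiffeo.integrable_push {T : E d → E d} (hT : IsDiffeo T) {lam : E d → ℝ}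
    (hlam : Integrable lam) : Integrable (push T lam) := by
  have := (hT.integrable_mul_push lam (fun _ => 1)).2 (by simpa using hlam)
  simpa using this

theorem IsDiffeo.integral_push {T : E d → E d} (hT : IsDiffeo T) (lam : E d → ℝ) :
    ∫ x, push T lam x = ∫ z, lam z := by
  simpa using hT.integral_mul_push lam (fun _ => 1)

/-- Both push-forwards carry the mass of `λ` and they agree off a compact set. This is what lets
`IsEnergy.perturb` keep varied densities in the energy domain. -/
theorem push_sub_mem_testFunZero {T Y : E d → E d} (hT : IsDiffeo T) (hY : IsDiffeo Y)
    {K : Set (E d)} (hK : IsCompact K) (h : ∀ z ∉ K, Y z = T z) {lam : E d → ℝ}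
    (hlam : ContDiff ℝ ∞ lam) (hint : Integrable lam) :
    (fun x => push Y lam x - push T lam x) ∈ testFunZero d := by
  refine ⟨⟨(hY.contDiff_push hlam).sub (hT.contDiff_push hlam), ?_⟩, ?_⟩
  · refine HasCompactSupport.intro (hK.image hT.1.continuous) fun x hx => ?_
    rw [push_eq_of_eq_off hT hY hK h lam hx, sub_self]
  · rw [integral_sub (hY.integrable_push hint) (hT.integrable_push hint), hY.integral_push,
      hT.integral_push, sub_self]

theorem IsEnergy.push_mem {D : Set (E d → ℝ)} {F : (E d → ℝ) → ℝ} {δF : (E d → ℝ) → E d → ℝ}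
    (hF : IsEnergy D F δF) {T Y : E d → E d} (hT : IsDiffeo T) (hY : IsDiffeo Y)
    {K : Set (E d)} (hK : IsCompact K) (h : ∀ z ∉ K, Y z = T z) {lam : E d → ℝ}
    (hlam : ContDiff ℝ ∞ lam) (hpos : ∀ z, 0 < lam z) (hint : Integrable lam)
    (hD : push T lam ∈ D) : push Y lam ∈ D := by
  have := hF.perturb _ hD _ (push_sub_mem_testFunZero hT hY hK h hlam hint)
    (fun x => by simpa using hY.push_pos hpos x)
  simpa using this

/-! ### Integration by parts -/

theorem divergence_eq_sum (w : E d → E d) (x : E d) :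
    divergence w x = ∑ i, ⟪EuclideanSpace.basisFun (Fin d) ℝ i,
      fderiv ℝ w x (EuclideanSpace.basisFun (Fin d) ℝ i)⟫ := by
  rw [divergence, LinearMap.trace_eq_sum_inner _ (EuclideanSpace.basisFun (Fin d) ℝ)]
  rfl

/-- Integration by parts in each coordinate direction, summed over the standard basis. Regularity
`C¹` suffices, which is all that is available for a first variation. -/
theorem integral_fderiv_apply_eq {f : E d → ℝ} {w : E d → E d} (hf : ContDiff ℝ 1 f)
    (hw : ContDiff ℝ 1 w) (hs : HasCompactSupport f ∨ HasCompactSupport w) :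
    ∫ x, fderiv ℝ f x (w x) = -∫ x, f x * divergence w x := by
  let b := EuclideanSpace.basisFun (Fin d) ℝ
  have hwi : ∀ i, ContDiff ℝ 1 (fun x => ⟪b i, w x⟫) := fun i => contDiff_const.inner ℝ hw
  have hdf : Continuous (fderiv ℝ f) := hf.continuous_fderiv (by simp)
  have hdw : ∀ i, Continuous (fderiv ℝ (fun x => ⟪b i, w x⟫)) :=
    fun i => (hwi i).continuous_fderiv (by simp)
  have hcs : HasCompactSupport f ∨ ∀ i, HasCompactSupport (fun x => ⟪b i, w x⟫) :=
    hs.imp_right fun h i => h.mono fun x hx => by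
      contrapose! hx
      simp [Function.notMem_support.1 hx]
  have hint : ∀ (i : Fin d) (g k : E d → ℝ), Continuous g → Continuous k →
      HasCompactSupport g ∨ HasCompactSupport k → Integrable (fun x => g x * k x) := by
    intro i g k hg hk h
    refine (hg.mul hk).integrable_of_hasCompactSupport ?_
    rcases h with h | h
    · exact h.mul_right
    · exact h.mul_left
  have hdfs : ∀ i, HasCompactSupport f → HasCompactSupport (fun x => fderiv ℝ f x (b i)) :=
    fun i h => h.fderiv_apply ℝ (b i)
  have h1 : ∀ i, Integrable fun x => fderiv ℝ f x (b i) * ⟪b i, w x⟫ := fun i =>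
    hint i _ _ (hdf.clm_apply continuous_const) (hwi i).continuous
      (hcs.imp (hdfs i) fun h => h i)
  have h2 : ∀ i, Integrable fun x => f x * fderiv ℝ (fun x => ⟪b i, w x⟫) x (b i) := fun i =>
    hint i _ _ hf.continuous ((hdw i).clm_apply continuous_const)
      (hcs.imp_right fun h => (h i).fderiv_apply ℝ (b i))
  have e1 : ∀ x, fderiv ℝ f x (w x) = ∑ i, fderiv ℝ f x (b i) * ⟪b i, w x⟫ := fun x => by
    conv_lhs => rw [← b.sum_repr' (w x)]
    simp [map_sum, mul_comm]
  have e2 : ∀ x, f x * divergence w x =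
      ∑ i, f x * fderiv ℝ (fun x => ⟪b i, w x⟫) x (b i) := fun x => by
    rw [divergence_eq_sum, Finset.mul_sum]
    refine Finset.sum_congr rfl fun i _ => ?_
    congr 1
    have : HasFDerivAt (fun x => ⟪b i, w x⟫) ((innerSL ℝ (b i)).comp (fderiv ℝ w x)) x :=
      (innerSL ℝ (b i)).hasFDerivAt.comp x
        (hw.contDiffAt.differentiableAt (by simp)).hasFDerivAt
    rw [this.fderiv]
    simp [b]
  simp_rw [e1, e2]
  rw [integral_finsetSum _ fun i _ => h1 i, integral_finsetSum _ fun i _ => h2 i,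
    ← Finset.sum_neg_distrib]
  refine Finset.sum_congr rfl fun i _ => ?_
  have := integral_mul_fderiv_eq_neg_fderiv_mul_of_integrable (μ := (volume : Measure (E d)))
    (h1 i) (h2 i) (hint i _ _ hf.continuous (hwi i).continuous (hcs.imp_right fun h => h i))
    (fun x _ => hf.contDiffAt.differentiableAt (by simp))
    (fun x _ => (hwi i).contDiffAt.differentiableAt (by simp))
  rw [this, neg_neg]

theorem norm_gradient (f : E d → ℝ) (x : E d) : ‖∇ f x‖ = ‖fderiv ℝ f x‖ := by
  rw [← toDual_gradient, LinearIsometryEquiv.norm_map]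

theorem contDiff_gradient {f : E d → ℝ} {m n : WithTop ℕ∞} (hf : ContDiff ℝ n f)
    (hmn : m + 1 ≤ n) : ContDiff ℝ m (∇ f) :=
  (InnerProductSpace.toDual ℝ (E d)).symm.contDiff.comp (hf.fderiv_right hmn)

theorem laplacian_eq_divergence {f : E d → ℝ} {x : E d} (hf : ContDiffAt ℝ 2 f x) :
    Laplacian.laplacian f x = divergence (∇ f) x := by
  rw [divergence_eq_sum, InnerProductSpace.laplacian_eq_iteratedFDeriv_orthonormalBasis f
    (EuclideanSpace.basisFun (Fin d) ℝ)]
  refine Finset.sum_congr rfl fun i _ => ?_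
  have h1 : HasFDerivAt (fderiv ℝ f) (fderiv ℝ (fderiv ℝ f) x) x :=
    ((hf.fderiv_right (m := 1) (by norm_num)).differentiableAt (by simp)).hasFDerivAt
  have h2 := ((InnerProductSpace.toDual ℝ (E d)).symm.toContinuousLinearEquiv.toContinuousLinearMap
    |>.hasFDerivAt).comp x h1
  have h3 : fderiv ℝ (∇ f) x = _ := h2.fderiv
  rw [h3, iteratedFDeriv_two_apply]
  rw [real_inner_comm]
  exact (InnerProductSpace.toDual_symm_apply).symm

/-! ### The Fisher information -/

theorem two_le_infty : (2 : WithTop ℕ∞) ≤ ∞ := by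
  exact WithTop.coe_le_coe.2 (le_top : (2 : ℕ∞) ≤ ⊤)

theorem divergence_smul {f : E d → ℝ} {w : E d → E d} {x : E d} (hf : DifferentiableAt ℝ f x)
    (hw : DifferentiableAt ℝ w x) :
    divergence (fun y => f y • w y) x = f x * divergence w x + fderiv ℝ f x (w x) := by
  have h : fderiv ℝ (fun y => f y • w y) x = f x • fderiv ℝ w x + (fderiv ℝ f x).smulRight (w x) :=
    (hf.hasFDerivAt.smul hw.hasFDerivAt).fderiv
  conv_rhs => rw [← (EuclideanSpace.basisFun (Fin d) ℝ).sum_repr' (w x)]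
  rw [divergence_eq_sum, divergence_eq_sum, h, map_sum, Finset.mul_sum, ← Finset.sum_add_distrib]
  refine Finset.sum_congr rfl fun i _ => ?_
  simp only [add_apply, smul_apply, ContinuousLinearMap.smulRight_apply, inner_add_right,
    real_inner_smul_right, map_smul, smul_eq_mul]
  ring

theorem gradient_log {ρ : E d → ℝ} {x : E d} (hρ : DifferentiableAt ℝ ρ x) (h0 : ρ x ≠ 0) :
    ∇ (fun y => Real.log (ρ y)) x = (ρ x)⁻¹ • ∇ ρ x := by
  have h := (hρ.hasFDerivAt.log h0).hasGradientAt.gradient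
  rw [h, map_smul]
  rfl

theorem contDiff_log {ρ : E d → ℝ} (hρ : ContDiff ℝ ∞ ρ) (hpos : ∀ x, 0 < ρ x) :
    ContDiff ℝ ∞ (fun y => Real.log (ρ y)) := hρ.log fun x => (hpos x).ne'

theorem fisher_integrand_eq {ρ : E d → ℝ} (hρ : ContDiff ℝ ∞ ρ) (hpos : ∀ x, 0 < ρ x) (x : E d) :
    ‖∇ (fun y => Real.log (ρ y)) x‖ ^ 2 * ρ x = ‖∇ ρ x‖ ^ 2 / ρ x := by
  have := hpos x
  rw [gradient_log (hρ.contDiffAt.differentiableAt (by simp)) this.ne', norm_smul, mul_pow,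
    norm_inv, Real.norm_eq_abs, abs_of_pos this]
  field_simp

theorem gradient_add_mul {ρ h : E d → ℝ} (hρ : ContDiff ℝ ∞ ρ) (hh : ContDiff ℝ ∞ h) (s : ℝ)
    (x : E d) : ∇ (fun y => ρ y + s * h y) x = ∇ ρ x + s • ∇ h x := by
  have h1 : HasFDerivAt (fun y => ρ y + s * h y) (fderiv ℝ ρ x + s • fderiv ℝ h x) x :=
    ((hρ.contDiffAt.differentiableAt (by simp)).hasFDerivAt).add
      ((hh.contDiffAt.differentiableAt (by simp)).hasFDerivAt.const_mul s)
  rw [h1.hasGradientAt.gradient, map_add, map_smul]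
  rfl

theorem laplacian_log {ρ : E d → ℝ} (hρ : ContDiff ℝ ∞ ρ) (hpos : ∀ x, 0 < ρ x) (x : E d) :
    Laplacian.laplacian (fun y => Real.log (ρ y)) x =
      Laplacian.laplacian ρ x / ρ x - ‖∇ ρ x‖ ^ 2 / ρ x ^ 2 := by
  have hx := (hpos x).ne'
  have hd : DifferentiableAt ℝ ρ x := hρ.contDiffAt.differentiableAt (by simp)
  rw [laplacian_eq_divergence ((contDiff_log hρ hpos).contDiffAt.of_le two_le_infty),
    laplacian_eq_divergence (hρ.contDiffAt.of_le two_le_infty)]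
  have h1 : ∇ (fun y => Real.log (ρ y)) = fun y => (ρ y)⁻¹ • ∇ ρ y := funext fun y =>
    gradient_log (hρ.contDiffAt.differentiableAt (by simp)) (hpos y).ne'
  have hg : ContDiff ℝ ∞ (∇ ρ) := contDiff_gradient hρ (by simp)
  rw [h1, divergence_smul (f := fun y => (ρ y)⁻¹) (hd.inv hx) (hg.contDiffAt.differentiableAt (by simp))]
  have h2 : HasFDerivAt (fun y => (ρ y)⁻¹) (-(ρ x ^ 2)⁻¹ • fderiv ℝ ρ x) x :=
    (hasDerivAt_inv hx).comp_hasFDerivAt x hd.hasFDerivAt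
  rw [h2.fderiv]
  simp only [smul_apply, smul_eq_mul]
  rw [← inner_gradient_left, real_inner_self_eq_norm_sq]
  field_simp
  ring

/-- Without the logarithm the quantum potential is a rational expression in `ρ`, `∇ρ` and `Δρ`, each
of which converges when densities converge smoothly. -/
theorem fisherVariation_eq {ρ : E d → ℝ} (hρ : ContDiff ℝ ∞ ρ) (hpos : ∀ x, 0 < ρ x) (x : E d) :
    fisherVariation ρ x = -2 * (Laplacian.laplacian ρ x / ρ x) + ‖∇ ρ x‖ ^ 2 / ρ x ^ 2 := by
  have := hpos x
  rw [fisherVariation, laplacian_log hρ hpos,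
    gradient_log (hρ.contDiffAt.differentiableAt (by simp)) this.ne', norm_smul, mul_pow,
    norm_inv, Real.norm_eq_abs, abs_of_pos this]
  field_simp
  ring

theorem laplacian_eq_sum (f : E d → ℝ) (x : E d) :
    Laplacian.laplacian f x = ∑ i, iteratedFDeriv ℝ 2 f x
      ![EuclideanSpace.basisFun (Fin d) ℝ i, EuclideanSpace.basisFun (Fin d) ℝ i] := by
  rw [InnerProductSpace.laplacian_eq_iteratedFDeriv_orthonormalBasis f
    (EuclideanSpace.basisFun (Fin d) ℝ)]

theorem contDiff_laplacian {f : E d → ℝ} (hf : ContDiff ℝ ∞ f) :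
    ContDiff ℝ ∞ (Laplacian.laplacian f) := by
  have h : Laplacian.laplacian f = fun x => ∑ i, fderiv ℝ (fderiv ℝ f) x
      (EuclideanSpace.basisFun (Fin d) ℝ i) (EuclideanSpace.basisFun (Fin d) ℝ i) := by
    funext x
    rw [laplacian_eq_sum]
    simp [iteratedFDeriv_two_apply]
  rw [h]
  have h2 : ContDiff ℝ ∞ (fderiv ℝ (fderiv ℝ f)) :=
    (hf.fderiv_right (m := ∞) (by simp)).fderiv_right (by simp)
  exact ContDiff.sum fun i _ => (h2.clm_apply contDiff_const).clm_apply contDiff_const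

theorem contDiff_fisherVariation {ρ : E d → ℝ} (hρ : ContDiff ℝ ∞ ρ) (hpos : ∀ x, 0 < ρ x) :
    ContDiff ℝ ∞ (fisherVariation ρ) := by
  have hl := contDiff_log hρ hpos
  exact (contDiff_const.mul (contDiff_laplacian hl)).sub
    ((contDiff_gradient (m := ∞) hl (by simp)).norm_sq ℝ)

theorem continuous_fisher_integrand {ρ : E d → ℝ} (hρ : ContDiff ℝ ∞ ρ) (hpos : ∀ x, 0 < ρ x) :
    Continuous (fun x => ‖∇ (fun y => Real.log (ρ y)) x‖ ^ 2 * ρ x) :=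
  (((contDiff_gradient (m := ∞) (contDiff_log hρ hpos) (by simp)).continuous.norm).pow 2).mul
    hρ.continuous

theorem mem_finiteFisher_add {ρ h : E d → ℝ} (hρ : IsDensity ρ) (hf : ρ ∈ finiteFisher d)
    (hh : h ∈ testFun d) (hpos : ∀ x, 0 < ρ x + h x) : (fun x => ρ x + h x) ∈ finiteFisher d := by
  refine integrable_of_eq_off_compact hh.2 hf
    (continuous_fisher_integrand (hρ.smooth.add hh.1) hpos) fun x hx => ?_
  have he : (fun y => Real.log (ρ y + h y)) =ᶠ[𝓝 x] fun y => Real.log (ρ y) := by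
    filter_upwards [(isClosed_tsupport h).isOpen_compl.mem_nhds hx] with y hy
    rw [image_eq_zero_of_notMem_tsupport hy, add_zero]
  simp only [he.gradient_eq, image_eq_zero_of_notMem_tsupport hx, add_zero]

/-- At `s = 0` the integrand has derivative `2 ∇h · ∇ log ρ - |∇ log ρ|² h`, and integrating the
first term by parts moves the derivative onto `∇ log ρ`. Directions of nonzero mean are allowed. -/
theorem isFirstVariation_fisher {ρ : E d → ℝ} (hρ : IsDensity ρ) (hf : ρ ∈ finiteFisher d) :
    IsFirstVariation (testFun d) fisher ρ (fisherVariation ρ) := by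
  intro h hh
  have hρs := hρ.smooth
  obtain ⟨δ, hδ, hδp⟩ := exists_forall_pos_add_mul hρs.continuous hρ.pos hh.1.continuous hh.2
  let J : Set ℝ := {s | |s| < δ}
  have hJ : J ∈ 𝓝 (0 : ℝ) :=
    (isOpen_lt continuous_abs continuous_const).mem_nhds (by simpa [J] using hδ)
  have hcρ : Continuous (∇ ρ) := (contDiff_gradient (m := ∞) hρs (by simp)).continuous
  have hch : Continuous (∇ h) := (contDiff_gradient (m := ∞) hh.1 (by simp)).continuous
  -- The form `|∇ρ|² / ρ` of the Fisher integrand is rational in `s`, so it is differentiated in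
  -- place of the logarithmic form.
  let f : ℝ → E d → ℝ := fun s x => ‖∇ ρ x + s • ∇ h x‖ ^ 2 / (ρ x + s * h x)
  let f' : ℝ → E d → ℝ := fun s x => (2 * ⟪∇ ρ x + s • ∇ h x, ∇ h x⟫ * (ρ x + s * h x) -
    ‖∇ ρ x + s • ∇ h x‖ ^ 2 * h x) / (ρ x + s * h x) ^ 2
  have hft : ∀ s ∈ J, ∀ x, ‖∇ (fun y => Real.log (ρ y + s * h y)) x‖ ^ 2 * (ρ x + s * h x) =
      f s x := fun s hs x => by
    rw [fisher_integrand_eq (hρs.add (contDiff_const.mul hh.1)) (hδp s hs),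
      gradient_add_mul hρs hh.1]
  have hgz : ∀ x ∉ tsupport h, ∇ h x = 0 := fun x hx => by
    have he : h =ᶠ[𝓝 x] fun _ => 0 := by
      filter_upwards [(isClosed_tsupport h).isOpen_compl.mem_nhds hx] with y hy
      exact image_eq_zero_of_notMem_tsupport hy
    rw [he.gradient_eq, gradient_fun_const]
  have key : HasDerivAt (fun s => ∫ x, f s x) (∫ x, f' 0 x) 0 := by
    refine hasDerivAt_integral_of_eq_off_compact (K := tsupport h) hh.2 hJ ?_ ?_ ?_ ?_ ?_ ?_
    · intro s hs
      refine Continuous.continuousOn (Continuous.div ?_ ?_ fun x => (hδp s hs x).ne')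
      · exact ((hcρ.add (hch.const_smul s)).norm).pow 2
      · exact hρs.continuous.add (continuous_const.mul hh.1.continuous)
    · refine ContinuousOn.div (Continuous.continuousOn ?_) (Continuous.continuousOn ?_)
        fun q hq => pow_ne_zero 2 (hδp q.1 hq.1 q.2).ne'
      · have := hρs.continuous
        have := hh.1.continuous
        fun_prop
      · have := hρs.continuous
        have := hh.1.continuous
        fun_prop
    · intro s hs x _
      have h1 : HasDerivAt (fun r : ℝ => ∇ ρ x + r • ∇ h x) (∇ h x) s := by
        simpa using ((hasDerivAt_id s).smul_const (∇ h x)).const_add (∇ ρ x)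
      have h2 : HasDerivAt (fun r : ℝ => ρ x + r * h x) (h x) s := by
        simpa using ((hasDerivAt_id s).mul_const (h x)).const_add (ρ x)
      exact h1.norm_sq.div h2 (hδp s hs x).ne'
    · refine hf.congr (Eventually.of_forall fun x => ?_)
      have := hft 0 (mem_of_mem_nhds hJ) x
      simpa using this
    · intro s _ x hx
      simp [f, hgz x hx, image_eq_zero_of_notMem_tsupport hx]
    · intro x hx
      simp only [f', hgz x hx, image_eq_zero_of_notMem_tsupport hx, inner_zero_right]
      simp
  have hval : ∫ x, f' 0 x = ∫ x, fisherVariation ρ x * h x := by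
    have hl := contDiff_log hρs hρ.pos
    set l := fun y => Real.log (ρ y) with hl_def
    have hgl : ContDiff ℝ ∞ (∇ l) := contDiff_gradient hl (by simp)
    have e1 : ∀ x, f' 0 x = 2 * fderiv ℝ h x (∇ l x) - ‖∇ l x‖ ^ 2 * h x := fun x => by
      have hx := (hρ.pos x).ne'
      rw [gradient_log (hρs.contDiffAt.differentiableAt (by simp)) hx, map_smul,
        ← inner_gradient_left, norm_smul, mul_pow, norm_inv, Real.norm_eq_abs,
        abs_of_pos (hρ.pos x), real_inner_comm]
      simp only [f', zero_smul, add_zero, zero_mul, smul_eq_mul]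
      field_simp
    have hi1 : Integrable fun x => 2 * fderiv ℝ h x (∇ l x) := by
      refine Integrable.const_mul ?_ _
      refine Continuous.integrable_of_hasCompactSupport ?_ ?_
      · exact (hh.1.continuous_fderiv (by simp)).clm_apply hgl.continuous
      · refine (hh.2.fderiv ℝ).mono fun x hx => ?_
        contrapose! hx
        simp [Function.notMem_support.1 hx]
    have hi2 : Integrable fun x => ‖∇ l x‖ ^ 2 * h x :=
      ((hgl.continuous.norm.pow 2).mul hh.1.continuous).integrable_of_hasCompactSupport
        hh.2.mul_left
    have hi3 : Integrable fun x => h x * Laplacian.laplacian l x :=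
      (hh.1.continuous.mul (contDiff_laplacian hl).continuous).integrable_of_hasCompactSupport
        hh.2.mul_right
    have e2 : ∫ x, fderiv ℝ h x (∇ l x) = -∫ x, h x * Laplacian.laplacian l x := by
      rw [integral_fderiv_apply_eq (hh.1.of_le (by exact_mod_cast le_top))
        (hgl.of_le (by exact_mod_cast le_top)) (Or.inl hh.2)]
      congr 1
      refine integral_congr_ae (Eventually.of_forall fun x => ?_)
      simp only [laplacian_eq_divergence (hl.contDiffAt.of_le two_le_infty)]
    simp_rw [e1]
    rw [integral_sub hi1 hi2, integral_const_mul, e2, mul_neg, ← integral_const_mul,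
      ← integral_neg, ← integral_sub (f := fun x => -(2 * (h x * Laplacian.laplacian l x)))
        (hi3.const_mul 2).neg hi2]
    refine integral_congr_ae (Eventually.of_forall fun x => ?_)
    simp only [fisherVariation, hl_def]
    ring
  rw [← hval]
  refine key.congr_of_eventuallyEq ?_
  filter_upwards [hJ] with s hs
  exact integral_congr_ae (Eventually.of_forall fun x => hft s hs x)

/-- Only derivatives of order at most two enter, and the denominators converge to positive limits.
-/
theorem tendstoLocallyUniformly_fisherVariation {r : ℕ → E d → ℝ} {ρ : E d → ℝ}
    (hr : ∀ n, IsDensity (r n)) (hρ : IsDensity ρ) (h : DensityTendsto r ρ) (x : E d) :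
    Tendsto (fun q : ℕ × E d => fisherVariation (r q.1) q.2) (atTop ×ˢ 𝓝 x)
      (𝓝 (fisherVariation ρ x)) := by
  have hk : ∀ k, Tendsto (fun q : ℕ × E d => iteratedFDeriv ℝ k (r q.1) q.2) (atTop ×ˢ 𝓝 x)
      (𝓝 (iteratedFDeriv ℝ k ρ x)) := fun k =>
    (tendstoLocallyUniformly_iff_tendsto_prod
      (hρ.smooth.continuous_iteratedFDeriv (by exact_mod_cast le_top))).1 (h.1 k) x
  have h0 : Tendsto (fun q : ℕ × E d => r q.1 q.2) (atTop ×ˢ 𝓝 x) (𝓝 (ρ x)) := by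
    have := ((continuousMultilinearCurryFin0 ℝ (E d) ℝ).continuous.tendsto _).comp (hk 0)
    simpa [Function.comp_def, continuousMultilinearCurryFin0_apply] using this
  have h1 : Tendsto (fun q : ℕ × E d => ‖∇ (r q.1) q.2‖) (atTop ×ˢ 𝓝 x) (𝓝 ‖∇ ρ x‖) := by
    have := (hk 1).norm
    simpa [norm_iteratedFDeriv_one, norm_gradient] using this
  have h2 : Tendsto (fun q : ℕ × E d => Laplacian.laplacian (r q.1) q.2) (atTop ×ˢ 𝓝 x)
      (𝓝 (Laplacian.laplacian ρ x)) := by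
    simp_rw [laplacian_eq_sum]
    refine tendsto_finsetSum _ fun i _ => ?_
    exact ((ContinuousMultilinearMap.apply ℝ (fun _ : Fin 2 => E d) ℝ
      ![EuclideanSpace.basisFun (Fin d) ℝ i, EuclideanSpace.basisFun (Fin d) ℝ i]).continuous.tendsto
        _).comp (hk 2)
  have hx := (hρ.pos x).ne'
  rw [fisherVariation_eq hρ.smooth hρ.pos]
  refine (((h2.div h0 hx).const_mul (-2)).add ((h1.pow 2).div (h0.pow 2) (pow_ne_zero 2 hx))).congr
    fun q => (fisherVariation_eq (hr q.1).smooth (hr q.1).pos q.2).symm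

theorem IsEnergy.add_fisher {D : Set (E d → ℝ)} {FR : (E d → ℝ) → ℝ}
    {δFR : (E d → ℝ) → E d → ℝ} (hFR : IsEnergy D FR δFR) :
    IsEnergy (D ∩ finiteFisher d) (energy FR) (energyVariation δFR) where
  isDensity ρ hρ := hFR.isDensity ρ hρ.1
  perturb ρ hρ h hh hpos :=
    ⟨hFR.perturb ρ hρ.1 h hh hpos, mem_finiteFisher_add (hFR.isDensity ρ hρ.1) hρ.2 hh.1 hpos⟩
  contDiff ρ hρ := by
    have h1 := hFR.isDensity ρ hρ.1
    exact (hFR.contDiff ρ hρ.1).add (contDiff_const.mul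
      ((contDiff_fisherVariation h1.smooth h1.pos).of_le (by exact_mod_cast le_top)))
  variation ρ hρ h hh := by
    have h1 := hFR.isDensity ρ hρ.1
    have h2 := (hFR.variation ρ hρ.1 h hh).add
      ((isFirstVariation_fisher h1 hρ.2 h hh.1).const_mul (1 / 8))
    have hi : ∀ g : E d → ℝ, Continuous g → Integrable fun x => g x * h x := fun g hg =>
      (hg.mul hh.1.1.continuous).integrable_of_hasCompactSupport hh.1.2.mul_left
    have h3 : (∫ x, energyVariation δFR ρ x * h x) =
        (∫ x, δFR ρ x * h x) + 1 / 8 * ∫ x, fisherVariation ρ x * h x := by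
      rw [← integral_const_mul, ← integral_add (hi _ (hFR.contDiff ρ hρ.1).continuous)
        ((hi _ (contDiff_fisherVariation h1.smooth h1.pos).continuous).const_mul _)]
      refine integral_congr_ae (Eventually.of_forall fun x => ?_)
      simp only [energyVariation]
      ring
    rw [h3]
    exact h2
  continuity r ρ hr hρ h := by
    have h1 := hFR.isDensity ρ hρ.1
    have hc := (hFR.contDiff ρ hρ.1).continuous
    have hcf := (contDiff_fisherVariation h1.smooth h1.pos).continuous
    refine (tendstoLocallyUniformly_iff_tendsto_prod (f := energyVariation δFR ρ)
      (hc.add (continuous_const.mul hcf))).2 fun x => ?_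
    exact ((tendstoLocallyUniformly_iff_tendsto_prod hc).1
      (hFR.continuity r ρ (fun n => (hr n).1) hρ.1 h) x).add
      ((tendstoLocallyUniformly_fisherVariation (fun n => hFR.isDensity _ (hr n).1) h1 h x).const_mul
        (1 / 8))

/-! ### Energies along smooth families of densities -/

section Energy

variable {D : Set (E d → ℝ)} {F : (E d → ℝ) → ℝ} {δF : (E d → ℝ) → E d → ℝ}

/-- Along a smooth family of densities with continuous second moments the first variation of an
energy is jointly continuous. -/
theorem IsEnergy.continuousOn_variation (hF : IsEnergy D F δF) {P : Type*}
    [NormedAddCommGroup P] [NormedSpace ℝ P] {U : Set P} (hU : UniqueDiffOn ℝ U)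
    {ρ : P → E d → ℝ} (hρ : ContDiffOn ℝ ∞ (fun q : P × E d => ρ q.1 q.2) (U ×ˢ univ))
    (hD : ∀ p ∈ U, ρ p ∈ D) (hm : ContinuousOn (fun p => ∫ x, ‖x‖ ^ 2 * ρ p x) U) :
    ContinuousOn (fun q : P × E d => δF (ρ q.1) q.2) (U ×ˢ univ) := by
  classical
  rintro ⟨p, x⟩ ⟨hp, -⟩
  -- The continuity axiom of an energy concerns sequences, so joint continuity is tested on
  -- sequences.
  refine tendsto_of_seq_tendsto fun u hu => ?_
  -- The axiom wants every term in the domain, whereas the sequence lies in `U` only eventually. The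
  -- exceptional terms are replaced by the limit.
  let p' : ℕ → P := fun n => if (u n).1 ∈ U then (u n).1 else p
  have hp'U : ∀ n, p' n ∈ U := fun n => by
    by_cases h : (u n).1 ∈ U <;> simp [p', h, hp]
  have hev : ∀ᶠ n in atTop, (u n).1 = p' n := by
    filter_upwards [hu self_mem_nhdsWithin] with n hn
    have : (u n).1 ∈ U := hn.1
    simp [p', this]
  have hu' := tendsto_nhdsWithin_iff.1 hu
  have hp1 : Tendsto (fun n => (u n).1) atTop (𝓝 p) := (continuous_fst.tendsto _).comp hu'.1
  have hx1 : Tendsto (fun n => (u n).2) atTop (𝓝 x) := (continuous_snd.tendsto _).comp hu'.1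
  have hp't : Tendsto p' atTop (𝓝 p) := hp1.congr' hev
  have hp'w : Tendsto p' atTop (𝓝[U] p) :=
    tendsto_nhdsWithin_iff.2 ⟨hp't, Eventually.of_forall hp'U⟩
  have hdt : DensityTendsto (fun n => ρ (p' n)) (ρ p) := by
    refine ⟨fun k => ?_, (hm p hp).tendsto.comp hp'w⟩
    refine (tendstoLocallyUniformly_iff_tendsto_prod
      ((hF.isDensity _ (hD p hp)).smooth.continuous_iteratedFDeriv
        (by exact_mod_cast le_top))).2 fun y => ?_
    have h1 := ((contDiffOn_iteratedFDeriv_snd hU hρ k).continuousOn (p, y) ⟨hp, mem_univ _⟩)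
    have h2 : Tendsto (fun q : ℕ × E d => (p' q.1, q.2)) (atTop ×ˢ 𝓝 y)
        (𝓝[U ×ˢ univ] (p, y)) := by
      refine tendsto_nhdsWithin_iff.2 ⟨?_, Eventually.of_forall fun q => ⟨hp'U _, mem_univ _⟩⟩
      rw [nhds_prod_eq]
      exact (hp't.comp tendsto_fst).prodMk tendsto_snd
    exact h1.tendsto.comp h2
  have h3 := (tendstoLocallyUniformly_iff_tendsto_prod (hF.contDiff _ (hD p hp)).continuous).1
    (hF.continuity _ _ (fun n => hD _ (hp'U n)) (hD p hp) hdt) x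
  have h4 : Tendsto (fun n : ℕ => (n, (u n).2)) atTop (atTop ×ˢ 𝓝 x) := tendsto_id.prodMk hx1
  refine (h3.comp h4).congr' ?_
  filter_upwards [hev] with n hn
  simp [← hn]

theorem smul_mem_testFunZero {h : E d → ℝ} (hh : h ∈ testFunZero d) (s : ℝ) :
    (fun x => s * h x) ∈ testFunZero d := by
  refine ⟨⟨contDiff_const.mul hh.1.1, hh.1.2.mul_left⟩, ?_⟩
  rw [integral_const_mul, hh.2, mul_zero]

/-- Chain rule for an energy along a smooth curve of densities with fixed values outside a compact
set. -/
theorem IsEnergy.hasDerivAt_comp (hF : IsEnergy D F δF) {J : Set ℝ} (hJ : IsOpen J)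
    {ρ : ℝ → E d → ℝ} (hρ : ContDiffOn ℝ ∞ (fun q : ℝ × E d => ρ q.1 q.2) (J ×ˢ univ))
    (hD : ∀ s ∈ J, ρ s ∈ D) {K : Set (E d)} (hK : IsCompact K) {e : ℝ} (he : e ∈ J)
    (hoff : ∀ s ∈ J, ∀ x ∉ K, ρ s x = ρ e x) :
    HasDerivAt (fun s => F (ρ s)) (∫ x, δF (ρ e) x * deriv (fun s => ρ s x) e) e := by
  have hden : ∀ s ∈ J, IsDensity (ρ s) := fun s hs => hF.isDensity _ (hD s hs)
  let h : ℝ → E d → ℝ := fun s x => ρ s x - ρ e x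
  have hhc : ContDiffOn ℝ ∞ (fun q : ℝ × E d => h q.1 q.2) (J ×ˢ univ) :=
    hρ.sub ((hden e he).smooth.comp_contDiffOn contDiffOn_snd)
  have hhs : ∀ s ∈ J, h s ∈ testFunZero d := by
    intro s hs
    refine ⟨⟨(hden s hs).smooth.sub (hden e he).smooth, ?_⟩, ?_⟩
    · refine HasCompactSupport.intro hK fun x hx => ?_
      simp [h, hoff s hs x hx]
    · simp only [h]
      rw [integral_sub (hden s hs).integrable (hden e he).integrable, (hden s hs).mass,
        (hden e he).mass, sub_self]
  -- the family of segments
  let U : Set (ℝ × ℝ) := J ×ˢ Icc 0 1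
  let r : ℝ × ℝ → E d → ℝ := fun p x => ρ e x + p.2 * h p.1 x
  have hUd : UniqueDiffOn ℝ U := hJ.uniqueDiffOn.prod (uniqueDiffOn_Icc zero_lt_one)
  have hrD : ∀ p ∈ U, r p ∈ D := by
    intro p hp
    refine hF.perturb _ (hD e he) _ (smul_mem_testFunZero (hhs _ hp.1) p.2) fun x => ?_
    have h1 := (hden e he).pos x
    have h2 := (hden _ hp.1).pos x
    -- Points of a segment between two positive densities are convex combinations, hence positive.
    have h3 : ρ e x + p.2 * h p.1 x = (1 - p.2) * ρ e x + p.2 * ρ p.1 x := by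
      simp only [h]; ring
    rw [h3]
    rcases hp.2.1.eq_or_lt with h0 | h0
    · rw [← h0]; simpa using h1
    · have := mul_pos h0 h2
      have := mul_nonneg (sub_nonneg.2 hp.2.2) h1.le
      linarith
  have hh2 : ContDiffOn ℝ ∞ (fun q : (ℝ × ℝ) × E d => q.1.2 * h q.1.1 q.2) (U ×ˢ univ) := by
    refine (contDiff_snd.comp contDiff_fst).contDiffOn.mul ?_
    exact hhc.comp (f := fun q : (ℝ × ℝ) × E d => (q.1.1, q.2))
      ((contDiff_fst.comp contDiff_fst).prodMk contDiff_snd).contDiffOn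
      fun q hq => ⟨hq.1.1, mem_univ _⟩
  have hr : ContDiffOn ℝ ∞ (fun q : (ℝ × ℝ) × E d => r q.1 q.2) (U ×ˢ univ) :=
    ((hden e he).smooth.comp_contDiffOn contDiffOn_snd).add hh2
  have hhoff : ∀ s ∈ J, ∀ x ∉ K, h s x = 0 := fun s hs x hx => by simp [h, hoff s hs x hx]
  have hrm : ContinuousOn (fun p => ∫ x, ‖x‖ ^ 2 * r p x) U := by
    have h1 : ContinuousOn (fun p : ℝ × ℝ => ∫ x, ‖x‖ ^ 2 * (p.2 * h p.1 x)) U := by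
      refine continuousOn_integral_of_compact_support hK ?_ ?_
      · exact (continuous_snd.norm.pow 2).continuousOn.mul hh2.continuousOn
      · intro p x hp hx
        simp [hhoff _ hp.1 x hx]
    refine (h1.const_add (∫ x, ‖x‖ ^ 2 * ρ e x)).congr fun p hp => ?_
    have h2 := smul_mem_testFunZero (hhs _ hp.1) p.2
    simp only [r, mul_add]
    refine integral_add (hden e he).moment ?_
    exact ((continuous_norm.pow 2).mul h2.1.1.continuous).integrable_of_hasCompactSupport
      h2.1.2.mul_left
  have hG := hF.continuousOn_variation hUd hr hrD hrm
  -- mean value theorem along the segments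
  have hmv : ∀ s ∈ J, ∃ c ∈ Icc (0 : ℝ) 1, F (ρ s) - F (ρ e) = ∫ x, δF (r (s, c)) x * h s x := by
    intro s hs
    -- The definition of a first variation gives a derivative only at the base point. Every point of
    -- the segment is itself in `D`, so it can serve as base point with the same direction `h s`.
    have hder : ∀ c ∈ Icc (0 : ℝ) 1, HasDerivAt (fun c => F (r (s, c)))
        (∫ x, δF (r (s, c)) x * h s x) c := by
      intro c hc
      have h1 := hF.variation _ (hrD (s, c) ⟨hs, hc⟩) _ (hhs s hs)
      have h2 : HasDerivAt (fun c' : ℝ => c' - c) 1 c := (hasDerivAt_id c).sub_const c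
      have h1' : HasDerivAt (fun ε : ℝ => F (fun x => r (s, c) x + ε * h s x))
          (∫ x, δF (r (s, c)) x * h s x) (c - c) := by rwa [sub_self]
      have h3 := HasDerivAt.comp (h := fun c' : ℝ => c' - c) c h1' h2
      rw [mul_one] at h3
      refine h3.congr_of_eventuallyEq (Eventually.of_forall fun c' => ?_)
      simp only [Function.comp, r]
      congr 1
      funext x
      ring
    obtain ⟨c, hc, hc'⟩ := exists_hasDerivAt_eq_slope (fun c => F (r (s, c)))
      (fun c => ∫ x, δF (r (s, c)) x * h s x) zero_lt_one
      (fun c hc => (hder c hc).continuousAt.continuousWithinAt)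
      (fun c hc => hder c (Ioo_subset_Icc_self hc))
    refine ⟨c, Ioo_subset_Icc_self hc, ?_⟩
    rw [hc']
    simp [r, h]
  -- derivative of the linearised functional
  have hδc : Continuous (δF (ρ e)) := (hF.contDiff _ (hD e he)).continuous
  have hdρ : ∀ s ∈ J, ∀ x, HasDerivAt (fun s => ρ s x) (deriv (fun s => ρ s x) s) s := by
    intro s hs x
    have := (hasDerivWithinAt_fst_of_prod_univ hρ (q := (s, x)) ⟨hs, mem_univ _⟩).hasDerivAt
      (hJ.mem_nhds hs)
    exact this.differentiableAt.hasDerivAt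
  have hdc : ContinuousOn (fun q : ℝ × E d => deriv (fun s => ρ s q.2) q.1) (J ×ˢ univ) := by
    refine (contDiffOn_derivWithin_fst hJ.uniqueDiffOn hρ).continuousOn.congr fun q hq => ?_
    exact (derivWithin_of_isOpen hJ hq.1).symm
  have hdoff : ∀ x ∉ K, deriv (fun s => ρ s x) e = 0 := fun x hx => by
    have : (fun s => ρ s x) =ᶠ[𝓝 e] fun _ => ρ e x := by
      filter_upwards [hJ.mem_nhds he] with s hs using hoff s hs x hx
    rw [this.deriv_eq, deriv_const]
  have hlin : HasDerivAt (fun s => ∫ x, δF (ρ e) x * h s x)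
      (∫ x, δF (ρ e) x * deriv (fun s => ρ s x) e) e := by
    refine hasDerivAt_integral_of_eq_off_compact (J := J) (K := K)
      (f' := fun s x => δF (ρ e) x * deriv (fun s => ρ s x) s) hK (hJ.mem_nhds he) ?_ ?_ ?_ ?_ ?_ ?_
    · exact fun s hs => (hδc.mul (hhs s hs).1.1.continuous).continuousOn
    · exact (hδc.comp continuous_snd).continuousOn.mul
        (hdc.mono (prod_mono subset_rfl (subset_univ K)))
    · exact fun s hs x _ => ((hdρ s hs x).sub_const (ρ e x)).const_mul (δF (ρ e) x)
    · simp [h]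
    · intro s hs x hx
      simp [hhoff s hs x hx, hhoff e he x hx]
    · intro x hx
      simp [hdoff x hx]
  -- bound for the increments
  obtain ⟨δ, hδ, hδJ⟩ := Metric.nhds_basis_closedBall.mem_iff.1 (hJ.mem_nhds he)
  obtain ⟨C, hC⟩ := ((isCompact_closedBall e δ).prod hK).exists_bound_of_continuousOn
    (hdc.mono (prod_mono hδJ (subset_univ K)))
  have hbound : ∀ s ∈ Metric.closedBall e δ, ∀ x ∈ K, |h s x| ≤ |C| * |s - e| := by
    intro s hs x hx
    have := (convex_closedBall e δ).norm_image_sub_le_of_norm_hasDerivWithin_le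
      (f := fun s => ρ s x) (fun s' hs' => (hdρ s' (hδJ hs') x).hasDerivWithinAt)
      (fun s' hs' => (hC (s', x) ⟨hs', hx⟩).trans (le_abs_self C))
      (Metric.mem_closedBall_self hδ.le) hs
    simpa using this
  -- By the mean value theorem the remainder is `∫ (δF(r(s,c)) - δF(ρ e)) h_s` over `K`. The bracket
  -- is uniformly small and `h_s` is at most `|C| |s - e|`, so the product is of smaller order than
  -- `s - e`.
  have hrem : (fun s => F (ρ s) - F (ρ e) - ∫ x, δF (ρ e) x * h s x) =o[𝓝 e] fun s => s - e := by
    rw [Asymptotics.isLittleO_iff]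
    intro κ hκ
    set V : ℝ := volume.real K with hV
    have hV0 : 0 ≤ V := measureReal_nonneg
    -- Chosen so that `η |C| V ≤ κ`; the added ones avoid division by zero.
    set η : ℝ := κ / ((|C| + 1) * (V + 1)) with hη
    have hη0 : 0 < η := by positivity
    -- Uniformity in the unknown intermediate point `c` comes from compactness of `[0, 1] × K`.
    -- Membership in `[0, 1]` is repeated inside because the compactness argument uses full
    -- neighbourhoods, while continuity is known only relative to `[0, 1]`.
    have hclose : ∀ᶠ s in 𝓝 e, ∀ y ∈ Icc (0 : ℝ) 1 ×ˢ K,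
        (y.1 ∈ Icc (0 : ℝ) 1 → |δF (r (s, y.1)) y.2 - δF (ρ e) y.2| < η) := by
      refine (isCompact_Icc.prod hK).eventually_forall_of_forall_eventually fun y hy => ?_
      have h1 : ContinuousOn (fun z : ℝ × (ℝ × E d) => |δF (r (z.1, z.2.1)) z.2.2 -
          δF (ρ e) z.2.2|) (J ×ˢ (Icc (0 : ℝ) 1 ×ˢ univ)) := by
        refine (ContinuousOn.sub ?_ ?_).abs
        · exact hG.comp (f := fun z : ℝ × (ℝ × E d) => ((z.1, z.2.1), z.2.2))
            (Continuous.continuousOn (by fun_prop)) fun z hz => ⟨⟨hz.1, hz.2.1⟩, mem_univ _⟩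
        · exact (hδc.comp (continuous_snd.comp continuous_snd)).continuousOn
      have h2 := (h1 (e, y) ⟨he, hy.1, mem_univ _⟩).tendsto
      have h3 : |δF (r (e, y.1)) y.2 - δF (ρ e) y.2| = 0 := by
        have : r (e, y.1) = ρ e := by
          funext x
          simp [r, h]
        rw [this, sub_self, abs_zero]
      rw [h3] at h2
      have h4 := eventually_nhdsWithin_iff.1 (h2.eventually (gt_mem_nhds hη0))
      have h5 : ∀ᶠ z : ℝ × (ℝ × E d) in 𝓝 (e, y), z.1 ∈ J :=
        (continuous_fst.tendsto (e, y)).eventually (hJ.mem_nhds he)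
      filter_upwards [h4, h5] with z hz hzJ hz1
      exact hz ⟨hzJ, hz1, mem_univ _⟩
    filter_upwards [hclose, Metric.closedBall_mem_nhds e hδ] with s hs hsb
    have hsJ := hδJ hsb
    obtain ⟨c, hc, hceq⟩ := hmv s hsJ
    have hint : ∀ g : E d → ℝ, Continuous g → Integrable fun x => g x * h s x := fun g hg =>
      (hg.mul (hhs s hsJ).1.1.continuous).integrable_of_hasCompactSupport (hhs s hsJ).1.2.mul_left
    rw [hceq, ← integral_sub (hint _ (hF.contDiff _ (hrD (s, c) ⟨hsJ, hc⟩)).continuous)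
      (hint _ hδc)]
    have hz : ∀ x ∉ K, δF (r (s, c)) x * h s x - δF (ρ e) x * h s x = 0 := fun x hx => by
      simp [hhoff s hsJ x hx]
    rw [← setIntegral_eq_integral_of_forall_compl_eq_zero hz]
    refine (norm_setIntegral_le_of_norm_le_const (C := η * (|C| * |s - e|)) hK.measure_lt_top
      fun x hx => ?_).trans ?_
    · rw [← sub_mul, norm_mul]
      exact mul_le_mul (hs (c, x) ⟨hc, hx⟩ hc).le (hbound s hsb x hx) (norm_nonneg _) hη0.le
    · rw [Real.norm_eq_abs, ← hV]
      have h6 : η * ((|C| + 1) * (V + 1)) = κ := by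
        rw [hη]; field_simp
      have h7 : |C| * V ≤ (|C| + 1) * (V + 1) := by nlinarith [abs_nonneg C]
      calc η * (|C| * |s - e|) * V = η * (|C| * V) * |s - e| := by ring
        _ ≤ η * ((|C| + 1) * (V + 1)) * |s - e| := by gcongr
        _ = κ * |s - e| := by rw [h6]
  rw [hasDerivAt_iff_isLittleO] at hlin ⊢
  refine (hrem.add hlin).congr_left fun s => ?_
  have : ∫ x, δF (ρ e) x * h e x = 0 := by simp [h]
  rw [this]
  simp only [smul_eq_mul]
  ring

end Energy

/-! ### Smooth families of maps -/

/-- Two bijections that agree off `K` carry `K` onto the same set. -/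
theorem image_eq_of_eq_off {T Y : E d → E d} (hT : IsDiffeo T) (hY : IsDiffeo Y) {K : Set (E d)}
    (h : ∀ z ∉ K, Y z = T z) (z : E d) : Y z ∈ T '' K ↔ z ∈ K := by
  constructor
  · rintro ⟨w, hw, hwz⟩
    by_contra hz
    rw [h z hz] at hwz
    exact hz (hT.bijective.1 hwz ▸ hw)
  · intro hz
    by_contra hn
    have h1 : Function.invFun T (Y z) ∉ K := fun hm => hn ⟨_, hm, hT.apply_invFun _⟩
    have h2 := h _ h1
    rw [hT.apply_invFun] at h2
    exact h1 (by rwa [hY.bijective.1 h2])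

theorem setIntegral_image_mul_push {T Y : E d → E d} (hT : IsDiffeo T) (hY : IsDiffeo Y)
    {K : Set (E d)} (hK : IsCompact K) (h : ∀ z ∉ K, Y z = T z) (lam f : E d → ℝ) :
    ∫ x in T '' K, f x * push Y lam x = ∫ z in K, f (Y z) * lam z := by
  have hm : MeasurableSet (T '' K) := (hK.image hT.1.continuous).measurableSet
  have h1 := hY.integral_mul_push lam ((T '' K).indicator f)
  rw [← integral_indicator hm, ← integral_indicator hK.measurableSet]
  refine Eq.trans (integral_congr_ae (Eventually.of_forall fun x => ?_))
    (h1.trans (integral_congr_ae (Eventually.of_forall fun z => ?_)))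
  · by_cases hx : x ∈ T '' K <;> simp [hx]
  · by_cases hz : z ∈ K
    · simp [hz, indicator_of_mem ((image_eq_of_eq_off hT hY h z).2 hz)]
    · simp [hz, indicator_of_notMem (mt (image_eq_of_eq_off hT hY h z).1 hz)]

/-! ### Differentiation along curves of diffeomorphisms -/

section Curve

variable {J : Set ℝ} {e : ℝ} {Y : ℝ → E d → E d} {K : Set (E d)} {lam : E d → ℝ}

theorem hasDerivAt_of_contDiffOn {W : Type*} [NormedAddCommGroup W] [NormedSpace ℝ W]
    {V : Type*} [NormedAddCommGroup V] [NormedSpace ℝ V] (hJ : IsOpen J) {f : ℝ × V → W}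
    (hf : ContDiffOn ℝ ∞ f (J ×ˢ univ)) {s : ℝ} (hs : s ∈ J) (x : V) :
    HasDerivAt (fun s => f (s, x)) (deriv (fun s => f (s, x)) s) s :=
  ((hasDerivWithinAt_fst_of_prod_univ hf (q := (s, x)) ⟨hs, mem_univ _⟩).hasDerivAt
    (hJ.mem_nhds hs)).differentiableAt.hasDerivAt

theorem continuousOn_deriv_of_contDiffOn {W : Type*} [NormedAddCommGroup W] [NormedSpace ℝ W]
    {V : Type*} [NormedAddCommGroup V] [NormedSpace ℝ V] (hJ : IsOpen J) {f : ℝ × V → W}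
    (hf : ContDiffOn ℝ ∞ f (J ×ˢ univ)) :
    ContinuousOn (fun q : ℝ × V => deriv (fun s => f (s, q.2)) q.1) (J ×ˢ univ) := by
  refine (contDiffOn_derivWithin_fst hJ.uniqueDiffOn hf).continuousOn.congr fun q hq => ?_
  exact (derivWithin_of_isOpen hJ hq.1).symm

/-- Differentiating `∫ f ρ dx = ∫ f(Y) λ dz` along a curve of diffeomorphisms. -/
theorem integral_mul_deriv_push (hJ : IsOpen J) (he : e ∈ J)
    (hY : ContDiff ℝ ∞ fun q : ℝ × E d => Y q.1 q.2) (hYd : ∀ s ∈ J, IsDiffeo (Y s))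
    (hK : IsCompact K) (hoff : ∀ s ∈ J, ∀ z ∉ K, Y s z = Y e z)
    (hlam : ContDiff ℝ ∞ lam) {f : E d → ℝ} (hf : ContDiff ℝ 1 f) :
    ∫ x, f x * deriv (fun s => push (Y s) lam x) e =
      ∫ z, fderiv ℝ f (Y e z) (deriv (fun s => Y s z) e) * lam z := by
  have hT := hYd e he
  have hp := contDiffOn_push hlam hJ.uniqueDiffOn hY hYd
  have hKi : IsCompact (Y e '' K) := hK.image hT.1.continuous
  have hYc : ContDiffOn ℝ ∞ (fun q : ℝ × E d => Y q.1 q.2) (J ×ˢ univ) := hY.contDiffOn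
  -- The same integral is differentiated twice: in Eulerian form the derivative falls on the
  -- density, in Lagrangian form on `f ∘ Y`. Uniqueness of derivatives identifies the results
  -- without computing the time derivative of the density.
  have h1 : HasDerivAt (fun s => ∫ x in Y e '' K, f x * push (Y s) lam x)
      (∫ x in Y e '' K, f x * deriv (fun s => push (Y s) lam x) e) e := by
    refine hasDerivAt_setIntegral_of_isCompact (J := J)
      (f' := fun s x => f x * deriv (fun s => push (Y s) lam x) s) hKi (hJ.mem_nhds he) ?_ ?_ ?_
    · exact fun s hs => (hf.continuous.mul ((hYd s hs).contDiff_push hlam).continuous).continuousOn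
    · exact (hf.continuous.comp continuous_snd).continuousOn.mul
        ((continuousOn_deriv_of_contDiffOn hJ hp).mono (prod_mono subset_rfl (subset_univ _)))
    · exact fun s hs x _ => (hasDerivAt_of_contDiffOn hJ hp hs x).const_mul (f x)
  have h2 : HasDerivAt (fun s => ∫ z in K, f (Y s z) * lam z)
      (∫ z in K, fderiv ℝ f (Y e z) (deriv (fun s => Y s z) e) * lam z) e := by
    refine hasDerivAt_setIntegral_of_isCompact (J := J)
      (f' := fun s z => fderiv ℝ f (Y s z) (deriv (fun s => Y s z) s) * lam z)
      hK (hJ.mem_nhds he) ?_ ?_ ?_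
    · exact fun s hs => ((hf.continuous.comp (hYd s hs).1.continuous).mul
        hlam.continuous).continuousOn
    · refine ContinuousOn.mul ?_ (hlam.continuous.comp continuous_snd).continuousOn
      refine ContinuousOn.clm_apply ?_
        ((continuousOn_deriv_of_contDiffOn hJ hYc).mono (prod_mono subset_rfl (subset_univ _)))
      exact ((hf.continuous_fderiv (by simp)).comp hY.continuous).continuousOn
    · intro s hs z _
      exact ((hf.contDiffAt.differentiableAt (by simp)).hasFDerivAt.comp_hasDerivAt s
        (hasDerivAt_of_contDiffOn hJ hYc hs z)).mul_const (lam z)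
  have h3 : HasDerivAt (fun s => ∫ x in Y e '' K, f x * push (Y s) lam x)
      (∫ z in K, fderiv ℝ f (Y e z) (deriv (fun s => Y s z) e) * lam z) e := by
    refine h2.congr_of_eventuallyEq ?_
    filter_upwards [hJ.mem_nhds he] with s hs
    exact setIntegral_image_mul_push hT (hYd s hs) hK (hoff s hs) lam f
  have e1 : ∀ z ∉ K, fderiv ℝ f (Y e z) (deriv (fun s => Y s z) e) * lam z = 0 := by
    intro z hz
    have : (fun s => Y s z) =ᶠ[𝓝 e] fun _ => Y e z := by
      filter_upwards [hJ.mem_nhds he] with s hs using hoff s hs z hz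
    rw [this.deriv_eq, deriv_const, map_zero, zero_mul]
  have e2 : ∀ x ∉ Y e '' K, f x * deriv (fun s => push (Y s) lam x) e = 0 := by
    intro x hx
    have : (fun s => push (Y s) lam x) =ᶠ[𝓝 e] fun _ => push (Y e) lam x := by
      filter_upwards [hJ.mem_nhds he] with s hs
      exact push_eq_of_eq_off hT (hYd s hs) hK (hoff s hs) lam hx
    rw [this.deriv_eq, deriv_const, mul_zero]
  rw [← setIntegral_eq_integral_of_forall_compl_eq_zero e1,
    ← setIntegral_eq_integral_of_forall_compl_eq_zero e2]
  exact h1.unique h3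

theorem IsEnergy.hasDerivAt_push {D : Set (E d → ℝ)} {F : (E d → ℝ) → ℝ}
    {δF : (E d → ℝ) → E d → ℝ} (hF : IsEnergy D F δF) (hJ : IsOpen J) (he : e ∈ J)
    (hY : ContDiff ℝ ∞ fun q : ℝ × E d => Y q.1 q.2) (hYd : ∀ s ∈ J, IsDiffeo (Y s))
    (hK : IsCompact K) (hoff : ∀ s ∈ J, ∀ z ∉ K, Y s z = Y e z)
    (hlam : ContDiff ℝ ∞ lam) (hpos : ∀ z, 0 < lam z) (hint : Integrable lam)
    (hD : push (Y e) lam ∈ D) :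
    HasDerivAt (fun s => F (push (Y s) lam))
      (∫ x, δF (push (Y e) lam) x * deriv (fun s => push (Y s) lam x) e) e :=
  hF.hasDerivAt_comp hJ (contDiffOn_push hlam hJ.uniqueDiffOn hY hYd)
    (fun s hs => hF.push_mem (hYd e he) (hYd s hs) hK (hoff s hs) hlam hpos hint hD)
    (hK.image (hYd e he).1.continuous) he
    fun s hs _ hx => push_eq_of_eq_off (hYd e he) (hYd s hs) hK (hoff s hs) lam hx

end Curve

theorem IsEnergy.integral_mul_deriv_push_eq {D : Set (E d → ℝ)} {F : (E d → ℝ) → ℝ}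
    {δF : (E d → ℝ) → E d → ℝ} (hF : IsEnergy D F δF) {J : Set ℝ} {e : ℝ} {Y : ℝ → E d → E d}
    {K : Set (E d)} {lam : E d → ℝ} (hJ : IsOpen J) (he : e ∈ J)
    (hY : ContDiff ℝ ∞ fun q : ℝ × E d => Y q.1 q.2) (hYd : ∀ s ∈ J, IsDiffeo (Y s))
    (hK : IsCompact K) (hoff : ∀ s ∈ J, ∀ z ∉ K, Y s z = Y e z)
    (hlam : ContDiff ℝ ∞ lam) (hD : push (Y e) lam ∈ D) :
    ∫ x, δF (push (Y e) lam) x * deriv (fun s => push (Y s) lam x) e =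
      ∫ z, ⟪∇ (δF (push (Y e) lam)) (Y e z), deriv (fun s => Y s z) e⟫ * lam z := by
  rw [integral_mul_deriv_push hJ he hY hYd hK hoff hlam (hF.contDiff _ hD)]
  simp only [inner_gradient_left]

/-- Second moments vary continuously under compactly supported perturbations. -/
theorem continuousOn_moment_of_eq_off {P : Type*} [NormedAddCommGroup P] [NormedSpace ℝ P]
    {T Y : P → E d → E d} {U : Set P} {K : Set (E d)} {lam : E d → ℝ}
    (hT : ContDiff ℝ ∞ fun q : P × E d => T q.1 q.2)
    (hY : ContDiff ℝ ∞ fun q : P × E d => Y q.1 q.2) (hYd : ∀ p ∈ U, IsDiffeo (Y p))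
    (hK : IsCompact K) (hoff : ∀ p ∈ U, ∀ z ∉ K, Y p z = T p z) (hlam : ContDiff ℝ ∞ lam)
    (hi : ∀ p ∈ U, Integrable fun z => ‖T p z‖ ^ 2 * lam z)
    (hm : ContinuousOn (fun p => ∫ z, ‖T p z‖ ^ 2 * lam z) U) :
    ContinuousOn (fun p => ∫ x, ‖x‖ ^ 2 * push (Y p) lam x) U := by
  have hlc := hlam.continuous
  have hTc := hT.continuous
  have hYc := hY.continuous
  have h0 : ∀ p ∈ U, ∀ z ∉ K, (‖Y p z‖ ^ 2 - ‖T p z‖ ^ 2) * lam z = 0 := fun p hp z hz => by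
    rw [hoff p hp z hz, sub_self, zero_mul]
  have h1 : ContinuousOn (fun p => ∫ z, (‖Y p z‖ ^ 2 - ‖T p z‖ ^ 2) * lam z) U := by
    refine continuousOn_integral_of_compact_support hK (Continuous.continuousOn ?_)
      (fun p z hp hz => h0 p hp z hz)
    simp only [Function.uncurry_def]
    fun_prop
  refine (hm.add h1).congr fun p hp => ?_
  rw [(hYd p hp).integral_mul_push lam fun x => ‖x‖ ^ 2]
  change _ = (∫ z, ‖T p z‖ ^ 2 * lam z) + ∫ z, (‖Y p z‖ ^ 2 - ‖T p z‖ ^ 2) * lam z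
  rw [← integral_add (hi p hp)]
  · refine integral_congr_ae (Eventually.of_forall fun z => ?_)
    simp only
    ring
  · refine Continuous.integrable_of_hasCompactSupport ?_ (HasCompactSupport.intro hK (h0 p hp))
    have hTp : Continuous (T p) := hTc.comp (continuous_const.prodMk continuous_id)
    have hYp : Continuous (Y p) := hYc.comp (continuous_const.prodMk continuous_id)
    fun_prop

/-! ### Paths -/

theorem hasDerivAt_vel {T : ℝ → E d → E d} (hT : ContDiff ℝ ∞ fun q : ℝ × E d => T q.1 q.2)
    (t : ℝ) (z : E d) : HasDerivAt (fun s => T s z) (vel T t z) t := by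
  have h : ContDiff ℝ ∞ (fun s => T s z) := hT.comp (contDiff_id.prodMk contDiff_const)
  exact (h.contDiffAt.differentiableAt (by simp)).hasDerivAt

theorem contDiff_vel {T : ℝ → E d → E d} (hT : ContDiff ℝ ∞ fun q : ℝ × E d => T q.1 q.2) :
    ContDiff ℝ ∞ fun q : ℝ × E d => vel T q.1 q.2 := contDiff_deriv_fst hT

/-- The square of the displacement is bounded by the kinetic energy. -/
theorem norm_sub_sq_le {T : ℝ → E d → E d} (hT : ContDiff ℝ ∞ fun q : ℝ × E d => T q.1 q.2)
    {t₀ t : ℝ} (ht : t ∈ Icc 0 t₀) (z : E d) :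
    ‖T t z - T 0 z‖ ^ 2 ≤ t₀ * ∫ r in (0 : ℝ)..t₀, ‖vel T r z‖ ^ 2 := by
  have hvc : Continuous fun r => vel T r z :=
    (contDiff_vel hT).continuous.comp (continuous_id.prodMk continuous_const)
  have ht0 : 0 ≤ t₀ := ht.1.trans ht.2
  set Q := ∫ r in (0 : ℝ)..t₀, ‖vel T r z‖ ^ 2 with hQ
  have hQ0 : 0 ≤ Q := intervalIntegral.integral_nonneg ht0 fun r _ => by positivity
  set L := ‖T t z - T 0 z‖ with hL
  have hL0 : 0 ≤ L := norm_nonneg _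
  rcases hL0.eq_or_lt with h0 | hLpos
  · rw [← h0, zero_pow two_ne_zero]
    positivity
  rcases ht0.eq_or_lt with h0 | htpos
  · have : t = 0 := le_antisymm (ht.2.trans h0.ge) ht.1
    rw [hL, this]
    rw [sub_self, norm_zero, zero_pow two_ne_zero]
    positivity
  have h1 : T t z - T 0 z = ∫ r in (0 : ℝ)..t, vel T r z :=
    (intervalIntegral.integral_eq_sub_of_hasDerivAt (fun r _ => hasDerivAt_vel hT r z)
      (hvc.intervalIntegrable _ _)).symm
  -- The optimal weight in Young's inequality `|v| ≤ κ/2 + |v|²/(2κ)`. Integration gives `L ≤ L/2 +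
  -- Q t₀/(2L)`, which is the Cauchy–Schwarz bound `L² ≤ t₀ Q`.
  set κ := L / t₀ with hκ
  have hκ0 : 0 < κ := div_pos hLpos htpos
  have h2 : L ≤ ∫ r in (0 : ℝ)..t, (κ / 2 + ‖vel T r z‖ ^ 2 / (2 * κ)) := by
    rw [hL, h1]
    refine intervalIntegral.norm_integral_le_of_norm_le ht.1
      (ae_of_all _ fun r _ => ?_) ?_
    · have h3 : 0 ≤ (‖vel T r z‖ - κ) ^ 2 / (2 * κ) := by positivity
      have h4 : (‖vel T r z‖ - κ) ^ 2 / (2 * κ) =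
          κ / 2 + ‖vel T r z‖ ^ 2 / (2 * κ) - ‖vel T r z‖ := by
        field_simp
        ring
      linarith
    · exact Continuous.intervalIntegrable (by fun_prop) _ _
  have h5 : ∫ r in (0 : ℝ)..t, (κ / 2 + ‖vel T r z‖ ^ 2 / (2 * κ)) ≤
      ∫ r in (0 : ℝ)..t₀, (κ / 2 + ‖vel T r z‖ ^ 2 / (2 * κ)) :=
    intervalIntegral.integral_mono_interval le_rfl ht.1 ht.2
      (ae_of_all _ fun r => by positivity)
      (Continuous.intervalIntegrable (by fun_prop) _ _)
  have h6 : ∫ r in (0 : ℝ)..t₀, (κ / 2 + ‖vel T r z‖ ^ 2 / (2 * κ)) =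
      t₀ * (κ / 2) + Q / (2 * κ) := by
    rw [intervalIntegral.integral_add (Continuous.intervalIntegrable (by fun_prop) _ _)
      (Continuous.intervalIntegrable (by fun_prop) _ _)]
    have h3 : ∫ r in (0 : ℝ)..t₀, ‖vel T r z‖ ^ 2 / (2 * κ) = Q / (2 * κ) := by
      simp only [div_eq_mul_inv, intervalIntegral.integral_mul_const, hQ]
    simp only [h3, intervalIntegral.integral_const, sub_zero, smul_eq_mul]
  have h7 : t₀ * (κ / 2) = L / 2 := by
    rw [hκ]; field_simp
  have h8 : Q / (2 * κ) = Q * t₀ / (2 * L) := by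
    rw [hκ]; field_simp
  have h9 : L / 2 ≤ Q * t₀ / (2 * L) := by linarith
  rw [le_div_iff₀ (by positivity)] at h9
  nlinarith

section Path

variable {D : Set (E d → ℝ)} {F : (E d → ℝ) → ℝ} {lam : E d → ℝ} {t₀ : ℝ} {ρ₀ ρ₁ : E d → ℝ}
  {T : ℝ → E d → E d}

/-- By Tonelli, the finite kinetic part of the action makes the time-integrated squared speed of
particles integrable against `λ`. -/
theorem IsPath.integrable_kinetic (hT : IsPath D F lam t₀ ρ₀ ρ₁ T) (ht₀ : 0 < t₀)
    (hlam : ContDiff ℝ ∞ lam) (hpos : ∀ z, 0 < lam z) :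
    Integrable fun z => (∫ r in (0 : ℝ)..t₀, ‖vel T r z‖ ^ 2) * lam z := by
  have hvc := (contDiff_vel hT.smooth).continuous
  have hlc := hlam.continuous
  have hcont : Continuous fun q : ℝ × E d => ‖vel T q.1 q.2‖ ^ 2 * lam q.2 := by fun_prop
  have h : Integrable (fun q : ℝ × E d => ‖vel T q.1 q.2‖ ^ 2 * lam q.2)
      ((volume.restrict (Ioc 0 t₀)).prod volume) := by
    rw [integrable_prod_iff hcont.aestronglyMeasurable]
    constructor
    · refine (ae_restrict_iff' measurableSet_Ioc).2 (Eventually.of_forall fun t ht => ?_)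
      exact (hT.tangent t (Ioc_subset_Icc_self ht)).2
    · have h1 := (intervalIntegrable_iff_integrableOn_Ioc_of_le ht₀.le).1 hT.kinetic
      refine h1.congr (Eventually.of_forall fun t => ?_)
      refine integral_congr_ae (Eventually.of_forall fun z => ?_)
      simp only [real_inner_self_eq_norm_sq]
      rw [Real.norm_of_nonneg (mul_nonneg (sq_nonneg _) (hpos z).le)]
  refine h.integral_prod_right.congr (Eventually.of_forall fun z => ?_)
  simp only
  rw [integral_mul_const, intervalIntegral.integral_of_le ht₀.le]

/-- The displacement bound dominates `|T_t|² λ` by one integrable function for all times. A path is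
not assumed to be continuous in `L²(λ)`; this follows from the integrable kinetic energy. -/
theorem IsPath.continuousOn_moment (hT : IsPath D F lam t₀ ρ₀ ρ₁ T) (ht₀ : 0 < t₀)
    (hlam : ContDiff ℝ ∞ lam) (hpos : ∀ z, 0 < lam z) :
    ContinuousOn (fun t => ∫ z, ‖T t z‖ ^ 2 * lam z) (Icc 0 t₀) := by
  have hTc := hT.smooth.continuous
  have hlc := hlam.continuous
  have h0 : (0 : ℝ) ∈ Icc 0 t₀ := ⟨le_rfl, ht₀.le⟩
  refine continuousOn_of_dominated (bound := fun z => 2 * (‖T 0 z‖ ^ 2 * lam z) +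
    2 * t₀ * ((∫ r in (0 : ℝ)..t₀, ‖vel T r z‖ ^ 2) * lam z)) ?_ ?_ ?_ ?_
  · intro t _
    have : Continuous (T t) := hTc.comp (continuous_const.prodMk continuous_id)
    exact Continuous.aestronglyMeasurable (by fun_prop)
  · intro t ht
    refine Eventually.of_forall fun z => ?_
    have hz := (hpos z).le
    rw [Real.norm_of_nonneg (mul_nonneg (sq_nonneg _) hz)]
    have h1 := norm_sub_sq_le hT.smooth ht z
    have h2 : ‖T t z‖ ^ 2 ≤ 2 * ‖T 0 z‖ ^ 2 + 2 * ‖T t z - T 0 z‖ ^ 2 := by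
      have h3 : ‖T t z‖ ≤ ‖T 0 z‖ + ‖T t z - T 0 z‖ := by
        simpa using norm_add_le (T 0 z) (T t z - T 0 z)
      have h4 := norm_nonneg (T t z)
      nlinarith [sq_nonneg (‖T 0 z‖ - ‖T t z - T 0 z‖)]
    calc ‖T t z‖ ^ 2 * lam z ≤ (2 * ‖T 0 z‖ ^ 2 + 2 * (t₀ * ∫ r in (0 : ℝ)..t₀,
          ‖vel T r z‖ ^ 2)) * lam z := by gcongr; linarith
      _ = _ := by ring
  · exact ((hT.inO 0 h0).2.const_mul 2).add ((hT.integrable_kinetic ht₀ hlam hpos).const_mul _)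
  · refine Eventually.of_forall fun z => Continuous.continuousOn ?_
    have : Continuous fun t => T t z := hTc.comp (continuous_id.prodMk continuous_const)
    fun_prop

end Path

/-! ### Variations of paths -/

/-- A smooth compactly supported variation of `T` through diffeomorphisms. -/
structure IsDiffeoVariation (t₀ : ℝ) (J : Set ℝ) (K : Set (E d)) (T : ℝ → E d → E d)
    (Y : ℝ → ℝ → E d → E d) : Prop where
  smooth : ContDiff ℝ ∞ (fun p : ℝ × ℝ × E d => Y p.1 p.2.1 p.2.2)
  base : ∀ t, Y 0 t = T t
  off : ∀ ε t, ∀ z ∉ K, Y ε t z = T t z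
  isCompact : IsCompact K
  isOpen : IsOpen J
  ordConnected : J.OrdConnected
  zero_mem : 0 ∈ J
  diffeo : ∀ ε ∈ J, ∀ t ∈ Icc 0 t₀, IsDiffeo (Y ε t)

/-- The direction of a variation. -/
def variationField (Y : ℝ → ℝ → E d → E d) (t : ℝ) (z : E d) : E d := deriv (fun ε => Y ε t z) 0

section Variation

variable {D : Set (E d → ℝ)} {F : (E d → ℝ) → ℝ} {δF : (E d → ℝ) → E d → ℝ} {lam : E d → ℝ}
  {t₀ : ℝ} {ρ₀ ρ₁ : E d → ℝ} {T : ℝ → E d → E d} {Y : ℝ → ℝ → E d → E d} {J : Set ℝ}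
  {K : Set (E d)}

/-- The derivative of the energy along a variation. -/
def energyRate (δF : (E d → ℝ) → E d → ℝ) (lam : E d → ℝ) (Y : ℝ → ℝ → E d → E d) (ε t : ℝ) : ℝ :=
  ∫ x, δF (push (Y ε t) lam) x * deriv (fun s => push (Y s t) lam x) ε

/-- The rate of change of the velocity along a variation. -/
def velRate (Y : ℝ → ℝ → E d → E d) (ε t : ℝ) (z : E d) : E d := deriv (fun s => vel (Y s) t z) ε

theorem contDiff_vel_variation (hY : ContDiff ℝ ∞ fun p : ℝ × ℝ × E d => Y p.1 p.2.1 p.2.2) :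
    ContDiff ℝ ∞ fun p : ℝ × ℝ × E d => vel (Y p.1) p.2.1 p.2.2 := by
  have h1 : ContDiff ℝ ∞ fun q : ℝ × (ℝ × E d) => Y q.2.1 q.1 q.2.2 :=
    hY.comp ((contDiff_fst.comp contDiff_snd).prodMk
      (contDiff_fst.prodMk (contDiff_snd.comp contDiff_snd)))
  exact (contDiff_deriv_fst h1).comp ((contDiff_fst.comp contDiff_snd).prodMk
    (contDiff_fst.prodMk (contDiff_snd.comp contDiff_snd)))

theorem contDiff_velRate (hY : ContDiff ℝ ∞ fun p : ℝ × ℝ × E d => Y p.1 p.2.1 p.2.2) :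
    ContDiff ℝ ∞ fun p : ℝ × ℝ × E d => velRate Y p.1 p.2.1 p.2.2 :=
  contDiff_deriv_fst (contDiff_vel_variation hY)

theorem contDiff_variationField (hY : ContDiff ℝ ∞ fun p : ℝ × ℝ × E d => Y p.1 p.2.1 p.2.2) :
    ContDiff ℝ ∞ fun q : ℝ × E d => variationField Y q.1 q.2 :=
  (contDiff_deriv_fst hY).comp (contDiff_const.prodMk contDiff_id)

/-- Mixed derivatives of smooth functions commute. -/
theorem deriv_deriv_comm {W : Type*} [NormedAddCommGroup W] [NormedSpace ℝ W] {f : ℝ × ℝ → W}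
    (hf : ContDiff ℝ ∞ f) (s t : ℝ) :
    deriv (fun s => deriv (fun t => f (s, t)) t) s =
      deriv (fun t => deriv (fun s => f (s, t)) s) t := by
  have hd : ∀ p, HasFDerivAt f (fderiv ℝ f p) p := fun p =>
    (hf.contDiffAt.differentiableAt (by simp)).hasFDerivAt
  have hs : ∀ s t : ℝ, HasDerivAt (fun s => (s, t)) ((1 : ℝ), (0 : ℝ)) s := fun s t =>
    (hasDerivAt_id s).prodMk (hasDerivAt_const s t)
  have ht : ∀ s t : ℝ, HasDerivAt (fun t => (s, t)) ((0 : ℝ), (1 : ℝ)) t := fun s t =>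
    (hasDerivAt_const t s).prodMk (hasDerivAt_id t)
  have h1 : (fun s => deriv (fun t => f (s, t)) t) = fun s => fderiv ℝ f (s, t) (0, 1) :=
    funext fun s => ((hd (s, t)).comp_hasDerivAt t (ht s t)).deriv
  have h2 : (fun t => deriv (fun s => f (s, t)) s) = fun t => fderiv ℝ f (s, t) (1, 0) :=
    funext fun t => ((hd (s, t)).comp_hasDerivAt s (hs s t)).deriv
  have hdd : HasFDerivAt (fderiv ℝ f) (fderiv ℝ (fderiv ℝ f) (s, t)) (s, t) :=
    ((hf.fderiv_right (m := ∞) (by simp)).contDiffAt.differentiableAt (by simp)).hasFDerivAt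
  have happ : ∀ v : ℝ × ℝ, HasFDerivAt (fun p => fderiv ℝ f p v)
      ((ContinuousLinearMap.apply ℝ W v).comp (fderiv ℝ (fderiv ℝ f) (s, t))) (s, t) := fun v =>
    (ContinuousLinearMap.apply ℝ W v).hasFDerivAt.comp (s, t) hdd
  rw [h1, h2]
  have h3 : deriv (fun s => fderiv ℝ f (s, t) (0, 1)) s =
      fderiv ℝ (fderiv ℝ f) (s, t) (1, 0) (0, 1) :=
    (HasFDerivAt.comp_hasDerivAt (l := fun p => fderiv ℝ f p (0, 1)) (f := fun s => (s, t)) s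
      (happ (0, 1)) (hs s t)).deriv
  have h4 : deriv (fun t => fderiv ℝ f (s, t) (1, 0)) t =
      fderiv ℝ (fderiv ℝ f) (s, t) (0, 1) (1, 0) :=
    (HasFDerivAt.comp_hasDerivAt (l := fun p => fderiv ℝ f p (1, 0)) (f := fun t => (s, t)) t
      (happ (1, 0)) (ht s t)).deriv
  rw [h3, h4]
  exact second_derivative_symmetric hd hdd (1, 0) (0, 1)

theorem velRate_zero (hY : ContDiff ℝ ∞ fun p : ℝ × ℝ × E d => Y p.1 p.2.1 p.2.2) (t : ℝ)
    (z : E d) : velRate Y 0 t z = vel (variationField Y) t z := by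
  have h : ContDiff ℝ ∞ fun p : ℝ × ℝ => Y p.1 p.2 z :=
    hY.comp (contDiff_fst.prodMk (contDiff_snd.prodMk contDiff_const))
  exact deriv_deriv_comm h 0 t

theorem IsDiffeoVariation.smooth_prod (hV : IsDiffeoVariation t₀ J K T Y) :
    ContDiff ℝ ∞ fun q : (ℝ × ℝ) × E d => Y q.1.1 q.1.2 q.2 :=
  hV.smooth.comp ((contDiff_fst.comp contDiff_fst).prodMk
    ((contDiff_snd.comp contDiff_fst).prodMk contDiff_snd))

theorem IsDiffeoVariation.smooth_left (hV : IsDiffeoVariation t₀ J K T Y) (t : ℝ) :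
    ContDiff ℝ ∞ fun q : ℝ × E d => Y q.1 t q.2 :=
  hV.smooth.comp (contDiff_fst.prodMk (contDiff_const.prodMk contDiff_snd))

theorem IsDiffeoVariation.smooth_right (hV : IsDiffeoVariation t₀ J K T Y) (ε : ℝ) :
    ContDiff ℝ ∞ fun q : ℝ × E d => Y ε q.1 q.2 :=
  hV.smooth.comp (contDiff_const.prodMk contDiff_id)

theorem IsDiffeoVariation.smooth_base (hV : IsDiffeoVariation t₀ J K T Y) :
    ContDiff ℝ ∞ fun q : ℝ × E d => T q.1 q.2 := by
  simpa only [hV.base] using hV.smooth_right 0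

theorem IsDiffeoVariation.off_off (hV : IsDiffeoVariation t₀ J K T Y) (ε ε' t : ℝ) :
    ∀ z ∉ K, Y ε t z = Y ε' t z := fun z hz => by rw [hV.off ε t z hz, hV.off ε' t z hz]

theorem IsDiffeoVariation.diffeo_base (hV : IsDiffeoVariation t₀ J K T Y) {t : ℝ}
    (ht : t ∈ Icc 0 t₀) : IsDiffeo (T t) := by
  simpa only [hV.base] using hV.diffeo 0 hV.zero_mem t ht

theorem IsDiffeoVariation.vel_off (hV : IsDiffeoVariation t₀ J K T Y) (ε t : ℝ) :
    ∀ z ∉ K, vel (Y ε) t z = vel T t z := fun z hz => by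
  simp only [vel, hV.off ε _ z hz]

theorem IsDiffeoVariation.variationField_off (hV : IsDiffeoVariation t₀ J K T Y) (t : ℝ) :
    ∀ z ∉ K, variationField Y t z = 0 := fun z hz => by
  simp only [variationField, hV.off _ t z hz, deriv_const]

theorem IsDiffeoVariation.push_off (hV : IsDiffeoVariation t₀ J K T Y) {ε ε' t : ℝ} (hε : ε ∈ J)
    (hε' : ε' ∈ J) (ht : t ∈ Icc 0 t₀) (lam : E d → ℝ) {x : E d} (hx : x ∉ T t '' K) :
    push (Y ε t) lam x = push (Y ε' t) lam x := by
  rw [push_eq_of_eq_off (hV.diffeo_base ht) (hV.diffeo ε hε t ht) hV.isCompact (hV.off ε t) lam hx,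
    push_eq_of_eq_off (hV.diffeo_base ht) (hV.diffeo ε' hε' t ht) hV.isCompact (hV.off ε' t) lam hx]

theorem IsDiffeoVariation.uniqueDiffOn (hV : IsDiffeoVariation t₀ J K T Y) (ht₀ : 0 < t₀) :
    UniqueDiffOn ℝ (J ×ˢ Icc 0 t₀) := hV.isOpen.uniqueDiffOn.prod (uniqueDiffOn_Icc ht₀)

theorem IsDiffeoVariation.contDiffOn_push (hV : IsDiffeoVariation t₀ J K T Y) (ht₀ : 0 < t₀)
    (hlam : ContDiff ℝ ∞ lam) :
    ContDiffOn ℝ ∞ (fun q : (ℝ × ℝ) × E d => push (Y q.1.1 q.1.2) lam q.2)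
      ((J ×ˢ Icc 0 t₀) ×ˢ univ) :=
  WHF.contDiffOn_push (T := fun p : ℝ × ℝ => Y p.1 p.2) hlam (hV.uniqueDiffOn ht₀) hV.smooth_prod
    fun p hp => hV.diffeo p.1 hp.1 p.2 hp.2

theorem IsDiffeoVariation.push_mem (hV : IsDiffeoVariation t₀ J K T Y) (hF : IsEnergy D F δF)
    (hlam : ContDiff ℝ ∞ lam) (hpos : ∀ z, 0 < lam z) (hint : Integrable lam) {ε t : ℝ}
    (hε : ε ∈ J) (ht : t ∈ Icc 0 t₀) (hD : push (T t) lam ∈ D) : push (Y ε t) lam ∈ D :=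
  hF.push_mem (hV.diffeo_base ht) (hV.diffeo ε hε t ht) hV.isCompact (hV.off ε t) hlam hpos hint hD

theorem IsDiffeoVariation.continuousOn_deriv_push (hV : IsDiffeoVariation t₀ J K T Y)
    (ht₀ : 0 < t₀) (hlam : ContDiff ℝ ∞ lam) :
    ContinuousOn (fun q : (ℝ × ℝ) × E d => deriv (fun s => push (Y s q.1.2) lam q.2) q.1.1)
      ((J ×ˢ Icc 0 t₀) ×ˢ univ) := by
  have hp := hV.contDiffOn_push ht₀ hlam
  have hu := (hV.uniqueDiffOn ht₀).prod (uniqueDiffOn_univ (𝕜 := ℝ) (E := E d))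
  have h1 := (hp.fderivWithin hu (m := ∞) (by simp)).continuousOn
  refine (h1.clm_apply (continuousOn_const (c := (((1 : ℝ), (0 : ℝ)), (0 : E d))))).congr ?_
  rintro ⟨⟨ε, t⟩, x⟩ hq
  have h2 := ((hp _ hq).differentiableWithinAt (by simp)).hasFDerivWithinAt
  have h3 : HasDerivWithinAt (fun s : ℝ => ((s, t), x)) ((1, 0), 0) J ε :=
    ((hasDerivWithinAt_id _ _).prodMk (hasDerivWithinAt_const _ _ _)).prodMk
      (hasDerivWithinAt_const _ _ _)
  have h4 := h2.comp_hasDerivWithinAt ε h3 fun s hs =>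
    mk_mem_prod (mk_mem_prod hs hq.1.2) (mem_univ _)
  exact (h4.hasDerivAt (hV.isOpen.mem_nhds hq.1.1)).deriv

/-- The integrand is jointly continuous and vanishes outside the compact set swept by `T_t(K)` over
all times, so the support does not depend on the parameters. -/
theorem IsDiffeoVariation.continuousOn_energyRate (hV : IsDiffeoVariation t₀ J K T Y)
    (hF : IsEnergy D F δF) (ht₀ : 0 < t₀) (hlam : ContDiff ℝ ∞ lam) (hpos : ∀ z, 0 < lam z)
    (hint : Integrable lam) (hD : ∀ t ∈ Icc 0 t₀, push (T t) lam ∈ D)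
    (hi : ∀ t ∈ Icc 0 t₀, Integrable fun z => ‖T t z‖ ^ 2 * lam z)
    (hm : ContinuousOn (fun t => ∫ z, ‖T t z‖ ^ 2 * lam z) (Icc 0 t₀)) :
    ContinuousOn (fun p : ℝ × ℝ => energyRate δF lam Y p.1 p.2) (J ×ˢ Icc 0 t₀) := by
  have hTs : ContDiff ℝ ∞ fun q : (ℝ × ℝ) × E d => T q.1.2 q.2 :=
    hV.smooth_base.comp ((contDiff_snd.comp contDiff_fst).prodMk contDiff_snd)
  have hmom := continuousOn_moment_of_eq_off (P := ℝ × ℝ) (T := fun p => T p.2)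
    (Y := fun p => Y p.1 p.2) (U := J ×ˢ Icc 0 t₀) hTs hV.smooth_prod
    (fun p hp => hV.diffeo p.1 hp.1 p.2 hp.2) hV.isCompact (fun p _ => hV.off p.1 p.2) hlam
    (fun p hp => hi p.2 hp.2) (hm.comp continuousOn_snd fun p hp => hp.2)
  have hc := hF.continuousOn_variation (hV.uniqueDiffOn ht₀) (hV.contDiffOn_push ht₀ hlam)
    (fun p hp => hV.push_mem hF hlam hpos hint hp.1 hp.2 (hD p.2 hp.2)) hmom
  have hK' : IsCompact ((fun q : ℝ × E d => T q.1 q.2) '' (Icc 0 t₀ ×ˢ K)) :=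
    (isCompact_Icc.prod hV.isCompact).image hV.smooth_base.continuous
  refine continuousOn_integral_of_compact_support hK'
    (hc.mul (hV.continuousOn_deriv_push ht₀ hlam)) ?_
  intro p x hp hx
  have hx' : x ∉ T p.2 '' K := fun ⟨z, hz, hzx⟩ => hx ⟨(p.2, z), ⟨hp.2, hz⟩, hzx⟩
  have : (fun s => push (Y s p.2) lam x) =ᶠ[𝓝 p.1] fun _ => push (Y p.1 p.2) lam x := by
    filter_upwards [hV.isOpen.mem_nhds hp.1] with s hs
    exact hV.push_off hs hp.1 hp.2 lam hx'
  rw [this.deriv_eq, deriv_const, mul_zero]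

theorem IsDiffeoVariation.hasDerivAt_energy (hV : IsDiffeoVariation t₀ J K T Y)
    (hF : IsEnergy D F δF) (hlam : ContDiff ℝ ∞ lam) (hpos : ∀ z, 0 < lam z)
    (hint : Integrable lam) {ε t : ℝ} (hε : ε ∈ J) (ht : t ∈ Icc 0 t₀)
    (hD : push (T t) lam ∈ D) :
    HasDerivAt (fun s => F (push (Y s t) lam)) (energyRate δF lam Y ε t) ε :=
  hF.hasDerivAt_push hV.isOpen hε (hV.smooth_left t) (fun s hs => hV.diffeo s hs t ht)
    hV.isCompact (fun s _ => hV.off_off s ε t) hlam hpos hint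
    (hV.push_mem hF hlam hpos hint hε ht hD)

theorem IsDiffeoVariation.energyRate_zero (hV : IsDiffeoVariation t₀ J K T Y)
    (hF : IsEnergy D F δF) (hlam : ContDiff ℝ ∞ lam) {t : ℝ} (ht : t ∈ Icc 0 t₀)
    (hD : push (T t) lam ∈ D) :
    energyRate δF lam Y 0 t =
      ∫ z, ⟪∇ (δF (push (T t) lam)) (T t z), variationField Y t z⟫ * lam z := by
  have h := hF.integral_mul_deriv_push_eq hV.isOpen hV.zero_mem (hV.smooth_left t)
    (fun s hs => hV.diffeo s hs t ht) hV.isCompact (fun s _ => hV.off_off s 0 t) hlam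
    (by rwa [hV.base])
  rw [energyRate, h]
  simp only [hV.base, variationField]

/-- The potential energy along a path is assumed only integrable in time. Its change under a
variation is better: it is the integral over `ε` of a jointly continuous rate. -/
theorem IsDiffeoVariation.continuousOn_energy_sub (hV : IsDiffeoVariation t₀ J K T Y)
    (hF : IsEnergy D F δF) (ht₀ : 0 < t₀) (hlam : ContDiff ℝ ∞ lam) (hpos : ∀ z, 0 < lam z)
    (hint : Integrable lam) (hD : ∀ t ∈ Icc 0 t₀, push (T t) lam ∈ D)
    (hi : ∀ t ∈ Icc 0 t₀, Integrable fun z => ‖T t z‖ ^ 2 * lam z)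
    (hm : ContinuousOn (fun t => ∫ z, ‖T t z‖ ^ 2 * lam z) (Icc 0 t₀)) {ε : ℝ} (hε : ε ∈ J) :
    ContinuousOn (fun t => F (push (Y ε t) lam) - F (push (T t) lam)) (Icc 0 t₀) := by
  have hA := hV.continuousOn_energyRate hF ht₀ hlam hpos hint hD hi hm
  have hsub : uIcc 0 ε ⊆ J := hV.ordConnected.uIcc_subset hV.zero_mem hε
  have hAs : ∀ t ∈ Icc 0 t₀, ContinuousOn (fun s => energyRate δF lam Y s t) (uIcc 0 ε) :=
    fun t ht => hA.comp (f := fun s => (s, t)) (by fun_prop) fun s hs => ⟨hsub hs, ht⟩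
  obtain ⟨C, hC⟩ := ((isCompact_uIcc (a := (0 : ℝ)) (b := ε)).prod
    (isCompact_Icc (a := (0 : ℝ)) (b := t₀))).exists_bound_of_continuousOn
    (hA.mono (prod_mono hsub subset_rfl))
  have h1 : ContinuousOn (fun t => ∫ s in uIoc 0 ε, energyRate δF lam Y s t) (Icc 0 t₀) := by
    refine continuousOn_of_dominated (bound := fun _ => C) ?_ ?_ ?_ ?_
    · exact fun t ht => ((hAs t ht).mono uIoc_subset_uIcc).aestronglyMeasurable measurableSet_uIoc
    · intro t ht
      refine (ae_restrict_iff' measurableSet_uIoc).2 (Eventually.of_forall fun s hs => ?_)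
      exact hC (s, t) ⟨uIoc_subset_uIcc hs, ht⟩
    · exact integrableOn_const
        ((measure_mono uIoc_subset_uIcc).trans_lt isCompact_uIcc.measure_lt_top).ne
    · refine (ae_restrict_iff' measurableSet_uIoc).2 (Eventually.of_forall fun s hs => ?_)
      exact hA.comp (f := fun t => (s, t)) (by fun_prop) fun t ht =>
        ⟨hsub (uIoc_subset_uIcc hs), ht⟩
  -- The sign restores the orientation of the interval from `0` to `ε` when `ε` is negative.
  refine (h1.const_smul (if (0 : ℝ) ≤ ε then (1 : ℝ) else -1)).congr fun t ht => ?_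
  have h2 := intervalIntegral.integral_eq_sub_of_hasDerivAt (a := 0) (b := ε)
    (fun s hs => hV.hasDerivAt_energy hF hlam hpos hint (hsub hs) ht (hD t ht))
    (hAs t ht).intervalIntegrable
  rw [intervalIntegral.intervalIntegral_eq_integral_uIoc, hV.base] at h2
  exact h2.symm

/-- The change of kinetic energy along a variation. -/
def kineticDiff (lam : E d → ℝ) (K : Set (E d)) (Y : ℝ → ℝ → E d → E d) (ε t : ℝ) : ℝ :=
  ∫ z in K, (‖vel (Y ε) t z‖ ^ 2 - ‖vel (Y 0) t z‖ ^ 2) * lam z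

theorem IsDiffeoVariation.continuous_kineticDiff (hV : IsDiffeoVariation t₀ J K T Y)
    (hlam : ContDiff ℝ ∞ lam) (ε : ℝ) : Continuous (kineticDiff lam K Y ε) := by
  have h1 := (contDiff_vel_variation hV.smooth).continuous
  have h2 := hlam.continuous
  have h3 : Continuous fun q : ℝ × E d => vel (Y ε) q.1 q.2 :=
    h1.comp (continuous_const.prodMk continuous_id)
  have h4 : Continuous fun q : ℝ × E d => vel (Y 0) q.1 q.2 :=
    h1.comp (continuous_const.prodMk continuous_id)
  refine continuous_parametric_integral_of_continuous ?_ hV.isCompact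
  simp only [Function.uncurry_def]
  fun_prop

theorem IsDiffeoVariation.hasDerivAt_kineticDiff (hV : IsDiffeoVariation t₀ J K T Y)
    (hlam : ContDiff ℝ ∞ lam) (ε t : ℝ) :
    HasDerivAt (fun s => kineticDiff lam K Y s t)
      (∫ z in K, 2 * ⟪vel (Y ε) t z, velRate Y ε t z⟫ * lam z) ε := by
  have h1 := (contDiff_vel_variation hV.smooth).continuous
  have h2 := hlam.continuous
  have h3 := (contDiff_velRate hV.smooth).continuous
  refine hasDerivAt_setIntegral_of_isCompact (J := univ)
    (f' := fun ε z => 2 * ⟪vel (Y ε) t z, velRate Y ε t z⟫ * lam z) hV.isCompact univ_mem ?_ ?_ ?_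
  · intro s _
    have h4 : ∀ s, Continuous fun z : E d => vel (Y s) t z := fun s =>
      h1.comp (f := fun z : E d => (s, t, z)) (by fun_prop)
    have h4s := h4 s
    have h40 := h4 0
    exact Continuous.continuousOn (by fun_prop)
  · have h5 : Continuous fun q : ℝ × E d => vel (Y q.1) t q.2 :=
      h1.comp (f := fun q : ℝ × E d => (q.1, t, q.2)) (by fun_prop)
    have h6 : Continuous fun q : ℝ × E d => velRate Y q.1 t q.2 :=
      h3.comp (f := fun q : ℝ × E d => (q.1, t, q.2)) (by fun_prop)
    exact Continuous.continuousOn (by fun_prop)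
  · intro s _ z _
    have h7 : ContDiff ℝ ∞ fun s => vel (Y s) t z :=
      (contDiff_vel_variation hV.smooth).comp
        (f := fun s : ℝ => (s, t, z)) (contDiff_id.prodMk contDiff_const)
    have h8 : HasDerivAt (fun s => vel (Y s) t z) (velRate Y s t z) s :=
      (h7.contDiffAt.differentiableAt (by simp)).hasDerivAt
    exact (h8.norm_sq.sub_const _).mul_const _

theorem IsDiffeoVariation.continuous_kineticRate (hV : IsDiffeoVariation t₀ J K T Y)
    (hlam : ContDiff ℝ ∞ lam) :
    Continuous fun p : ℝ × ℝ => ∫ z in K, 2 * ⟪vel (Y p.1) p.2 z, velRate Y p.1 p.2 z⟫ * lam z := by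
  have h1 : Continuous fun q : (ℝ × ℝ) × E d => vel (Y q.1.1) q.1.2 q.2 :=
    (contDiff_vel_variation hV.smooth).continuous.comp
      (f := fun q : (ℝ × ℝ) × E d => (q.1.1, q.1.2, q.2)) (by fun_prop)
  have h3 : Continuous fun q : (ℝ × ℝ) × E d => velRate Y q.1.1 q.1.2 q.2 :=
    (contDiff_velRate hV.smooth).continuous.comp
      (f := fun q : (ℝ × ℝ) × E d => (q.1.1, q.1.2, q.2)) (by fun_prop)
  have h2 := hlam.continuous
  refine continuous_parametric_integral_of_continuous ?_ hV.isCompact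
  simp only [Function.uncurry_def]
  fun_prop

theorem IsDiffeoVariation.integrable_vel (hV : IsDiffeoVariation t₀ J K T Y)
    (hlam : ContDiff ℝ ∞ lam) {t : ℝ} (hi : Integrable fun z => ‖vel T t z‖ ^ 2 * lam z) (ε : ℝ) :
    Integrable fun z => ‖vel (Y ε) t z‖ ^ 2 * lam z := by
  refine integrable_of_eq_off_compact hV.isCompact hi ?_ fun z hz => by rw [hV.vel_off ε t z hz]
  have h1 : Continuous fun z : E d => vel (Y ε) t z :=
    (contDiff_vel_variation hV.smooth).continuous.comp (f := fun z : E d => (ε, t, z)) (by fun_prop)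
  have h2 := hlam.continuous
  fun_prop

/-- Separates the kinetic energy into a finite part independent of the variation and a difference
over the compact set `K`. -/
theorem IsDiffeoVariation.metric_vel (hV : IsDiffeoVariation t₀ J K T Y)
    (hlam : ContDiff ℝ ∞ lam) {t : ℝ} (hi : Integrable fun z => ‖vel T t z‖ ^ 2 * lam z) (ε : ℝ) :
    metric lam (vel (Y ε) t) (vel (Y ε) t) =
      metric lam (vel T t) (vel T t) + kineticDiff lam K Y ε t := by
  have h1 := hV.integrable_vel hlam hi ε
  have hb : ∀ z, vel (Y 0) t z = vel T t z := fun z => by simp only [vel, hV.base]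
  have h2 : kineticDiff lam K Y ε t =
      ∫ z, (‖vel (Y ε) t z‖ ^ 2 * lam z - ‖vel T t z‖ ^ 2 * lam z) := by
    rw [← setIntegral_eq_integral_of_forall_compl_eq_zero (s := K)]
    · simp only [kineticDiff, hb, sub_mul]
    · intro z hz
      rw [hV.vel_off ε t z hz, sub_self]
  simp only [metric, real_inner_self_eq_norm_sq]
  rw [h2, integral_sub h1 hi]
  ring

/-- Varying a path changes its kinetic and potential energies by functions continuous in time, so
integrability of both is preserved. -/
theorem IsDiffeoVariation.isPath (hV : IsDiffeoVariation t₀ J K T Y) (hF : IsEnergy D F δF)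
    (ht₀ : 0 < t₀) (hlam : ContDiff ℝ ∞ lam) (hpos : ∀ z, 0 < lam z) (hint : Integrable lam)
    (hT : IsPath D F lam t₀ ρ₀ ρ₁ T) {ε : ℝ} (hε : ε ∈ J) (hl : push (Y ε 0) lam = ρ₀)
    (hr : push (Y ε t₀) lam = ρ₁) : IsPath D F lam t₀ ρ₀ ρ₁ (Y ε) where
  smooth := hV.smooth_right ε
  inO t ht := by
    refine ⟨hV.diffeo ε hε t ht, integrable_of_eq_off_compact hV.isCompact (hT.inO t ht).2 ?_
      fun z hz => by rw [hV.off ε t z hz]⟩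
    have h1 := (hV.diffeo ε hε t ht).1.continuous
    have h2 := hlam.continuous
    fun_prop
  tangent t ht := ⟨(contDiff_vel (hV.smooth_right ε)).comp (contDiff_const.prodMk contDiff_id),
    hV.integrable_vel hlam (hT.tangent t ht).2 ε⟩
  finite t ht := hV.push_mem hF hlam hpos hint hε ht (hT.finite t ht)
  kinetic := by
    refine (hT.kinetic.add ((hV.continuous_kineticDiff hlam ε).intervalIntegrable 0 t₀)).congr ?_
    intro t ht
    rw [uIoc_of_le ht₀.le] at ht
    exact (hV.metric_vel hlam (hT.tangent t (Ioc_subset_Icc_self ht)).2 ε).symm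
  potential := by
    have h1 := hV.continuousOn_energy_sub hF ht₀ hlam hpos hint hT.finite
      (fun t ht => (hT.inO t ht).2) (hT.continuousOn_moment ht₀ hlam hpos) hε
    rw [← uIcc_of_le ht₀.le] at h1
    refine (hT.potential.add h1.intervalIntegrable).congr fun t _ => ?_
    simp
  left := hl
  right := hr

/-- The first variation of the action. -/
theorem IsDiffeoVariation.hasDerivAt_action (hV : IsDiffeoVariation t₀ J K T Y)
    (hF : IsEnergy D F δF) (ht₀ : 0 < t₀) (hlam : ContDiff ℝ ∞ lam) (hpos : ∀ z, 0 < lam z)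
    (hint : Integrable lam) (hT : IsPath D F lam t₀ ρ₀ ρ₁ T) :
    HasDerivAt (fun ε => action F lam t₀ (Y ε))
      (∫ t in Icc 0 t₀, ((∫ z in K, ⟪vel T t z, vel (variationField Y) t z⟫ * lam z) -
        energyRate δF lam Y 0 t)) 0 := by
  have hm := hT.continuousOn_moment ht₀ hlam hpos
  have hi : ∀ t ∈ Icc 0 t₀, Integrable fun z => ‖T t z‖ ^ 2 * lam z := fun t ht => (hT.inO t ht).2
  -- Only the difference of Lagrangians is differentiated under the time integral. The Lagrangian
  -- itself is merely integrable in time, but the difference is continuous on the compact interval.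
  let f : ℝ → ℝ → ℝ := fun ε t =>
    1 / 2 * kineticDiff lam K Y ε t - (F (push (Y ε t) lam) - F (push (T t) lam))
  let f' : ℝ → ℝ → ℝ := fun ε t =>
    1 / 2 * (∫ z in K, 2 * ⟪vel (Y ε) t z, velRate Y ε t z⟫ * lam z) - energyRate δF lam Y ε t
  have hfc : ∀ ε ∈ J, ContinuousOn (f ε) (Icc 0 t₀) := fun ε hε =>
    ((continuous_const.mul (hV.continuous_kineticDiff hlam ε)).continuousOn).sub
      (hV.continuousOn_energy_sub hF ht₀ hlam hpos hint hT.finite hi hm hε)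
  have key := hasDerivAt_setIntegral_of_isCompact (μ := (volume : Measure ℝ)) (X := ℝ)
    (K := Icc 0 t₀) (f := f) (f' := f') isCompact_Icc (hV.isOpen.mem_nhds hV.zero_mem) hfc
    ((continuous_const.mul (hV.continuous_kineticRate hlam)).continuousOn.sub
      (hV.continuousOn_energyRate hF ht₀ hlam hpos hint hT.finite hi hm))
    (fun ε hε t ht => ((hV.hasDerivAt_kineticDiff hlam ε t).const_mul (1 / 2)).sub
      ((hV.hasDerivAt_energy hF hlam hpos hint hε ht (hT.finite t ht)).sub_const _))
  have hval : ∀ t, f' 0 t = (∫ z in K, ⟪vel T t z, vel (variationField Y) t z⟫ * lam z) -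
      energyRate δF lam Y 0 t := by
    intro t
    simp only [f', mul_assoc, integral_const_mul]
    rw [← mul_assoc]
    norm_num
    refine integral_congr_ae (Eventually.of_forall fun z => ?_)
    simp only [velRate_zero hV.smooth]
    simp only [vel, hV.base]
  simp only [hval] at key
  refine (key.const_add (action F lam t₀ T)).congr_of_eventuallyEq ?_
  filter_upwards [hV.isOpen.mem_nhds hV.zero_mem] with ε hε
  have hL : IntervalIntegrable (fun t => lagrangian F lam (T t) (vel T t)) volume 0 t₀ :=
    (hT.kinetic.const_mul (1 / 2)).sub hT.potential
  have hf : IntervalIntegrable (f ε) volume 0 t₀ := by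
    have := hfc ε hε
    rw [← uIcc_of_le ht₀.le] at this
    exact this.intervalIntegrable
  rw [integral_Icc_eq_integral_Ioc, ← intervalIntegral.integral_of_le ht₀.le, action, action,
    ← intervalIntegral.integral_add hL hf]
  refine intervalIntegral.integral_congr fun t ht => ?_
  rw [uIcc_of_le ht₀.le] at ht
  simp only [lagrangian, f]
  rw [hV.metric_vel hlam (hT.tangent t ht).2 ε]
  ring

theorem IsDiffeoVariation.metric_variationField (hV : IsDiffeoVariation t₀ J K T Y)
    (S : E d → E d) (t : ℝ) :
    metric lam S (variationField Y t) = ∫ z in K, ⟪S z, variationField Y t z⟫ * lam z := by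
  rw [metric, ← setIntegral_eq_integral_of_forall_compl_eq_zero (s := K)]
  intro z hz
  rw [hV.variationField_off t z hz, inner_zero_right, zero_mul]

theorem IsDiffeoVariation.hasDerivAt_metric (hV : IsDiffeoVariation t₀ J K T Y)
    (hlam : ContDiff ℝ ∞ lam) (t : ℝ) :
    HasDerivAt (fun t => metric lam (vel T t) (variationField Y t))
      ((∫ z in K, ⟪vel T t z, vel (variationField Y) t z⟫ * lam z) +
        metric lam (vel (vel T) t) (variationField Y t)) t := by
  have hv := contDiff_vel hV.smooth_base
  have hx := contDiff_variationField hV.smooth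
  have h1 := hv.continuous
  have h2 := (contDiff_vel hv).continuous
  have h3 := hx.continuous
  have h4 := (contDiff_vel hx).continuous
  have h5 := hlam.continuous
  have hs : ∀ {f : ℝ → E d → E d}, (Continuous fun q : ℝ × E d => f q.1 q.2) → ∀ t,
      Continuous (f t) := fun hf t => hf.comp (continuous_const.prodMk continuous_id)
  have hint : ∀ {f g : ℝ → E d → E d}, (Continuous fun q : ℝ × E d => f q.1 q.2) →
      (Continuous fun q : ℝ × E d => g q.1 q.2) →
      IntegrableOn (fun z => ⟪f t z, g t z⟫ * lam z) K := fun hf hg => by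
    have := hs hf t
    have := hs hg t
    exact (Continuous.continuousOn (by fun_prop)).integrableOn_compact hV.isCompact
  simp only [hV.metric_variationField]
  have key := hasDerivAt_setIntegral_of_isCompact (μ := (volume : Measure (E d))) (J := univ)
    (e := t) (f := fun t z => ⟪vel T t z, variationField Y t z⟫ * lam z)
    (f' := fun t z => (⟪vel T t z, vel (variationField Y) t z⟫ +
      ⟪vel (vel T) t z, variationField Y t z⟫) * lam z) hV.isCompact univ_mem
    (fun s _ => by
      have := hs h1 s
      have := hs h3 s
      exact Continuous.continuousOn (by fun_prop))
    (Continuous.continuousOn (by fun_prop))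
    (fun s _ z _ => ((hasDerivAt_vel hv s z).inner ℝ (hasDerivAt_vel hx s z)).mul_const _)
  simp only [add_mul] at key
  rwa [integral_add (hint h1 h4) (hint h2 h3)] at key

theorem IsDiffeoVariation.continuous_metric (hV : IsDiffeoVariation t₀ J K T Y)
    (hlam : ContDiff ℝ ∞ lam) :
    Continuous fun t => metric lam (vel (vel T) t) (variationField Y t) := by
  have h2 := (contDiff_vel (contDiff_vel hV.smooth_base)).continuous
  have h3 := (contDiff_variationField hV.smooth).continuous
  have h5 := hlam.continuous
  simp only [hV.metric_variationField]
  refine continuous_parametric_integral_of_continuous ?_ hV.isCompact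
  simp only [Function.uncurry_def]
  fun_prop

/-- The Euler–Lagrange identity with boundary terms. -/
theorem IsDiffeoVariation.eq_of_isCritical (hV : IsDiffeoVariation t₀ J K T Y)
    (hF : IsEnergy D F δF) (ht₀ : 0 < t₀) (hlam : ContDiff ℝ ∞ lam) (hpos : ∀ z, 0 < lam z)
    (hint : Integrable lam) (hT : IsCritical D F lam t₀ ρ₀ ρ₁ T)
    (hl : ∀ ε ∈ J, push (Y ε 0) lam = ρ₀) (hr : ∀ ε ∈ J, push (Y ε t₀) lam = ρ₁) :
    metric lam (vel T t₀) (variationField Y t₀) - metric lam (vel T 0) (variationField Y 0) =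
      ∫ t in (0 : ℝ)..t₀, (metric lam (vel (vel T) t) (variationField Y t) +
        energyRate δF lam Y 0 t) := by
  have hm := hT.1.continuousOn_moment ht₀ hlam hpos
  have hi : ∀ t ∈ Icc 0 t₀, Integrable fun z => ‖T t z‖ ^ 2 * lam z :=
    fun t ht => (hT.1.inO t ht).2
  have hPV : IsPathVariation D F lam t₀ ρ₀ ρ₁ T Y :=
    { smooth := hV.smooth
      base := fun t _ => hV.base t
      support := ⟨K, hV.isCompact, fun ε t _ => hV.off ε t⟩
      path := by
        filter_upwards [hV.isOpen.mem_nhds hV.zero_mem] with ε hε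
        exact hV.isPath hF ht₀ hlam hpos hint hT.1 hε (hl ε hε) (hr ε hε) }
  have h0 := (hV.hasDerivAt_action hF ht₀ hlam hpos hint hT.1).unique (hT.2 Y hPV)
  rw [integral_Icc_eq_integral_Ioc, ← intervalIntegral.integral_of_le ht₀.le] at h0
  let b' : ℝ → ℝ := fun t => ∫ z in K, ⟪vel T t z, vel (variationField Y) t z⟫ * lam z
  have hb'c : Continuous b' := by
    have h1 := (contDiff_vel hV.smooth_base).continuous
    have h4 := (contDiff_vel (contDiff_variationField hV.smooth)).continuous
    have h5 := hlam.continuous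
    refine continuous_parametric_integral_of_continuous ?_ hV.isCompact
    simp only [Function.uncurry_def]
    fun_prop
  have hA : IntervalIntegrable (fun t => energyRate δF lam Y 0 t) volume 0 t₀ := by
    have h1 := hV.continuousOn_energyRate hF ht₀ hlam hpos hint hT.1.finite hi hm
    have h2 : ContinuousOn (fun t => energyRate δF lam Y 0 t) (uIcc 0 t₀) := by
      rw [uIcc_of_le ht₀.le]
      exact h1.comp (f := fun t => ((0 : ℝ), t)) (by fun_prop) fun t ht => ⟨hV.zero_mem, ht⟩
    exact h2.intervalIntegrable
  have hM := (hV.continuous_metric hlam).intervalIntegrable (μ := volume) 0 t₀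
  have hB := hb'c.intervalIntegrable (μ := volume) 0 t₀
  -- Integration by parts in time. The boundary terms are kept because the endpoint maps may move
  -- even though the endpoint densities do not.
  have h1 := intervalIntegral.integral_eq_sub_of_hasDerivAt
    (fun t _ => hV.hasDerivAt_metric hlam t) (hB.add hM)
  rw [intervalIntegral.integral_sub hB hA] at h0
  rw [intervalIntegral.integral_add hB hM] at h1
  rw [← h1, intervalIntegral.integral_add hM hA]
  linarith

end Variation

/-! ### The second order equation -/

theorem eq_zero_of_integral_mul_eq_zero {f : E d → ℝ} (hf : Continuous f)
    (h : ∀ g : E d → ℝ, ContDiff ℝ ∞ g → HasCompactSupport g → ∫ x, g x * f x = 0) (x : E d) :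
    f x = 0 := by
  have h1 := ae_eq_zero_of_integral_contDiff_smul_eq_zero (μ := (volume : Measure (E d)))
    hf.locallyIntegrable (fun g hg hs => by simpa using h g hg hs)
  have h2 : f = fun _ => 0 := (hf.ae_eq_iff_eq volume continuous_const).1 h1
  exact congrFun h2 x

/-- The fundamental lemma of the calculus of variations on the open interval; continuity then
reaches the endpoints. -/
theorem eqOn_zero_of_integral_mul_eq_zero {a : ℝ → ℝ} {t₀ : ℝ} (ht₀ : 0 < t₀)
    (ha : ContinuousOn a (Icc 0 t₀))
    (h : ∀ χ : ℝ → ℝ, ContDiff ℝ ∞ χ → HasCompactSupport χ → tsupport χ ⊆ Ioo 0 t₀ →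
      ∫ t in (0 : ℝ)..t₀, χ t * a t = 0) : ∀ t ∈ Icc 0 t₀, a t = 0 := by
  have h1 := (isOpen_Ioo (a := (0 : ℝ)) (b := t₀)).ae_eq_zero_of_integral_contDiff_smul_eq_zero
    (μ := volume) (f := a) ((ha.mono Ioo_subset_Icc_self).locallyIntegrableOn measurableSet_Ioo)
    (fun χ hχ hs hsub => by
      rw [← h χ hχ hs hsub, intervalIntegral.integral_of_le ht₀.le,
        setIntegral_eq_integral_of_forall_compl_eq_zero]
      · rfl
      · intro t ht
        rw [image_eq_zero_of_notMem_tsupport fun hm => ht (Ioo_subset_Ioc_self (hsub hm)),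
          zero_mul])
  have h2 : a =ᵐ[volume.restrict (Icc 0 t₀)] fun _ => 0 := by
    rw [← Measure.restrict_congr_set (Ioo_ae_eq_Icc (μ := (volume : Measure ℝ)))]
    exact (ae_restrict_iff' measurableSet_Ioo).2 h1
  exact Measure.eqOn_Icc_of_ae_eq volume ht₀.ne h2 ha continuousOn_const

/-- The linear variation in the direction of a compactly supported field. -/
def linearVariation (T ξ : ℝ → E d → E d) (ε t : ℝ) (z : E d) : E d := T t z + ε • ξ t z

theorem exists_isDiffeoVariation_linear {t₀ : ℝ} (ht₀ : 0 < t₀) {T ξ : ℝ → E d → E d}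
    (hT : ContDiff ℝ ∞ fun q : ℝ × E d => T q.1 q.2) (hTd : ∀ t ∈ Icc 0 t₀, IsDiffeo (T t))
    (hξ : ContDiff ℝ ∞ fun q : ℝ × E d => ξ q.1 q.2) {K : Set (E d)} (hK : IsCompact K)
    (hs : ∀ t, ∀ z ∉ K, ξ t z = 0) :
    ∃ δ > 0, IsDiffeoVariation t₀ (Metric.ball 0 δ) K T (linearVariation T ξ) := by
  obtain ⟨δ, hδ, h⟩ := exists_forall_isDiffeo_add_smul (uniqueDiffOn_Icc ht₀) isCompact_Icc hT hTd
    hξ hK fun t _ => hs t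
  refine ⟨δ, hδ, ?_, ?_, ?_, hK, Metric.isOpen_ball, ?_, Metric.mem_ball_self hδ, ?_⟩
  · exact (hT.comp contDiff_snd).add (contDiff_fst.smul (hξ.comp contDiff_snd))
  · intro t; funext z; simp [linearVariation]
  · intro ε t z hz; simp [linearVariation, hs t z hz]
  · exact (convex_ball (0 : ℝ) δ).ordConnected
  · intro ε hε t ht
    exact h ε (by simpa using hε) t ht

theorem variationField_linearVariation (T ξ : ℝ → E d → E d) :
    variationField (linearVariation T ξ) = ξ := by
  funext t z
  have : HasDerivAt (fun ε : ℝ => T t z + ε • ξ t z) (ξ t z) 0 := by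
    simpa using ((hasDerivAt_id (0 : ℝ)).smul_const (ξ t z)).const_add (T t z)
  exact this.deriv

/-! ### The Euler–Lagrange equation of a critical point -/

section Critical

variable {D : Set (E d → ℝ)} {F : (E d → ℝ) → ℝ} {δF : (E d → ℝ) → E d → ℝ} {lam : E d → ℝ}
  {t₀ : ℝ} {ρ₀ ρ₁ : E d → ℝ} {T : ℝ → E d → E d}

/-- The weak form of the second order equation. -/
theorem IsCritical.weak (hT : IsCritical D F lam t₀ ρ₀ ρ₁ T) (hF : IsEnergy D F δF) (ht₀ : 0 < t₀)
    (hlam : ContDiff ℝ ∞ lam) (hpos : ∀ z, 0 < lam z) (hint : Integrable lam) {η : E d → E d}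
    (hη : ContDiff ℝ ∞ η) (hs : HasCompactSupport η) :
    ∀ t ∈ Icc 0 t₀, metric lam (vel (vel T) t) η +
      (∫ z, ⟪∇ (δF (push (T t) lam)) (T t z), η z⟫ * lam z) = 0 := by
  have hP := hT.1
  have hTd : ∀ t ∈ Icc 0 t₀, IsDiffeo (T t) := fun t ht => (hP.inO t ht).1
  have hm := hP.continuousOn_moment ht₀ hlam hpos
  have hi : ∀ t ∈ Icc 0 t₀, Integrable fun z => ‖T t z‖ ^ 2 * lam z := fun t ht => (hP.inO t ht).2
  have hz : ∀ z ∉ tsupport η, η z = 0 := fun z hz => image_eq_zero_of_notMem_tsupport hz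
  refine eqOn_zero_of_integral_mul_eq_zero ht₀ ?_ ?_
  · obtain ⟨δ, _, hV⟩ := exists_isDiffeoVariation_linear (ξ := fun _ => η) ht₀ hP.smooth hTd
      (hη.comp contDiff_snd) hs fun _ => hz
    have hc := hV.continuousOn_energyRate hF ht₀ hlam hpos hint hP.finite hi hm
    have h1 : ContinuousOn (fun t => energyRate δF lam (linearVariation T fun _ => η) 0 t)
        (Icc 0 t₀) :=
      hc.comp (f := fun t => ((0 : ℝ), t)) (by fun_prop) fun t ht => ⟨hV.zero_mem, ht⟩
    have h2 := hV.continuous_metric hlam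
    rw [variationField_linearVariation] at h2
    refine (h2.continuousOn.add h1).congr fun t ht => ?_
    change _ = _ + energyRate δF lam (linearVariation T fun _ => η) 0 t
    rw [hV.energyRate_zero hF hlam ht (hP.finite t ht), variationField_linearVariation]
  · intro χ hχ hχs hχt
    have hχ0 : χ 0 = 0 := image_eq_zero_of_notMem_tsupport fun h => (hχt h).1.ne rfl
    have hχ1 : χ t₀ = 0 := image_eq_zero_of_notMem_tsupport fun h => (hχt h).2.ne rfl
    -- The cut-off fixes both endpoint maps, so the variation is admissible and the boundary terms
    -- vanish.
    let ξ : ℝ → E d → E d := fun t z => χ t • η z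
    have hξ : ContDiff ℝ ∞ fun q : ℝ × E d => ξ q.1 q.2 :=
      (hχ.comp (contDiff_fst (E := ℝ) (F := E d))).smul (hη.comp (contDiff_snd (E := ℝ) (F := E d)))
    obtain ⟨δ, _, hV⟩ := exists_isDiffeoVariation_linear (ξ := ξ) ht₀ hP.smooth hTd
      hξ hs fun t z h => by simp [ξ, hz z h]
    have hl : ∀ ε, linearVariation T ξ ε 0 = T 0 := fun ε => by
      funext z; simp [linearVariation, ξ, hχ0]
    have hr : ∀ ε, linearVariation T ξ ε t₀ = T t₀ := fun ε => by
      funext z; simp [linearVariation, ξ, hχ1]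
    have key := hV.eq_of_isCritical hF ht₀ hlam hpos hint hT
      (fun ε _ => by rw [hl, hP.left]) (fun ε _ => by rw [hr, hP.right])
    rw [variationField_linearVariation] at key
    have e0 : metric lam (vel T 0) (ξ 0) = 0 := by simp [metric, ξ, hχ0]
    have e1 : metric lam (vel T t₀) (ξ t₀) = 0 := by simp [metric, ξ, hχ1]
    rw [e0, e1, sub_zero] at key
    refine Eq.trans (intervalIntegral.integral_congr fun t ht => ?_) key.symm
    rw [uIcc_of_le ht₀.le] at ht
    rw [hV.energyRate_zero hF hlam ht (hP.finite t ht), variationField_linearVariation]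
    simp only [metric, ξ, real_inner_smul_right, mul_assoc, integral_const_mul, mul_add]

theorem IsCritical.solvesSecondOrder (hT : IsCritical D F lam t₀ ρ₀ ρ₁ T) (hF : IsEnergy D F δF)
    (ht₀ : 0 < t₀) (hlam : ContDiff ℝ ∞ lam) (hpos : ∀ z, 0 < lam z) (hint : Integrable lam) :
    SolvesSecondOrder δF lam t₀ T := by
  intro t ht z
  have hP := hT.1
  set v : E d → E d := fun z => vel (vel T) t z + ∇ (δF (push (T t) lam)) (T t z) with hv
  have hTt := (hP.inO t ht).1
  have hac : Continuous fun z => vel (vel T) t z :=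
    (contDiff_vel (contDiff_vel hP.smooth)).continuous.comp (continuous_const.prodMk continuous_id)
  have hgc : Continuous fun z => ∇ (δF (push (T t) lam)) (T t z) :=
    (contDiff_gradient (m := 0) (hF.contDiff _ (hP.finite t ht)) (by simp)).continuous.comp
      hTt.1.continuous
  have hvc : Continuous v := hac.add hgc
  have hlc := hlam.continuous
  have h0 : ∀ w : E d, ∀ z, ⟪v z, w⟫ * lam z = 0 := by
    -- Fields `g(z) w` with a fixed vector `w` reduce the vector equation to the scalar fundamental
    -- lemma. Afterwards `w` is taken to be the value of `v` at the point.
    intro w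
    refine eq_zero_of_integral_mul_eq_zero (by fun_prop) fun g hg hs => ?_
    have h1 := hT.weak hF ht₀ hlam hpos hint (η := fun z => g z • w) (hg.smul contDiff_const)
      hs.smul_right t ht
    have hi : ∀ u : E d → E d, Continuous u → Integrable fun z => ⟪u z, g z • w⟫ * lam z := by
      intro u hu
      have hgc' := hg.continuous
      refine Continuous.integrable_of_hasCompactSupport (by fun_prop) ?_
      refine hs.mono fun z hz => ?_
      contrapose! hz
      simp [Function.notMem_support.1 hz]
    rw [metric, ← integral_add (hi _ hac) (hi _ hgc)] at h1
    rw [← h1]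
    refine integral_congr_ae (Eventually.of_forall fun z => ?_)
    simp only [hv, inner_add_left, real_inner_smul_right]
    ring
  have h1 := h0 (v z) z
  have h2 : v z = 0 := by
    rcases mul_eq_zero.1 h1 with h | h
    · exact inner_self_eq_zero.1 h
    · exact absurd h (hpos z).ne'
  exact eq_neg_of_add_eq_zero_left h2

end Critical

/-! ### The Hamiltonian system on the space of diffeomorphisms -/

/-- The first equation determines `Λ = λ Ṫ`. Since `λ` does not depend on time, the second is then
`λ` times the second order equation; one-sided derivatives are unique at the endpoints of the
interval too. -/
theorem solvesFirstOrder_iff {D : Set (E d → ℝ)} {F : (E d → ℝ) → ℝ}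
    {δF : (E d → ℝ) → E d → ℝ} {lam : E d → ℝ} {t₀ : ℝ} {ρ₀ ρ₁ : E d → ℝ} {T : ℝ → E d → E d}
    (hT : IsPath D F lam t₀ ρ₀ ρ₁ T) (ht₀ : 0 < t₀) (hpos : ∀ z, 0 < lam z)
    (Λ : ℝ → E d → E d) :
    SolvesFirstOrder δF lam t₀ T Λ ↔
      (∀ t ∈ Icc 0 t₀, ∀ z, Λ t z = lam z • vel T t z) ∧ SolvesSecondOrder δF lam t₀ T := by
  have hd : ∀ t z, HasDerivWithinAt (fun s => lam z • vel T s z) (lam z • vel (vel T) t z)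
      (Icc 0 t₀) t := fun t z =>
    ((hasDerivAt_vel (contDiff_vel hT.smooth) t z).const_smul (lam z)).hasDerivWithinAt
  constructor
  · intro h
    have hΛ : ∀ t ∈ Icc 0 t₀, ∀ z, Λ t z = lam z • vel T t z := fun t ht z => by
      rw [(h t ht z).1, smul_smul, mul_inv_cancel₀ (hpos z).ne', one_smul]
    refine ⟨hΛ, fun t ht z => ?_⟩
    have h1 := (h t ht z).2.congr (f₁ := fun s => lam z • vel T s z)
      (fun s hs => (hΛ s hs z).symm) (hΛ t ht z).symm
    have h2 := (uniqueDiffOn_Icc ht₀ t ht).eq_deriv _ (hd t z) h1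
    rw [← smul_neg] at h2
    exact smul_right_injective _ (hpos z).ne' h2
  · rintro ⟨hΛ, h⟩ t ht z
    refine ⟨by rw [hΛ t ht z, smul_smul, inv_mul_cancel₀ (hpos z).ne', one_smul], ?_⟩
    have h1 := hd t z
    rw [h t ht z, smul_neg] at h1
    exact h1.congr (fun s hs => hΛ s hs z) (hΛ t ht z)

theorem integrable_inner_mul {lam : E d → ℝ} (hlam : ContDiff ℝ ∞ lam) (hpos : ∀ z, 0 < lam z)
    {σ τ : E d → E d} (hσ : IsTangent lam σ) (hτ : IsTangent lam τ) :
    Integrable fun z => ⟪σ z, τ z⟫ * lam z := by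
  have h1 := hσ.1.continuous
  have h2 := hτ.1.continuous
  have h3 := hlam.continuous
  refine (hσ.2.add hτ.2).mono' (Continuous.aestronglyMeasurable (by fun_prop))
    (Eventually.of_forall fun z => ?_)
  rw [norm_mul, Real.norm_of_nonneg (hpos z).le]
  have h4 := norm_inner_le_norm (𝕜 := ℝ) (σ z) (τ z)
  have h5 : ‖⟪σ z, τ z⟫‖ ≤ ‖σ z‖ ^ 2 + ‖τ z‖ ^ 2 := by
    nlinarith [sq_nonneg (‖σ z‖ - ‖τ z‖), sq_nonneg ‖σ z‖, sq_nonneg ‖τ z‖]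
  calc ‖⟪σ z, τ z⟫‖ * lam z ≤ (‖σ z‖ ^ 2 + ‖τ z‖ ^ 2) * lam z := by
        have := (hpos z).le
        gcongr
    _ = _ := by simp only [Pi.add_apply]; ring

/-- The metric does not depend on the base point, so this is a quadratic polynomial in `ε` whose
linear coefficient is the pairing. -/
theorem hasDerivAt_half_metric {lam : E d → ℝ} (hlam : ContDiff ℝ ∞ lam) (hpos : ∀ z, 0 < lam z)
    {σ τ : E d → E d} (hσ : IsTangent lam σ) (hτ : IsTangent lam τ) :
    HasDerivAt (fun ε : ℝ => 1 / 2 * metric lam (fun z => σ z + ε • τ z) fun z => σ z + ε • τ z)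
      (metric lam σ τ) 0 := by
  have h : ∀ ε : ℝ, 1 / 2 * metric lam (fun z => σ z + ε • τ z) (fun z => σ z + ε • τ z) =
      1 / 2 * metric lam σ σ + ε * metric lam σ τ + ε ^ 2 * (1 / 2 * metric lam τ τ) := by
    intro ε
    have e : ∀ z, ⟪σ z + ε • τ z, σ z + ε • τ z⟫ * lam z = ⟪σ z, σ z⟫ * lam z +
        2 * ε * (⟪σ z, τ z⟫ * lam z) + ε ^ 2 * (⟪τ z, τ z⟫ * lam z) := fun z => by
      simp only [inner_add_left, inner_add_right, real_inner_smul_left, real_inner_smul_right,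
        real_inner_comm (σ z) (τ z)]
      ring
    simp only [metric, e]
    rw [integral_add, integral_add, integral_const_mul, integral_const_mul]
    · ring
    · exact integrable_inner_mul hlam hpos hσ hσ
    · exact (integrable_inner_mul hlam hpos hσ hτ).const_mul _
    · exact (integrable_inner_mul hlam hpos hσ hσ).add
        ((integrable_inner_mul hlam hpos hσ hτ).const_mul _)
    · exact (integrable_inner_mul hlam hpos hτ hτ).const_mul _
  simp only [h]
  have h1 := (((hasDerivAt_id (0 : ℝ)).mul_const (metric lam σ τ)).const_add
    (1 / 2 * metric lam σ σ)).add (((hasDerivAt_id (0 : ℝ)).pow 2).mul_const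
      (1 / 2 * metric lam τ τ))
  exact h1.congr_deriv (by simp)

theorem hasDerivAt_lagrangian {F : (E d → ℝ) → ℝ} {lam : E d → ℝ} (hlam : ContDiff ℝ ∞ lam)
    (hpos : ∀ z, 0 < lam z) {T σ τ : E d → E d} (hσ : IsTangent lam σ) (hτ : IsTangent lam τ) :
    HasDerivAt (fun ε : ℝ => lagrangian F lam T fun z => σ z + ε • τ z)
      (∫ z, ⟪lam z • σ z, τ z⟫) 0 := by
  have h : ∫ z, ⟪lam z • σ z, τ z⟫ = metric lam σ τ := by
    simp only [metric, real_inner_smul_left, mul_comm]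
  rw [h]
  exact (hasDerivAt_half_metric hlam hpos hσ hτ).sub_const _

theorem hamiltonian_smul {F : (E d → ℝ) → ℝ} {lam : E d → ℝ} (hpos : ∀ z, 0 < lam z)
    (T σ : E d → E d) :
    hamiltonian F lam T (fun z => lam z • σ z) = metric lam σ σ - lagrangian F lam T σ := by
  have h : ∀ z, (lam z)⁻¹ • lam z • σ z = σ z := fun z => by
    rw [smul_smul, inv_mul_cancel₀ (hpos z).ne', one_smul]
  simp only [hamiltonian, lagrangian, h]
  ring

theorem hasDerivAt_hamiltonian_momentum {F : (E d → ℝ) → ℝ} {lam : E d → ℝ}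
    (hlam : ContDiff ℝ ∞ lam) (hpos : ∀ z, 0 < lam z) {T Λ M : E d → E d}
    (hΛ : IsTangent lam fun z => (lam z)⁻¹ • Λ z) (hM : IsTangent lam fun z => (lam z)⁻¹ • M z) :
    HasDerivAt (fun ε : ℝ => hamiltonian F lam T fun z => Λ z + ε • M z)
      (∫ z, ⟪(lam z)⁻¹ • Λ z, M z⟫) 0 := by
  have h1 : ∫ z, ⟪(lam z)⁻¹ • Λ z, M z⟫ =
      metric lam (fun z => (lam z)⁻¹ • Λ z) fun z => (lam z)⁻¹ • M z := by
    refine integral_congr_ae (Eventually.of_forall fun z => ?_)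
    have := (hpos z).ne'
    simp only [real_inner_smul_left, real_inner_smul_right]
    field_simp
  rw [h1]
  refine ((hasDerivAt_half_metric hlam hpos hΛ hM).add_const (F (push T lam))).congr_of_eventuallyEq
    (Eventually.of_forall fun ε => ?_)
  have h2 : ∀ z, (lam z)⁻¹ • (Λ z + ε • M z) = (lam z)⁻¹ • Λ z + ε • (lam z)⁻¹ • M z := fun z => by
    rw [smul_add, smul_comm ε]
  simp only [hamiltonian, h2]

theorem hasDerivAt_hamiltonian_position {D : Set (E d → ℝ)} {F : (E d → ℝ) → ℝ}
    {δF : (E d → ℝ) → E d → ℝ} (hF : IsEnergy D F δF) {lam : E d → ℝ} (hlam : ContDiff ℝ ∞ lam)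
    (hpos : ∀ z, 0 < lam z) (hint : Integrable lam) {T Λ S : E d → E d} (hT : InO lam T)
    (hD : push T lam ∈ D) (hS : ContDiff ℝ ∞ S) (hs : HasCompactSupport S) :
    HasDerivAt (fun ε : ℝ => hamiltonian F lam (fun z => T z + ε • S z) Λ)
      (∫ z, ⟪lam z • ∇ (δF (push T lam)) (T z), S z⟫) 0 := by
  -- The map is regarded as a constant path over the auxiliary interval `[0, 1]`, so that the energy
  -- derivative for variations of paths applies at time zero.
  obtain ⟨δ, hδ, hV⟩ := exists_isDiffeoVariation_linear (T := fun _ => T) (ξ := fun _ => S)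
    zero_lt_one (hT.1.1.comp contDiff_snd) (fun _ _ => hT.1) (hS.comp contDiff_snd) hs
    fun _ z hz => image_eq_zero_of_notMem_tsupport hz
  have h0 : (0 : ℝ) ∈ Icc (0 : ℝ) 1 := ⟨le_rfl, zero_le_one⟩
  have h1 := hV.hasDerivAt_energy hF hlam hpos hint hV.zero_mem h0 hD
  rw [hV.energyRate_zero hF hlam h0 hD, variationField_linearVariation] at h1
  have h2 : ∫ z, ⟪lam z • ∇ (δF (push T lam)) (T z), S z⟫ =
      ∫ z, ⟪∇ (δF (push T lam)) (T z), S z⟫ * lam z := by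
    simp only [real_inner_smul_left, mul_comm]
  rw [h2]
  exact h1.const_add _

/-! ### Twists preserving Lebesgue measure -/

theorem det_id_add_smulRight (f : E d →L[ℝ] ℝ) (u : E d) :
    (ContinuousLinearMap.id ℝ (E d) + f.smulRight u).det = 1 + f u := by
  have h : (ContinuousLinearMap.id ℝ (E d) + f.smulRight u).toLinearMap =
      LinearMap.transvection f.toLinearMap u := by
    ext1 v
    rfl
  rw [ContinuousLinearMap.det, h, LinearMap.transvection.det]
  rfl

theorem hasFDerivAt_clm_sub_const (A : E d →L[ℝ] E d) (c y : E d) :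
    HasFDerivAt (fun y => A (y - c)) A y := by
  have h := A.hasFDerivAt.comp y ((hasFDerivAt_id y).sub_const c)
  rwa [ContinuousLinearMap.comp_id] at h

/-- The infinitesimal rotation in the plane spanned by `a` and `b`. -/
def planeSkew (a b : E d) : E d →L[ℝ] E d :=
  (innerSL ℝ a).smulRight b - (innerSL ℝ b).smulRight a

theorem planeSkew_apply (a b v : E d) : planeSkew a b v = ⟪a, v⟫ • b - ⟪b, v⟫ • a := rfl

theorem inner_planeSkew (a b v w : E d) : ⟪planeSkew a b v, w⟫ = -⟪v, planeSkew a b w⟫ := by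
  simp only [planeSkew_apply, inner_sub_left, inner_sub_right, real_inner_smul_left,
    real_inner_smul_right, real_inner_comm v]
  ring

theorem inner_planeSkew_self (a b v : E d) : ⟪v, planeSkew a b v⟫ = 0 := by
  have h := inner_planeSkew a b v v
  rw [real_inner_comm] at h
  linarith

/-- The rotation by the angle `θ` in the plane spanned by the orthonormal vectors `a` and `b`. -/
def planeRot (a b : E d) (θ : ℝ) : E d →L[ℝ] E d :=
  ContinuousLinearMap.id ℝ (E d) + Real.sin θ • planeSkew a b +
    (1 - Real.cos θ) • (planeSkew a b).comp (planeSkew a b)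

theorem planeRot_apply (a b : E d) (θ : ℝ) (v : E d) : planeRot a b θ v =
    v + Real.sin θ • planeSkew a b v + (1 - Real.cos θ) • planeSkew a b (planeSkew a b v) := rfl

/-- The map that rotates the sphere of radius `r` around `c` by the angle `s β(r²)`. -/
def twist (a b c : E d) (β : ℝ → ℝ) (s : ℝ) (y : E d) : E d :=
  c + planeRot a b (s * β (‖y - c‖ ^ 2)) (y - c)

theorem contDiff_twist (a b c : E d) {β : ℝ → ℝ} (hβ : ContDiff ℝ ∞ β) :
    ContDiff ℝ ∞ fun q : ℝ × E d => twist a b c β q.1 q.2 := by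
  have h1 : ContDiff ℝ ∞ fun q : ℝ × E d => q.2 - c := contDiff_snd.sub contDiff_const
  have h2 : ContDiff ℝ ∞ fun q : ℝ × E d => q.1 * β (‖q.2 - c‖ ^ 2) :=
    contDiff_fst.mul (hβ.comp (h1.norm_sq ℝ))
  have hA := (planeSkew a b).contDiff (n := ∞)
  simp only [twist, planeRot_apply]
  exact contDiff_const.add ((h1.add ((Real.contDiff_sin.comp h2).smul (hA.comp h1))).add
    ((contDiff_const.sub (Real.contDiff_cos.comp h2)).smul (hA.comp (hA.comp h1))))

theorem twist_of_eq_zero (a b c : E d) {β : ℝ → ℝ} {s : ℝ} {y : E d}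
    (h : s * β (‖y - c‖ ^ 2) = 0) : twist a b c β s y = y := by
  simp [twist, planeRot_apply, h]

theorem hasDerivAt_twist (a b c : E d) (β : ℝ → ℝ) (y : E d) :
    HasDerivAt (fun s => twist a b c β s y) (β (‖y - c‖ ^ 2) • planeSkew a b (y - c)) 0 := by
  have h : HasDerivAt (fun s : ℝ => s * β (‖y - c‖ ^ 2)) (β (‖y - c‖ ^ 2)) 0 := by
    simpa using (hasDerivAt_id (0 : ℝ)).mul_const (β (‖y - c‖ ^ 2))
  have h1 := ((h.sin.smul_const (planeSkew a b (y - c))).const_add (y - c)).add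
    (((h.cos.const_sub 1).smul_const (planeSkew a b (planeSkew a b (y - c)))))
  exact (h1.const_add c).congr_deriv (by simp)

/-! ### Rotations in a plane and the volume-preserving twists they generate -/

section Orthonormal

variable {a b : E d} (ha : ⟪a, a⟫ = 1) (hb : ⟪b, b⟫ = 1) (hab : ⟪a, b⟫ = 0)

include ha hb hab

theorem planeSkew_planeSkew (v : E d) :
    planeSkew a b (planeSkew a b v) = -(⟪a, v⟫ • a + ⟪b, v⟫ • b) := by
  have hba : ⟪b, a⟫ = 0 := by rw [real_inner_comm, hab]
  simp only [planeSkew_apply, inner_sub_right, real_inner_smul_right, ha, hb, hab, hba]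
  module

/-- With `A³ = -A` the exponential series of `θ A` collapses to the Rodrigues formula, which is the
form in which `planeRot` is defined. -/
theorem planeSkew_cube (v : E d) :
    planeSkew a b (planeSkew a b (planeSkew a b v)) = -planeSkew a b v := by
  have hba : ⟪b, a⟫ = 0 := by rw [real_inner_comm, hab]
  rw [planeSkew_planeSkew ha hb hab v]
  simp only [planeSkew_apply, inner_neg_right, inner_add_right, real_inner_smul_right, ha, hb, hab,
    hba]
  module

theorem planeRot_neg_planeRot (θ : ℝ) (v : E d) : planeRot a b (-θ) (planeRot a b θ v) = v := by
  have h3 := planeSkew_cube ha hb hab v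
  simp only [planeRot_apply, map_add, map_smul, h3, map_neg, Real.sin_neg, Real.cos_neg]
  have h4 : 2 * (1 - Real.cos θ) - (1 - Real.cos θ) ^ 2 - Real.sin θ ^ 2 = 0 := by
    linear_combination -(Real.sin_sq_add_cos_sq θ)
  calc _ = v + (2 * (1 - Real.cos θ) - (1 - Real.cos θ) ^ 2 - Real.sin θ ^ 2) •
        planeSkew a b (planeSkew a b v) := by module
    _ = v := by rw [h4, zero_smul, add_zero]

theorem norm_planeRot (θ : ℝ) (v : E d) : ‖planeRot a b θ v‖ = ‖v‖ := by
  have hba : ⟪b, a⟫ = 0 := by rw [real_inner_comm, hab]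
  have h : ‖planeRot a b θ v‖ ^ 2 = ‖v‖ ^ 2 := by
    rw [← real_inner_self_eq_norm_sq, ← real_inner_self_eq_norm_sq, planeRot_apply,
      planeSkew_planeSkew ha hb hab, planeSkew_apply]
    simp only [inner_add_left, inner_add_right, inner_sub_left, inner_sub_right, inner_neg_left,
      inner_neg_right, real_inner_smul_left, real_inner_smul_right, ha, hb, hab, hba,
      real_inner_comm a v, real_inner_comm b v]
    linear_combination (⟪a, v⟫ ^ 2 + ⟪b, v⟫ ^ 2) * Real.sin_sq_add_cos_sq θ
  exact (pow_left_inj₀ (norm_nonneg _) (norm_nonneg _) two_ne_zero).1 h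

theorem abs_det_planeRot (θ : ℝ) : |(planeRot a b θ).det| = 1 := by
  let e : E d →ₗᵢ[ℝ] E d := ⟨(planeRot a b θ).toLinearMap, norm_planeRot ha hb hab θ⟩
  have h := LinearMap.normDet_eq_abs_det e.toLinearMap
  rw [LinearIsometry.normDet_eq_one] at h
  exact h.symm

theorem norm_twist_sub (c : E d) (β : ℝ → ℝ) (s : ℝ) (y : E d) :
    ‖twist a b c β s y - c‖ = ‖y - c‖ := by
  rw [twist, add_sub_cancel_left, norm_planeRot ha hb hab]

/-- A twist preserves the distance to its centre, so a point and its image are rotated by the same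
angle. -/
theorem twist_neg_twist (c : E d) (β : ℝ → ℝ) (s : ℝ) (y : E d) :
    twist a b c β (-s) (twist a b c β s y) = y := by
  rw [twist, norm_twist_sub ha hb hab, twist, add_sub_cancel_left, neg_mul,
    planeRot_neg_planeRot ha hb hab, add_sub_cancel]

theorem isDiffeo_twist (c : E d) {β : ℝ → ℝ} (hβ : ContDiff ℝ ∞ β) (s : ℝ) :
    IsDiffeo (twist a b c β s) := by
  have h : ∀ s, ContDiff ℝ ∞ (twist a b c β s) := fun s =>
    ContDiff.comp (g := fun q : ℝ × E d => twist a b c β q.1 q.2) (f := fun y => (s, y))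
      (contDiff_twist a b c hβ) (contDiff_const.prodMk contDiff_id)
  refine ⟨h s, twist a b c β (-s), h _, twist_neg_twist ha hb hab c β s, fun y => ?_⟩
  simpa using twist_neg_twist ha hb hab c β (-s) y

/-- Since `d/dθ` of the rotation is the rotation composed with `A`, the derivative of the angle
contributes a rank-one term that factors through the rotation. -/
theorem hasFDerivAt_twist (c : E d) {β : ℝ → ℝ} (hβ : ContDiff ℝ ∞ β) (s : ℝ) (y : E d) :
    HasFDerivAt (twist a b c β s) ((planeRot a b (s * β (‖y - c‖ ^ 2))).comp
      (ContinuousLinearMap.id ℝ (E d) + ((s * (2 * deriv β (‖y - c‖ ^ 2))) •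
        innerSL ℝ (y - c)).smulRight (planeSkew a b (y - c)))) y := by
  have h0 : HasFDerivAt (fun y => y - c) (ContinuousLinearMap.id ℝ (E d)) y :=
    (hasFDerivAt_id y).sub_const c
  have h1 : HasFDerivAt (fun y => s * β (‖y - c‖ ^ 2))
      ((s * (2 * deriv β (‖y - c‖ ^ 2))) • innerSL ℝ (y - c)) y := by
    have h2 := (hβ.contDiffAt.differentiableAt (x := ‖y - c‖ ^ 2) (by simp)).hasDerivAt
    have h3 := (h2.comp_hasFDerivAt y h0.norm_sq).const_mul s
    refine h3.congr_fderiv ?_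
    ext v
    simp
    ring
  have h4 : HasFDerivAt (fun y => planeSkew a b (y - c)) (planeSkew a b) y :=
    hasFDerivAt_clm_sub_const _ _ _
  have h5 : HasFDerivAt (fun y => planeSkew a b (planeSkew a b (y - c)))
      ((planeSkew a b).comp (planeSkew a b)) y :=
    hasFDerivAt_clm_sub_const ((planeSkew a b).comp (planeSkew a b)) _ _
  have h6 := (((h0.add (h1.sin.smul h4)).add ((h1.cos.const_sub 1).smul h5))).const_add c
  have h7 : HasFDerivAt (twist a b c β s) _ y := h6
  refine h7.congr_fderiv (ContinuousLinearMap.ext fun v => ?_)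
  clear h7 h6 h5 h4 h1 h0
  have h3 := planeSkew_cube ha hb hab (y - c)
  simp only [_root_.add_apply, ContinuousLinearMap.comp_apply, planeRot_apply,
    _root_.smul_apply, ContinuousLinearMap.smulRight_apply,
    ContinuousLinearMap.id_apply, map_add, map_smul, h3, _root_.neg_apply,
    smul_eq_mul]
  module

/-- The rank-one factor is a transvection: its covector is proportional to `y - c`, which is
orthogonal to `A (y - c)`. So the twist preserves volume for every angle profile `β`. -/
theorem abs_det_fderiv_twist (c : E d) {β : ℝ → ℝ} (hβ : ContDiff ℝ ∞ β) (s : ℝ) (y : E d) :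
    |(fderiv ℝ (twist a b c β s) y).det| = 1 := by
  rw [(hasFDerivAt_twist ha hb hab c hβ s y).fderiv, det_comp, abs_mul,
    abs_det_planeRot ha hb hab, one_mul]
  rw [det_id_add_smulRight]
  rw [_root_.smul_apply, innerSL_apply_apply, inner_planeSkew_self, smul_zero, add_zero,
    abs_one]

theorem push_twist_one (c : E d) {β : ℝ → ℝ} (hβ : ContDiff ℝ ∞ β) (s : ℝ) :
    push (twist a b c β s) (fun _ => 1) = fun _ => 1 := by
  funext x
  have hT := isDiffeo_twist ha hb hab c hβ s
  have h1 := congrArg abs (hT.det_invFun_mul x)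
  rw [abs_mul, abs_det_fderiv_twist ha hb hab c hβ, one_mul, abs_one] at h1
  rw [push, h1, one_mul]

end Orthonormal

/-! ### Straightening a positive density -/

theorem hasFDerivAt_parametric_integral {V W : Type} [NormedAddCommGroup V] [NormedSpace ℝ V]
    [ProperSpace V] [NormedAddCommGroup W] [NormedSpace ℝ W] {f : V × ℝ → W}
    (hf : ContDiff ℝ 1 f) (z : V) :
    HasFDerivAt (fun z => ∫ s in (0 : ℝ)..1, f (z, s))
      (∫ s in (0 : ℝ)..1, (fderiv ℝ f (z, s)).comp (ContinuousLinearMap.inl ℝ V ℝ)) z := by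
  have hc : Continuous fun q : V × ℝ => (fderiv ℝ f q).comp (ContinuousLinearMap.inl ℝ V ℝ) :=
    (hf.continuous_fderiv (by simp)).clm_comp continuous_const
  obtain ⟨C, hC⟩ := ((isCompact_closedBall z 1).prod
    (isCompact_Icc (a := (0 : ℝ)) (b := 1))).exists_bound_of_continuousOn hc.continuousOn
  have hfc := hf.continuous
  refine intervalIntegral.hasFDerivAt_integral_of_dominated_of_fderiv_le
    (bound := fun _ => C) (F := fun z s => f (z, s))
    (F' := fun z s => (fderiv ℝ f (z, s)).comp (ContinuousLinearMap.inl ℝ V ℝ))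
    (Metric.closedBall_mem_nhds z one_pos) ?_ ?_ ?_ ?_ ?_ ?_
  · exact Eventually.of_forall fun y => (by fun_prop : Continuous fun s => f (y, s)).aestronglyMeasurable
  · exact (by fun_prop : Continuous fun s => f (z, s)).intervalIntegrable _ _
  · exact (hc.comp (by fun_prop : Continuous fun s : ℝ => (z, s))).aestronglyMeasurable
  · refine Eventually.of_forall fun s hs y hy => hC (y, s) ⟨hy, ?_⟩
    rw [uIoc_of_le zero_le_one] at hs
    exact Ioc_subset_Icc_self hs
  · exact intervalIntegrable_const
  · refine Eventually.of_forall fun s _ y _ => ?_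
    exact (hf.contDiffAt.differentiableAt (by simp)).hasFDerivAt.comp y
      (hasFDerivAt_prodMk_left y s)

theorem contDiff_parametric_integral {V W : Type} [NormedAddCommGroup V] [NormedSpace ℝ V]
    [ProperSpace V] [NormedAddCommGroup W] [NormedSpace ℝ W] {f : V × ℝ → W}
    (hf : ContDiff ℝ ∞ f) : ContDiff ℝ ∞ fun z => ∫ s in (0 : ℝ)..1, f (z, s) := by
  refine contDiff_infty.2 fun n => ?_
  -- The codomain varies because the derivative of the integral is an integral of operator-valued
  -- functions.
  induction n generalizing W with
  | zero =>
    have h : Differentiable ℝ fun z => ∫ s in (0 : ℝ)..1, f (z, s) := fun z =>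
      (hasFDerivAt_parametric_integral (hf.of_le (by simp)) z).differentiableAt
    exact contDiff_zero.2 h.continuous
  | succ n ih =>
    refine contDiff_succ_iff_hasFDerivAt.2 ⟨_, ?_, fun z =>
      hasFDerivAt_parametric_integral (hf.of_le (by simp)) z⟩
    exact ih (f := fun q => (fderiv ℝ f q).comp (ContinuousLinearMap.inl ℝ V ℝ))
      ((hf.fderiv_right (by simp)).clm_comp contDiff_const)

section Straighten

variable {m : E d → ℝ} {e : E d}

/-- The integral of `m` along the line in direction `e` through `z`. -/
def lineIntegral (m : E d → ℝ) (e z : E d) : ℝ :=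
  ∫ s in (0 : ℝ)..⟪e, z⟫, m (z + (s - ⟪e, z⟫) • e)

/-- The map with Jacobian determinant `m` that moves points along the direction `e`. -/
def straighten (m : E d → ℝ) (e z : E d) : E d := z + (lineIntegral m e z - ⟪e, z⟫) • e

theorem contDiff_lineIntegral (hm : ContDiff ℝ ∞ m) : ContDiff ℝ ∞ (lineIntegral m e) := by
  -- Rescaling to the fixed interval `[0, 1]` moves the variable endpoint into the integrand.
  have h : lineIntegral m e = fun z => ⟪e, z⟫ *
      ∫ u in (0 : ℝ)..1, m (z + (u * ⟪e, z⟫ - ⟪e, z⟫) • e) := by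
    funext z
    have := intervalIntegral.smul_integral_comp_mul_right (a := 0) (b := 1)
      (fun s => m (z + (s - ⟪e, z⟫) • e)) ⟪e, z⟫
    rw [zero_mul, one_mul, smul_eq_mul] at this
    exact this.symm
  rw [h]
  have he : ContDiff ℝ ∞ fun z : E d => ⟪e, z⟫ := contDiff_const.inner ℝ contDiff_id
  have he' : ContDiff ℝ ∞ fun q : E d × ℝ => ⟪e, q.1⟫ := he.comp contDiff_fst
  refine he.mul (contDiff_parametric_integral
    (f := fun q : E d × ℝ => m (q.1 + (q.2 * ⟪e, q.1⟫ - ⟪e, q.1⟫) • e)) (hm.comp ?_))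
  exact contDiff_fst.add (((contDiff_snd.mul he').sub he').smul contDiff_const)

theorem contDiff_straighten (hm : ContDiff ℝ ∞ m) : ContDiff ℝ ∞ (straighten m e) :=
  contDiff_id.add (((contDiff_lineIntegral hm).sub (contDiff_const.inner ℝ contDiff_id)).smul
    contDiff_const)

variable (he : ⟪e, e⟫ = 1)
include he

theorem lineIntegral_add_smul (z : E d) (τ : ℝ) : lineIntegral m e (z + τ • e) =
    ∫ s in (0 : ℝ)..⟪e, z⟫ + τ, m (z + (s - ⟪e, z⟫) • e) := by
  have h : ⟪e, z + τ • e⟫ = ⟪e, z⟫ + τ := by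
    rw [inner_add_right, real_inner_smul_right, he, mul_one]
  rw [lineIntegral, h]
  congr 1
  funext s
  congr 1
  module

theorem hasDerivAt_lineIntegral (hm : Continuous m) (z : E d) (τ : ℝ) :
    HasDerivAt (fun τ : ℝ => lineIntegral m e (z + τ • e)) (m (z + τ • e)) τ := by
  have hc : Continuous fun s : ℝ => m (z + (s - ⟪e, z⟫) • e) := by fun_prop
  have h1 := intervalIntegral.integral_hasDerivAt_right (hc.intervalIntegrable 0 (⟪e, z⟫ + τ))
    (hc.stronglyMeasurableAtFilter _ _) hc.continuousAt
  have h2 := h1.comp_const_add ⟪e, z⟫ τ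
  simp only [add_sub_cancel_left] at h2
  exact h2.congr_of_eventuallyEq
    (Eventually.of_forall fun τ => lineIntegral_add_smul he z τ)

theorem inner_straighten (z : E d) : ⟪e, straighten m e z⟫ = lineIntegral m e z := by
  rw [straighten, inner_add_right, real_inner_smul_right, he]
  ring

/-- The map moves points only along `e`, so its derivative is the identity plus a rank-one term and
the determinant is the derivative of the line integral in direction `e`, which is the integrand. -/
theorem det_fderiv_straighten (hm : ContDiff ℝ ∞ m) (z : E d) :
    (fderiv ℝ (straighten m e) z).det = m z := by
  have h1 : HasFDerivAt (lineIntegral m e) (fderiv ℝ (lineIntegral m e) z) z :=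
    ((contDiff_lineIntegral hm).contDiffAt.differentiableAt (by simp)).hasFDerivAt
  have h2 : HasFDerivAt (fun z : E d => ⟪e, z⟫) (innerSL ℝ e) z := (innerSL ℝ e).hasFDerivAt
  have h3 : HasFDerivAt (straighten m e) (ContinuousLinearMap.id ℝ (E d) +
      (fderiv ℝ (lineIntegral m e) z - innerSL ℝ e).smulRight e) z :=
    (hasFDerivAt_id z).add ((h1.sub h2).smul_const e)
  have h4 : fderiv ℝ (lineIntegral m e) z e = m z := by
    have h5 : HasDerivAt (fun τ : ℝ => z + τ • e) e 0 := by
      simpa using ((hasDerivAt_id (0 : ℝ)).smul_const e).const_add z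
    have h6 : HasDerivAt (fun τ : ℝ => lineIntegral m e (z + τ • e))
        (fderiv ℝ (lineIntegral m e) z e) 0 :=
      HasFDerivAt.comp_hasDerivAt (l := lineIntegral m e) 0 (by simpa using h1) h5
    have h7 := h6.unique (hasDerivAt_lineIntegral he hm.continuous z 0)
    simpa using h7
  rw [h3.fderiv, det_id_add_smulRight, _root_.sub_apply, h4, innerSL_apply_apply, he]
  ring

/-- Each line parallel to `e` is mapped to itself, increasingly and with slope at least `κ`; the
lower bound makes this onto. The determinant never vanishes, so the inverse is smooth. -/
theorem isDiffeo_straighten (hm : ContDiff ℝ ∞ m) {κ : ℝ} (hκ : 0 < κ) (hb : ∀ z, κ ≤ m z) :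
    IsDiffeo (straighten m e) := by
  have hmono : ∀ z, StrictMono fun τ : ℝ => lineIntegral m e (z + τ • e) := fun z =>
    strictMono_of_deriv_pos fun τ => by
      rw [(hasDerivAt_lineIntegral he hm.continuous z τ).deriv]
      exact hκ.trans_le (hb _)
  have hsurj : ∀ z, Function.Surjective fun τ : ℝ => lineIntegral m e (z + τ • e) := by
    intro z
    have hd := fun τ => hasDerivAt_lineIntegral he hm.continuous z τ
    have hd' : ∀ τ, HasDerivAt (fun τ : ℝ => lineIntegral m e (z + τ • e) - τ * κ)
        (m (z + τ • e) - κ) τ := fun τ =>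
      ((hd τ).sub ((hasDerivAt_id τ).mul_const κ)).congr_deriv (by rw [one_mul])
    have hmon : Monotone fun τ : ℝ => lineIntegral m e (z + τ • e) - τ * κ :=
      monotone_of_deriv_nonneg (fun τ => (hd' τ).differentiableAt) fun τ => by
        rw [(hd' τ).deriv]
        exact sub_nonneg.2 (hb _)
    refine Continuous.surjective (continuous_iff_continuousAt.2 fun τ => (hd τ).continuousAt) ?_ ?_
    · refine tendsto_atTop_mono' _ ?_ (tendsto_atTop_add_const_left _ (lineIntegral m e z)
        (tendsto_id.atTop_mul_const hκ))
      filter_upwards [eventually_ge_atTop 0] with τ hτ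
      have := hmon hτ
      simp only [zero_smul, add_zero, zero_mul, sub_zero] at this
      simp only [id]
      linarith
    · refine tendsto_atBot_mono' _ ?_ (tendsto_atBot_add_const_left _ (lineIntegral m e z)
        (tendsto_id.atBot_mul_const hκ))
      filter_upwards [eventually_le_atBot 0] with τ hτ
      have := hmon hτ
      simp only [zero_smul, add_zero, zero_mul, sub_zero] at this
      simp only [id]
      linarith
  have hbij : Function.Bijective (straighten m e) := by
    constructor
    · intro z w hzw
      have h1 : lineIntegral m e z = lineIntegral m e w := by
        rw [← inner_straighten he, hzw, inner_straighten he]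
      obtain ⟨τ, hτ⟩ : ∃ τ : ℝ, z = w + τ • e := by
        refine ⟨(lineIntegral m e w - ⟪e, w⟫) - (lineIntegral m e z - ⟪e, z⟫), ?_⟩
        simp only [straighten] at hzw
        rw [sub_smul, ← add_sub_assoc, ← hzw, add_sub_cancel_right]
      have h2 : τ = 0 := (hmono w).injective (by simpa [← hτ] using h1)
      rw [hτ, h2, zero_smul, add_zero]
    · intro y
      obtain ⟨τ, hτ⟩ := hsurj y ⟪e, y⟫
      refine ⟨y + τ • e, ?_⟩
      simp only at hτ
      rw [straighten, hτ, inner_add_right, real_inner_smul_right, he]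
      module
  have hs := contDiff_straighten (e := e) hm
  have hdet : ∀ z, (fderiv ℝ (straighten m e) z).det ≠ 0 := fun z => by
    rw [det_fderiv_straighten he hm]
    exact (hκ.trans_le (hb z)).ne'
  let A : E d → E d ≃L[ℝ] E d := fun z => (fderiv ℝ (straighten m e) z).toContinuousLinearEquivOfDetNeZero (hdet z)
  have hA : ∀ z, HasStrictFDerivAt (straighten m e) (A z : E d →L[ℝ] E d) z := fun z =>
    hs.contDiffAt.hasStrictFDerivAt (by simp)
  let H : E d ≃ₜ E d := (Equiv.ofBijective _ hbij).toHomeomorphOfContinuousOpen hs.continuous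
    (isOpenMap_of_hasStrictFDerivAt_equiv hA)
  exact ⟨hs, H.symm, H.contDiff_symm (f₀' := A) (fun z => (hA z).hasFDerivAt) hs,
    H.symm_apply_apply, H.apply_symm_apply⟩

theorem push_straighten (hm : ContDiff ℝ ∞ m) {κ : ℝ} (hκ : 0 < κ) (hb : ∀ z, κ ≤ m z) :
    push (straighten m e) m = fun _ => 1 := by
  funext x
  have hT := isDiffeo_straighten he hm hκ hb
  have h1 := hT.det_invFun_mul x
  rw [det_fderiv_straighten he hm] at h1
  rw [push, ← abs_of_pos (hκ.trans_le (hb (Function.invFun (straighten m e) x))), ← abs_mul, h1,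
    abs_one]

end Straighten

/-! ### Rearrangements preserving a density -/

theorem push_comp {T S : E d → E d} (hT : IsDiffeo T) (hS : IsDiffeo S) (lam : E d → ℝ) :
    push (fun z => T (S z)) lam = push T (push S lam) := by
  have h : Function.invFun (fun z => T (S z)) = Function.invFun S ∘ Function.invFun T :=
    IsDiffeo.invFun_eq (fun z => by simp [hT.invFun_apply, hS.invFun_apply])
      fun z => by simp [hT.apply_invFun, hS.apply_invFun]
  funext x
  have h1 : DifferentiableAt ℝ (Function.invFun S) (Function.invFun T x) :=
    hS.contDiff_invFun.contDiffAt.differentiableAt (by simp)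
  have h2 : DifferentiableAt ℝ (Function.invFun T) x :=
    hT.contDiff_invFun.contDiffAt.differentiableAt (by simp)
  rw [push, push, push, h, fderiv_comp x h1 h2, det_comp, abs_mul, Function.comp_apply]
  ring

theorem isDiffeo_id : IsDiffeo (fun z : E d => z) :=
  ⟨contDiff_id, fun z => z, contDiff_id, fun _ => rfl, fun _ => rfl⟩

theorem invFun_id : Function.invFun (fun z : E d => z) = fun z => z :=
  IsDiffeo.invFun_eq (fun _ => rfl) fun _ => rfl

theorem push_id (lam : E d → ℝ) : push (fun z => z) lam = lam := by
  funext x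
  have : fderiv ℝ (fun z : E d => z) x = ContinuousLinearMap.id ℝ (E d) := fderiv_fun_id
  rw [push, invFun_id, this, det_clm_id, abs_one, mul_one]

theorem IsDiffeo.invFun {T : E d → E d} (hT : IsDiffeo T) : IsDiffeo (Function.invFun T) :=
  ⟨hT.contDiff_invFun, T, hT.1, hT.apply_invFun, hT.invFun_apply⟩

theorem push_conj {Ψ R : E d → E d} (hΨ : IsDiffeo Ψ) (hR : IsDiffeo R) {m : E d → ℝ}
    (hm : push Ψ m = fun _ => 1) (hR1 : push R (fun _ => 1) = fun _ => 1) :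
    push (fun z => Function.invFun Ψ (R (Ψ z))) m = m := by
  rw [push_comp (S := fun z => R (Ψ z)) hΨ.invFun (hR.comp hΨ), push_comp hR hΨ, hm, hR1, ← hm,
    ← push_comp hΨ.invFun hΨ]
  simp only [hΨ.invFun_apply, push_id]

/-- A diffeomorphism that is the identity off `K` maps `K` to itself, so on `K` only the values of
the density on `K` matter. Invariance of `m` thus passes to `λ`. -/
theorem push_eq_self_of_eqOn {η : E d → E d} (hη : IsDiffeo η) {K : Set (E d)} (hK : IsCompact K)
    (hoff : ∀ z ∉ K, η z = z) {m lam : E d → ℝ} (hm : push η m = m) (h : EqOn m lam K) :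
    push η lam = lam := by
  funext x
  by_cases hx : x ∈ K
  · have h1 : Function.invFun η x ∈ K := by
      by_contra hn
      have := hoff _ hn
      rw [hη.apply_invFun] at this
      exact hn (this ▸ hx)
    have h2 := congrFun hm x
    rw [push, h h1, h hx] at h2
    exact h2
  · rw [push_eq_of_eq_off isDiffeo_id hη hK hoff lam (by simpa using hx), push_id]

/-- Take `λ + (1 - χ)` with a bump `χ` equal to one on the unit ball and zero off the ball of radius
two. Inside the larger ball `λ` has a positive minimum, outside it the second summand is one. The
global lower bound, which `λ` may lack, is what straightening requires. -/
theorem exists_le_eqOn_ball {lam : E d → ℝ} (hlam : ContDiff ℝ ∞ lam) (hpos : ∀ z, 0 < lam z)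
    (z₀ : E d) : ∃ m : E d → ℝ, ContDiff ℝ ∞ m ∧ (∃ κ > 0, ∀ z, κ ≤ m z) ∧
      EqOn m lam (Metric.closedBall z₀ 1) := by
  let χ : ContDiffBump z₀ := ⟨1, 2, one_pos, one_lt_two⟩
  obtain ⟨w, -, hw⟩ := (isCompact_closedBall z₀ 2).exists_isMinOn
    ⟨z₀, Metric.mem_closedBall_self zero_le_two⟩ hlam.continuous.continuousOn
  refine ⟨fun z => lam z + (1 - χ z), hlam.add (contDiff_const.sub χ.contDiff),
    ⟨min (lam w) 1, lt_min (hpos w) one_pos, fun z => ?_⟩, fun z hz => ?_⟩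
  · by_cases hz : z ∈ Metric.closedBall z₀ 2
    · have h1 : lam w ≤ lam z := hw hz
      have := χ.le_one (x := z)
      exact (min_le_left _ _).trans (by linarith)
    · have h1 : χ z = 0 := χ.zero_of_le_dist (by simpa using (not_le.1 hz).le)
      have := (hpos z).le
      exact (min_le_right _ _).trans (by simp only [h1]; linarith)
  · have h1 : χ z = 1 := χ.one_of_mem_closedBall hz
    simp [h1]

/-! ### Infinitesimal circulation -/

/-- Turns the `(a, b)` component of the curl of `α` into a divergence, ready for integration by
parts. -/
theorem divergence_planeSkew {α : E d → E d} {y : E d} (hα : DifferentiableAt ℝ α y) (a b : E d) :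
    divergence (fun y => planeSkew a b (α y)) y =
      ⟪a, fderiv ℝ α y b⟫ - ⟪b, fderiv ℝ α y a⟫ := by
  have h : fderiv ℝ (fun y => planeSkew a b (α y)) y = (planeSkew a b).comp (fderiv ℝ α y) :=
    ((planeSkew a b).hasFDerivAt.comp y hα.hasFDerivAt).fderiv
  have h2 : ((planeSkew a b).comp (fderiv ℝ α y)).toLinearMap =
      ((innerSL ℝ a).comp (fderiv ℝ α y)).toLinearMap.smulRight b -
        ((innerSL ℝ b).comp (fderiv ℝ α y)).toLinearMap.smulRight a := by
    ext1 v
    rfl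
  rw [divergence, h, h2, map_sub, LinearMap.trace_smulRight, LinearMap.trace_smulRight]
  rfl

/-- A smooth function of one variable equal to one near zero and supported in `(-δ², δ²)`. -/
def radialBump (δ : ℝ) (hδ : 0 < δ) : ContDiffBump (0 : ℝ) :=
  ⟨δ ^ 2 / 2, δ ^ 2, by positivity, by linarith [pow_pos hδ 2]⟩

theorem deriv_radialBump {δ : ℝ} (hδ : 0 < δ) {c y : E d} (hy : y ∉ Metric.closedBall c δ) :
    deriv (radialBump δ hδ) (‖y - c‖ ^ 2) = 0 := by
  have h1 : δ < ‖y - c‖ := by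
    rw [Metric.mem_closedBall, not_le, dist_eq_norm] at hy
    exact hy
  have h2 : ‖y - c‖ ^ 2 ∉ tsupport (radialBump δ hδ) := by
    rw [(radialBump δ hδ).tsupport_eq, Metric.mem_closedBall, not_le, dist_zero_right,
      Real.norm_of_nonneg (sq_nonneg _)]
    exact pow_lt_pow_left₀ h1 hδ.le two_ne_zero
  by_contra hn
  exact h2 (support_deriv_subset hn)

/-- If the small circulations of a vector field around a point vanish, so does its curl there. -/
theorem inner_fderiv_eq_of_integral_eq_zero {α : E d → E d} (hα : ContDiff ℝ ∞ α) (a b c : E d)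
    {δ₀ : ℝ} (hδ₀ : 0 < δ₀) (h : ∀ δ, ∀ hδ : 0 < δ, δ < δ₀ →
      ∫ y, ⟪α y, deriv (radialBump δ hδ) (‖y - c‖ ^ 2) • planeSkew a b (y - c)⟫ = 0) :
    ⟪a, fderiv ℝ α c b⟫ = ⟪b, fderiv ℝ α c a⟫ := by
  set w : E d → E d := fun y => planeSkew a b (α y) with hw
  have hws : ContDiff ℝ ∞ w := (planeSkew a b).contDiff.comp hα
  set g : E d → ℝ := divergence w with hg
  have hgc : Continuous g := by
    have : Continuous (fderiv ℝ α) := hα.continuous_fderiv (by simp)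
    have h1 : g = fun y => ⟪a, fderiv ℝ α y b⟫ - ⟪b, fderiv ℝ α y a⟫ := funext fun y =>
      divergence_planeSkew (hα.contDiffAt.differentiableAt (by simp)) a b
    rw [h1]
    fun_prop
  suffices hgz : g c = 0 by
    rw [hg, hw, divergence_planeSkew (hα.contDiffAt.differentiableAt (by simp))] at hgz
    exact sub_eq_zero.1 hgz
  by_contra hne
  have hnear : ∀ᶠ y in 𝓝 c, 0 < g y * g c :=
    ((by fun_prop : Continuous fun y => g y * g c).tendsto c).eventually_const_lt
      (mul_self_pos.2 hne)
  obtain ⟨r, hr, hball⟩ := Metric.eventually_nhds_iff_ball.1 hnear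
  obtain ⟨δ, hδ, hδm⟩ := exists_between (lt_min hr hδ₀)
  set B := radialBump δ hδ with hB
  set f : E d → ℝ := fun y => B (‖y - c‖ ^ 2) with hf
  have hfs : ContDiff ℝ ∞ f := B.contDiff.comp ((contDiff_id.sub contDiff_const).norm_sq ℝ)
  have hf0 : ∀ y ∉ Metric.closedBall c δ, f y = 0 := fun y hy => by
    rw [Metric.mem_closedBall, not_le, dist_eq_norm] at hy
    refine B.zero_of_le_dist ?_
    rw [dist_zero_right, Real.norm_of_nonneg (sq_nonneg _)]
    exact (pow_lt_pow_left₀ hy hδ.le two_ne_zero).le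
  have hfc : HasCompactSupport f := HasCompactSupport.intro (isCompact_closedBall c δ) hf0
  have h1 := integral_fderiv_apply_eq (hfs.of_le (by simp)) (hws.of_le (by simp)) (Or.inl hfc)
  -- The gradient of the radial function `f` is `2 B'(|y - c|²) (y - c)`. Moving the skew map across
  -- the inner product gives the twist field, whose pairing with `α` vanishes by assumption; hence
  -- `∫ f div w = 0`.
  have h2 : ∀ y, fderiv ℝ f y (w y) =
      -2 * ⟪α y, deriv B (‖y - c‖ ^ 2) • planeSkew a b (y - c)⟫ := fun y => by
    have h0 : HasFDerivAt (fun y => y - c) (ContinuousLinearMap.id ℝ (E d)) y :=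
      (hasFDerivAt_id y).sub_const c
    have hd := (B.contDiff.contDiffAt.differentiableAt (n := ∞) (x := ‖y - c‖ ^ 2)
      (by simp)).hasDerivAt.comp_hasFDerivAt y h0.norm_sq
    have he : fderiv ℝ f y = _ := hd.fderiv
    rw [he, real_inner_smul_right, real_inner_comm, inner_planeSkew]
    simp [hw, inner_sub_left]
    ring
  have h3 := h δ hδ (hδm.trans_le (min_le_right _ _))
  rw [← hB] at h3
  rw [integral_congr_ae (Eventually.of_forall h2), integral_const_mul, h3, mul_zero] at h1
  have h4 : ∫ y, f y * (g y * g c) = 0 := by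
    simp only [← mul_assoc, integral_mul_const]
    rw [hg, neg_eq_zero.1 h1.symm, zero_mul]
  -- If the curl at `c` were nonzero it would keep its sign on a small ball. Since `f ≥ 0`, `f c =
  -- 1` and `f` vanishes off that ball, the integral could not be zero.
  have hpos : 0 < ∫ y, f y * (g y * g c) := by
    refine Continuous.integral_pos_of_hasCompactSupport_nonneg_nonzero (x := c)
      (hfs.continuous.mul (hgc.mul continuous_const)) hfc.mul_right (fun y => ?_) ?_
    · by_cases hy : y ∈ Metric.closedBall c δ
      · exact mul_nonneg B.nonneg (hball y (Metric.closedBall_subset_ball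
          (hδm.trans_le (min_le_left _ _)) hy)).le
      · simp [hf0 y hy]
    · have : f c = 1 := by
        simp only [hf, sub_self, norm_zero]
        exact B.one_of_mem_closedBall (by simpa using B.rIn_pos.le)
      rw [this, one_mul]
      exact (mul_self_pos.2 hne).ne'
  exact hpos.ne' h4

/-! ### The initial velocity of a critical path is a gradient -/

/-- Twists exist only in planes spanned by orthonormal pairs. Expansion in the standard basis uses
just these, the diagonal terms being trivially symmetric. -/
theorem bilin_symm_of_basis {M N : E d →L[ℝ] E d}
    (h : ∀ a b : E d, ⟪a, a⟫ = 1 → ⟪b, b⟫ = 1 → ⟪a, b⟫ = 0 → ⟪M b, N a⟫ = ⟪M a, N b⟫) (u w : E d) :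
    ⟪M u, N w⟫ = ⟪M w, N u⟫ := by
  let e := EuclideanSpace.basisFun (Fin d) ℝ
  have hb : ∀ i j, ⟪M (e i), N (e j)⟫ = ⟪M (e j), N (e i)⟫ := fun i j => by
    rcases eq_or_ne i j with rfl | hij
    · rfl
    · exact h (e j) (e i) (by simp [e.norm_eq_one])
        (by simp [e.norm_eq_one]) (e.orthonormal.2 hij.symm)
  rw [← e.sum_repr u, ← e.sum_repr w]
  simp only [map_sum, map_smul, sum_inner, inner_sum, real_inner_smul_left, real_inner_smul_right]
  rw [Finset.sum_comm]
  refine Finset.sum_congr rfl fun i _ => Finset.sum_congr rfl fun j _ => ?_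
  rw [hb]
  ring

section Critical

variable {D : Set (E d → ℝ)} {F : (E d → ℝ) → ℝ} {δF : (E d → ℝ) → E d → ℝ} {lam : E d → ℝ}
  {t₀ : ℝ} {ρ₀ ρ₁ : E d → ℝ} {T : ℝ → E d → E d}

/-- Circulations of the initial velocity of a critical path vanish. -/
theorem IsCritical.metric_fderiv_eq_zero (hT : IsCritical D F lam t₀ ρ₀ ρ₁ T)
    (hF : IsEnergy D F δF) (ht₀ : 0 < t₀) (hlam : ContDiff ℝ ∞ lam) (hpos : ∀ z, 0 < lam z)
    (hint : Integrable lam) {η : ℝ → E d → E d}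
    (hη : ContDiff ℝ ∞ fun q : ℝ × E d => η q.1 q.2) (hd : ∀ s, IsDiffeo (η s))
    (h0 : ∀ z, η 0 z = z) {K : Set (E d)} (hK : IsCompact K) (hoff : ∀ s, ∀ z ∉ K, η s z = z)
    (hpush : ∀ s, push (η s) lam = lam) {ξ : E d → E d}
    (hξ : ∀ z, HasDerivAt (fun s => η s z) (ξ z) 0) :
    metric lam (vel T 0) (fun z => fderiv ℝ (T 0) z (ξ z)) = 0 := by
  have hP := hT.1
  -- The relabelling acts fully at time zero and not at all at time `t₀`, so only the initial
  -- boundary term survives. It leaves all densities unchanged, which makes the variation admissible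
  -- although `T 0` moves.
  let χ : ℝ → ℝ := fun t => 1 - t / t₀
  let Y : ℝ → ℝ → E d → E d := fun ε t z => T t (η (ε * χ t) z)
  have hV : IsDiffeoVariation t₀ univ K T Y :=
    { smooth := by
        have hχ : ContDiff ℝ ∞ fun p : ℝ × ℝ × E d => p.1 * χ p.2.1 :=
          contDiff_fst.mul (contDiff_const.sub ((contDiff_fst.comp contDiff_snd).div_const t₀))
        exact hP.smooth.comp (f := fun p : ℝ × ℝ × E d => (p.2.1, η (p.1 * χ p.2.1) p.2.2))
          ((contDiff_fst.comp contDiff_snd).prodMk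
            (hη.comp (hχ.prodMk (contDiff_snd.comp contDiff_snd))))
      base := fun t => by funext z; simp [Y, h0]
      off := fun ε t z hz => by simp only [Y, hoff _ z hz]
      isCompact := hK
      isOpen := isOpen_univ
      ordConnected := ordConnected_univ
      zero_mem := mem_univ _
      diffeo := fun ε _ t ht => (hP.inO t ht).1.comp (hd _) }
  have hpY : ∀ ε, ∀ t ∈ Icc 0 t₀, push (Y ε t) lam = push (T t) lam := fun ε t ht => by
    rw [push_comp (hP.inO t ht).1 (hd _), hpush]
  have hl : (0 : ℝ) ∈ Icc 0 t₀ := ⟨le_rfl, ht₀.le⟩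
  have hr : t₀ ∈ Icc 0 t₀ := ⟨ht₀.le, le_rfl⟩
  have key := hV.eq_of_isCritical hF ht₀ hlam hpos hint hT
    (fun ε _ => (hpY ε 0 hl).trans hP.left) (fun ε _ => (hpY ε t₀ hr).trans hP.right)
  -- The energy rate is zero because the densities are constant in `ε`, and by the second order
  -- equation the acceleration pairs with the variation to minus the same rate.
  have hrhs : ∫ t in (0 : ℝ)..t₀, (metric lam (vel (vel T) t) (variationField Y t) +
      energyRate δF lam Y 0 t) = 0 := by
    refine (intervalIntegral.integral_congr fun t ht => ?_).trans
      intervalIntegral.integral_zero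
    rw [uIcc_of_le ht₀.le] at ht
    have h1 : energyRate δF lam Y 0 t = 0 := by
      simp [energyRate, hpY _ t ht]
    have h2 := hV.energyRate_zero hF hlam ht (hP.finite t ht)
    have h3 : metric lam (vel (vel T) t) (variationField Y t) =
        -∫ z, ⟪∇ (δF (push (T t) lam)) (T t z), variationField Y t z⟫ * lam z := by
      rw [metric, ← integral_neg]
      refine integral_congr_ae (Eventually.of_forall fun z => ?_)
      simp only
      rw [hT.solvesSecondOrder hF ht₀ hlam hpos hint t ht z, inner_neg_left, neg_mul]
    rw [h3, ← h2, h1, neg_zero, add_zero]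
  have hf0 : variationField Y 0 = fun z => fderiv ℝ (T 0) z (ξ z) := by
    funext z
    have h1 : HasFDerivAt (T 0) (fderiv ℝ (T 0) z) (η 0 z) := by
      rw [h0]
      exact ((hP.inO 0 hl).1.1.contDiffAt.differentiableAt (by simp)).hasFDerivAt
    have h2 := h1.comp_hasDerivAt 0 (hξ z)
    have h3 : (fun ε => Y ε 0 z) = T 0 ∘ fun s => η s z := by
      funext ε; simp [Y, χ]
    rw [variationField, h3, h2.deriv]
  have hf1 : variationField Y t₀ = fun _ => 0 := by
    funext z
    simp [variationField, Y, χ, ht₀.ne', h0]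
  rw [hrhs, hf0, hf1, sub_eq_zero] at key
  rw [← key]
  simp [metric]

/-- The differential of the pulled back initial velocity is symmetric. -/
theorem IsCritical.inner_fderiv_vel_symm (hT : IsCritical D F lam t₀ ρ₀ ρ₁ T)
    (hF : IsEnergy D F δF) (ht₀ : 0 < t₀) (hlam : ContDiff ℝ ∞ lam) (hpos : ∀ z, 0 < lam z)
    (hint : Integrable lam) (z₀ u w : E d) :
    ⟪fderiv ℝ (vel T 0) z₀ u, fderiv ℝ (T 0) z₀ w⟫ =
      ⟪fderiv ℝ (vel T 0) z₀ w, fderiv ℝ (T 0) z₀ u⟫ := by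
  -- Straightening needs a unit vector, which dimension zero does not have.
  rcases subsingleton_or_nontrivial (E d) with hs | hn
  · rw [Subsingleton.elim u w]
  obtain ⟨e, he'⟩ := exists_norm_eq (E d) zero_le_one
  have he : ⟪e, e⟫ = 1 := by rw [real_inner_self_eq_norm_sq, he', one_pow]
  have hP := hT.1
  have hT0 : ContDiff ℝ ∞ (T 0) := (hP.inO 0 ⟨le_rfl, ht₀.le⟩).1.1
  have hV0 : ContDiff ℝ ∞ (vel T 0) :=
    ContDiff.comp (g := fun q : ℝ × E d => vel T q.1 q.2) (f := fun z => ((0 : ℝ), z))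
      (contDiff_vel hP.smooth) (contDiff_const.prodMk contDiff_id)
  obtain ⟨m, hm, ⟨κ, hκ, hb⟩, hmlam⟩ := exists_le_eqOn_ball hlam hpos z₀
  set Ψ := straighten m e with hΨdef
  have hΨ : IsDiffeo Ψ := isDiffeo_straighten he hm hκ hb
  have hΨm : push Ψ m = fun _ => 1 := push_straighten he hm hκ hb
  set S := Function.invFun Ψ with hS
  have hSs : ContDiff ℝ ∞ S := hΨ.contDiff_invFun
  set c := Ψ z₀ with hc
  have hSc : S c = z₀ := hΨ.invFun_apply z₀
  -- Twists of radius below `δ₀` correspond to relabellings supported where `m` agrees with `λ`.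
  obtain ⟨δ₀, hδ₀, hball⟩ : ∃ δ₀ > 0, ∀ y ∈ Metric.ball c δ₀, S y ∈ Metric.closedBall z₀ 1 := by
    refine Metric.eventually_nhds_iff_ball.1 (hSs.continuous.continuousAt.eventually_mem ?_)
    rw [hSc]
    exact Metric.closedBall_mem_nhds z₀ one_pos
  set G : E d → E d := fun y => T 0 (S y) with hG
  set U : E d → E d := fun y => vel T 0 (S y) with hU
  have hGs : ContDiff ℝ ∞ G := hT0.comp hSs
  have hUs : ContDiff ℝ ∞ U := hV0.comp hSs
  have hDG : ∀ y, HasFDerivAt G ((fderiv ℝ (T 0) (S y)).comp (fderiv ℝ S y)) y := fun y =>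
    ((hT0.contDiffAt.differentiableAt (by simp)).hasFDerivAt).comp y
      (hSs.contDiffAt.differentiableAt (by simp)).hasFDerivAt
  have hDU : ∀ y, HasFDerivAt U ((fderiv ℝ (vel T 0) (S y)).comp (fderiv ℝ S y)) y := fun y =>
    ((hV0.contDiffAt.differentiableAt (by simp)).hasFDerivAt).comp y
      (hSs.contDiffAt.differentiableAt (by simp)).hasFDerivAt
  -- The initial velocity pulled back by `G = T 0 ∘ S`, as a field in the straightened coordinates;
  -- `metric_fderiv_eq_zero` says that it is orthogonal to the twist fields.
  set α : E d → E d := fun y => ContinuousLinearMap.adjoint (fderiv ℝ G y) (U y) with hα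
  have hG' : ContDiff ℝ ∞ (fderiv ℝ G) := hGs.fderiv_right (by simp)
  have hαs : ContDiff ℝ ∞ α :=
    ((ContinuousLinearMap.adjoint (𝕜 := ℝ) (E := E d) (F := E d)).toContinuousLinearEquiv.contDiff.comp
      hG').clm_apply hUs
  have hsymm : ∀ a b : E d, ⟪a, a⟫ = 1 → ⟪b, b⟫ = 1 → ⟪a, b⟫ = 0 →
      ⟪fderiv ℝ U c b, fderiv ℝ G c a⟫ = ⟪fderiv ℝ U c a, fderiv ℝ G c b⟫ := by
    intro a b ha hbb hab
    have hcurl := inner_fderiv_eq_of_integral_eq_zero hαs a b c hδ₀ fun δ hδ hδδ => by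
      set β : ℝ → ℝ := deriv (radialBump δ hδ) with hβ
      have hβs : ContDiff ℝ ∞ β :=
        (contDiff_infty_iff_deriv.1 (radialBump δ hδ).contDiff).2
      set K : Set (E d) := S '' Metric.closedBall c δ with hKdef
      have hK : IsCompact K := (isCompact_closedBall c δ).image hSs.continuous
      have hβ0 : ∀ z ∉ K, β (‖Ψ z - c‖ ^ 2) = 0 := fun z hz =>
        deriv_radialBump hδ fun hm => hz ⟨Ψ z, hm, hΨ.invFun_apply z⟩
      have hKm : EqOn m lam K := by
        rintro _ ⟨y, hy, rfl⟩
        exact hmlam (hball y (Metric.closedBall_subset_ball hδδ hy))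
      set η : ℝ → E d → E d := fun s z => S (twist a b c β s (Ψ z)) with hη
      have hRd := isDiffeo_twist ha hbb hab c hβs
      have hηd : ∀ s, IsDiffeo (η s) := fun s => hΨ.invFun.comp ((hRd s).comp hΨ)
      have hηoff : ∀ s, ∀ z ∉ K, η s z = z := fun s z hz => by
        simp only [hη, twist_of_eq_zero a b c (s := s) (by rw [hβ0 z hz, mul_zero] :
          s * β (‖Ψ z - c‖ ^ 2) = 0)]
        exact hΨ.invFun_apply z
      have hηs : ContDiff ℝ ∞ fun q : ℝ × E d => η q.1 q.2 :=
        hSs.comp (ContDiff.comp (g := fun q : ℝ × E d => twist a b c β q.1 q.2)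
          (f := fun q : ℝ × E d => (q.1, Ψ q.2)) (contDiff_twist a b c hβs)
          (contDiff_fst.prodMk (hΨ.1.comp contDiff_snd)))
      have hη0 : ∀ z, η 0 z = z := fun z => by
        simp only [hη, twist_of_eq_zero a b c (s := 0) (zero_mul _)]
        exact hΨ.invFun_apply z
      have hηξ : ∀ z, HasDerivAt (fun s => η s z)
          (fderiv ℝ S (Ψ z) (β (‖Ψ z - c‖ ^ 2) • planeSkew a b (Ψ z - c))) 0 := fun z => by
        have h1 : HasFDerivAt S (fderiv ℝ S (Ψ z)) (twist a b c β 0 (Ψ z)) := by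
          rw [twist_of_eq_zero a b c (s := 0) (zero_mul _)]
          exact (hSs.contDiffAt.differentiableAt (by simp)).hasFDerivAt
        exact h1.comp_hasDerivAt 0 (hasDerivAt_twist a b c β (Ψ z))
      have h1 := hT.metric_fderiv_eq_zero hF ht₀ hlam hpos hint hηs hηd hη0 hK hηoff
        (fun s => push_eq_self_of_eqOn (hηd s) hK (hηoff s)
          (push_conj hΨ (hRd s) hΨm (push_twist_one ha hbb hab c hβs s)) hKm) hηξ
      -- Straightening sends `m` to Lebesgue measure, so the circulation of `α` in the new
      -- coordinates is an integral against `m`, and `m = λ` on the support.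
      have h2 := hΨ.integral_mul_push m
        fun y => ⟪α y, β (‖y - c‖ ^ 2) • planeSkew a b (y - c)⟫
      simp only [hΨm, mul_one] at h2
      rw [h2, ← h1, metric]
      refine integral_congr_ae (Eventually.of_forall fun z => ?_)
      simp only
      have hz : S (Ψ z) = z := hΨ.invFun_apply z
      by_cases hzK : z ∈ K
      · rw [hKm hzK, hα]
        simp only [ContinuousLinearMap.adjoint_inner_left, (hDG (Ψ z)).fderiv, hz, hU,
          ContinuousLinearMap.comp_apply]
      · simp [hβ0 z hzK]
    have hin : ∀ v w : E d, ⟪w, fderiv ℝ α c v⟫ = ⟪fderiv ℝ U c v, fderiv ℝ G c w⟫ +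
        ⟪U c, fderiv ℝ (fderiv ℝ G) c v w⟫ := fun v w => by
      have h1 : HasFDerivAt (fun y => ⟪w, α y⟫) ((innerSL ℝ w).comp (fderiv ℝ α c)) c :=
        (innerSL ℝ w).hasFDerivAt.comp c (hαs.contDiffAt.differentiableAt (by simp)).hasFDerivAt
      have h2 : (fun y => ⟪w, α y⟫) = fun y => ⟪U y, fderiv ℝ G y w⟫ := by
        funext y
        rw [hα, real_inner_comm, ContinuousLinearMap.adjoint_inner_left]
      have h3 := (hUs.contDiffAt.differentiableAt (x := c) (by simp)).hasFDerivAt.inner ℝ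
        ((hG'.contDiffAt.differentiableAt (x := c) (by simp)).hasFDerivAt.clm_apply
          (hasFDerivAt_const w c))
      rw [h2] at h1
      have h4 := congrArg (fun L => L v) (h1.unique h3)
      simpa [add_comm] using h4
    -- The curl of `α` contains a second derivative of `G`, which cancels by symmetry and leaves
    -- only first derivatives of velocity and map.
    have hsecond : fderiv ℝ (fderiv ℝ G) c b a = fderiv ℝ (fderiv ℝ G) c a b :=
      (hGs.contDiffAt.isSymmSndFDerivAt (by simp [two_le_infty])) b a
    rw [hin, hin, hsecond] at hcurl
    exact add_right_cancel hcurl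
  have h1 := bilin_symm_of_basis hsymm (fderiv ℝ Ψ z₀ u) (fderiv ℝ Ψ z₀ w)
  have h2 : ∀ v, fderiv ℝ S c (fderiv ℝ Ψ z₀ v) = v := fun v =>
    congrArg (fun A => A v) (hΨ.invFun_comp_fderiv z₀)
  rw [(hDG c).fderiv, (hDU c).fderiv, hSc] at h1
  simpa only [ContinuousLinearMap.comp_apply, h2] using h1

end Critical

/-! ### The Eulerian velocity -/

theorem hasDerivAt_fderiv_apply {T : ℝ → E d → E d}
    (hT : ContDiff ℝ ∞ fun q : ℝ × E d => T q.1 q.2) (t : ℝ) (z u : E d) :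
    HasDerivAt (fun s => fderiv ℝ (T s) z u) (fderiv ℝ (vel T t) z u) t := by
  have hs : ∀ s, ContDiff ℝ ∞ (T s) := fun s =>
    ContDiff.comp (g := fun q : ℝ × E d => T q.1 q.2) (f := fun z => (s, z)) hT
      (contDiff_const.prodMk contDiff_id)
  have hv : ∀ s, ContDiff ℝ ∞ (vel T s) := fun s =>
    ContDiff.comp (g := fun q : ℝ × E d => vel T q.1 q.2) (f := fun z => (s, z)) (contDiff_vel hT)
      (contDiff_const.prodMk contDiff_id)
  have hline : HasDerivAt (fun r : ℝ => z + r • u) u 0 := by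
    simpa using ((hasDerivAt_id (0 : ℝ)).smul_const u).const_add z
  have hd : ∀ f : E d → E d, ContDiff ℝ ∞ f →
      deriv (fun r : ℝ => f (z + r • u)) 0 = fderiv ℝ f z u := fun f hf => by
    have h1 : HasFDerivAt f (fderiv ℝ f z) (z + (0 : ℝ) • u) := by
      rw [zero_smul, add_zero]
      exact (hf.contDiffAt.differentiableAt (by simp)).hasFDerivAt
    exact (h1.comp_hasDerivAt 0 hline).deriv
  have hc := deriv_deriv_comm (f := fun p : ℝ × ℝ => T p.1 (z + p.2 • u))
    (hT.comp (contDiff_fst.prodMk (contDiff_const.add (contDiff_snd.smul contDiff_const)))) t 0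
  simp only [hd _ (hs _)] at hc
  have h2 : deriv (fun s => fderiv ℝ (T s) z u) t = fderiv ℝ (vel T t) z u := by
    rw [hc, ← hd _ (hv t)]
    rfl
  have h3 : ContDiff ℝ ∞ fun s => fderiv ℝ (T s) z u :=
    ((contDiff_fderiv_snd hT).comp (contDiff_id.prodMk contDiff_const)).clm_apply contDiff_const
  rw [← h2]
  exact (h3.contDiffAt.differentiableAt (by simp)).hasDerivAt

theorem hasFDerivAt_of_gradient {f : E d → ℝ} (hf : Differentiable ℝ f) (x : E d) :
    HasFDerivAt f (innerSL ℝ (∇ f x)) x :=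
  (hf x).hasGradientAt.hasFDerivAt

/-- Symmetry of the Hessian, stated for functions whose smoothness is known only through the
gradient. -/
theorem inner_fderiv_gradient_symm {f : E d → ℝ} (hf : Differentiable ℝ f)
    (hg : ContDiff ℝ ∞ (∇ f)) (x u w : E d) :
    ⟪fderiv ℝ (∇ f) x u, w⟫ = ⟪fderiv ℝ (∇ f) x w, u⟫ := by
  have h1 : HasFDerivAt (fun y => innerSL ℝ (∇ f y)) ((innerSL ℝ).comp (fderiv ℝ (∇ f) x)) x :=
    (innerSL ℝ (E := E d)).hasFDerivAt.comp x
      (hg.contDiffAt.differentiableAt (by simp)).hasFDerivAt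
  exact second_derivative_symmetric (fun y => hasFDerivAt_of_gradient hf y) h1 u w

/-- The Eulerian velocity of a family of diffeomorphisms. -/
def eulerVel (T : ℝ → E d → E d) (t : ℝ) (x : E d) : E d := vel T t (Function.invFun (T t) x)

/-- The Eulerian acceleration `∂ₜ v`. -/
def eulerVelDeriv (T : ℝ → E d → E d) (t : ℝ) (x : E d) : E d :=
  vel (vel T) t (Function.invFun (T t) x) - fderiv ℝ (eulerVel T t) x (eulerVel T t x)

/-! ### Regularity and evolution of the Eulerian velocity -/

section Flow

variable {T : ℝ → E d → E d} {t₀ : ℝ} (ht₀ : 0 < t₀)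
  (hT : ContDiff ℝ ∞ fun q : ℝ × E d => T q.1 q.2) (hd : ∀ t ∈ Icc 0 t₀, IsDiffeo (T t))

include hT in
theorem contDiff_vel_time (t : ℝ) : ContDiff ℝ ∞ (vel T t) :=
  ContDiff.comp (g := fun q : ℝ × E d => vel T q.1 q.2) (f := fun z => (t, z)) (contDiff_vel hT)
    (contDiff_const.prodMk contDiff_id)

include hT hd

theorem contDiffOn_eulerVel :
    ContDiffOn ℝ ∞ (fun q : ℝ × E d => eulerVel T q.1 q.2) (Icc 0 t₀ ×ˢ univ) :=
  (contDiff_vel hT).comp_contDiffOn (contDiffOn_fst.prodMk (contDiffOn_invFun hT hd))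

theorem contDiff_eulerVel {t : ℝ} (ht : t ∈ Icc 0 t₀) : ContDiff ℝ ∞ (eulerVel T t) :=
  (contDiff_vel_time hT t).comp (hd t ht).contDiff_invFun

omit hT in
theorem eulerVel_apply {t : ℝ} (ht : t ∈ Icc 0 t₀) (z : E d) :
    eulerVel T t (T t z) = vel T t z := by
  rw [eulerVel, (hd t ht).invFun_apply]

theorem fderiv_eulerVel_apply {t : ℝ} (ht : t ∈ Icc 0 t₀) (z u : E d) :
    fderiv ℝ (eulerVel T t) (T t z) (fderiv ℝ (T t) z u) = fderiv ℝ (vel T t) z u := by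
  have h1 := ((contDiff_eulerVel hT hd ht).contDiffAt.differentiableAt (x := T t z)
    (by simp)).hasFDerivAt.comp z
      ((hd t ht).1.contDiffAt.differentiableAt (by simp)).hasFDerivAt
  have h2 : eulerVel T t ∘ T t = vel T t := funext fun z => eulerVel_apply hd ht z
  rw [h2] at h1
  rw [h1.fderiv]
  rfl

include ht₀ in
-- Differentiating `v(s, T_s z) = Ṫ_s z` within the interval gives `∂ₜ v + Dv v = T̈ ∘ T⁻¹`, from
-- which the time derivative is read off.
theorem hasDerivWithinAt_eulerVel {t : ℝ} (ht : t ∈ Icc 0 t₀) (x : E d) :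
    HasDerivWithinAt (fun s => eulerVel T s x) (eulerVelDeriv T t x) (Icc 0 t₀) t := by
  set z := Function.invFun (T t) x with hz
  have hx : T t z = x := (hd t ht).apply_invFun x
  have hv := contDiffOn_eulerVel hT hd
  have hq : (t, x) ∈ Icc 0 t₀ ×ˢ (univ : Set (E d)) := ⟨ht, mem_univ _⟩
  set L := fderivWithin ℝ (fun q : ℝ × E d => eulerVel T q.1 q.2) (Icc 0 t₀ ×ˢ univ) (t, x) with hL
  have h1 : HasFDerivWithinAt (fun q : ℝ × E d => eulerVel T q.1 q.2) L (Icc 0 t₀ ×ˢ univ)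
      (t, T t z) := by
    rw [hx]
    exact ((hv _ hq).differentiableWithinAt (by simp)).hasFDerivWithinAt
  have h2 : HasDerivWithinAt (fun s => (s, T s z)) ((1 : ℝ), vel T t z) (Icc 0 t₀) t :=
    (hasDerivWithinAt_id _ _).prodMk (hasDerivAt_vel hT t z).hasDerivWithinAt
  have h3 := h1.comp_hasDerivWithinAt t h2 fun s hs => mk_mem_prod hs (mem_univ _)
  have h4 : HasDerivWithinAt (fun s => vel T s z) (L (1, vel T t z)) (Icc 0 t₀) t :=
    h3.congr (fun s hs => (eulerVel_apply hd hs z).symm) (eulerVel_apply hd ht z).symm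
  have h5 := (uniqueDiffOn_Icc ht₀ t ht).eq_deriv _ h4
    (hasDerivAt_vel (contDiff_vel hT) t z).hasDerivWithinAt
  have h6 : fderiv ℝ (eulerVel T t) x = L.comp (ContinuousLinearMap.inr ℝ ℝ (E d)) :=
    (hasFDerivAt_snd_of_prod_univ hv hq).fderiv
  have h7 : L (1, 0) = eulerVelDeriv T t x := by
    have e1 : ((1 : ℝ), (0 : E d)) = (1, vel T t z) - (0, vel T t z) := by simp
    rw [eulerVelDeriv, ← hz, ← h5, h6, e1, map_sub]
    rfl
  rw [← h7]
  exact hasDerivWithinAt_fst_of_prod_univ hv hq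

include ht₀ in
theorem continuousOn_eulerVelDeriv :
    ContinuousOn (fun q : ℝ × E d => eulerVelDeriv T q.1 q.2) (Icc 0 t₀ ×ˢ univ) := by
  have h1 := contDiffOn_eulerVel hT hd
  have h2 := (contDiffOn_fderiv_snd (uniqueDiffOn_Icc ht₀) h1).continuousOn
  have h3 : ContinuousOn (fun q : ℝ × E d => vel (vel T) q.1 (Function.invFun (T q.1) q.2))
      (Icc 0 t₀ ×ˢ univ) :=
    ((contDiff_vel (contDiff_vel hT)).comp_contDiffOn
      (contDiffOn_fst.prodMk (contDiffOn_invFun hT hd))).continuousOn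
  exact h3.sub (h2.clm_apply h1.continuousOn)

omit hd in
/-- The symmetry of the pulled back velocity gradient is propagated if the acceleration is a
gradient field. -/
theorem inner_fderiv_vel_symm_of_gradient {φ : ℝ → E d → ℝ}
    (hφ : ∀ t ∈ Icc 0 t₀, Differentiable ℝ (φ t)) (hg : ∀ t ∈ Icc 0 t₀, ContDiff ℝ ∞ (∇ (φ t)))
    (hacc : ∀ t ∈ Icc 0 t₀, ∀ z, vel (vel T) t z = -∇ (φ t) (T t z))
    (h0 : ∀ z u w, ⟪fderiv ℝ (vel T 0) z u, fderiv ℝ (T 0) z w⟫ =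
      ⟪fderiv ℝ (vel T 0) z w, fderiv ℝ (T 0) z u⟫) {t : ℝ} (ht : t ∈ Icc 0 t₀) (z u w : E d) :
    ⟪fderiv ℝ (vel T t) z u, fderiv ℝ (T t) z w⟫ =
      ⟪fderiv ℝ (vel T t) z w, fderiv ℝ (T t) z u⟫ := by
  have hTs : ∀ s, ContDiff ℝ ∞ (T s) := fun s =>
    ContDiff.comp (g := fun q : ℝ × E d => T q.1 q.2) (f := fun z => (s, z)) hT
      (contDiff_const.prodMk contDiff_id)
  let S : ℝ → ℝ := fun t => ⟪fderiv ℝ (vel T t) z u, fderiv ℝ (T t) z w⟫ -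
      ⟪fderiv ℝ (vel T t) z w, fderiv ℝ (T t) z u⟫
  have hA : ∀ t ∈ Icc 0 t₀, ∀ u, fderiv ℝ (vel (vel T) t) z u =
      -fderiv ℝ (∇ (φ t)) (T t z) (fderiv ℝ (T t) z u) := fun t ht u => by
    have h1 := (((hg t ht).contDiffAt.differentiableAt (x := T t z) (by simp)).hasFDerivAt.comp z
      ((hTs t).contDiffAt.differentiableAt (by simp)).hasFDerivAt).neg
    have h2 : vel (vel T) t = -(∇ (φ t) ∘ T t) := funext fun z => hacc t ht z
    rw [h2, h1.fderiv]
    rfl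
  -- The terms with two velocity gradients cancel, and the acceleration terms cancel because the
  -- Hessian of `φ` is symmetric.
  have hS : ∀ t ∈ Icc 0 t₀, HasDerivAt S 0 t := fun t ht => by
    have h1 := ((hasDerivAt_fderiv_apply (contDiff_vel hT) t z u).inner ℝ
      (hasDerivAt_fderiv_apply hT t z w)).sub
      ((hasDerivAt_fderiv_apply (contDiff_vel hT) t z w).inner ℝ
      (hasDerivAt_fderiv_apply hT t z u))
    refine h1.congr_deriv ?_
    rw [hA t ht, hA t ht, inner_neg_left, inner_neg_left,
      inner_fderiv_gradient_symm (hφ t ht) (hg t ht),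
      real_inner_comm (fderiv ℝ (vel T t) z w) (fderiv ℝ (vel T t) z u)]
    ring
  have hc := constant_of_derivWithin_zero (f := S) (a := 0) (b := t₀)
    (fun t ht => (hS t ht).differentiableAt.differentiableWithinAt)
    (fun s hs => by
      have hs' := Ico_subset_Icc_self hs
      exact (hS s hs').hasDerivWithinAt.derivWithin
        (uniqueDiffOn_Icc (hs.1.trans_lt hs.2) s hs')) t ht
  have h0' : S 0 = 0 := sub_eq_zero.2 (h0 z u w)
  rw [h0'] at hc
  exact sub_eq_zero.1 hc

/-- Substitute `DT⁻¹ u` and `DT⁻¹ w` and use `Dv DT = DṪ`. -/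
theorem inner_fderiv_eulerVel_symm {t : ℝ} (ht : t ∈ Icc 0 t₀)
    (h : ∀ z u w, ⟪fderiv ℝ (vel T t) z u, fderiv ℝ (T t) z w⟫ =
      ⟪fderiv ℝ (vel T t) z w, fderiv ℝ (T t) z u⟫) (x u w : E d) :
    ⟪fderiv ℝ (eulerVel T t) x u, w⟫ = ⟪fderiv ℝ (eulerVel T t) x w, u⟫ := by
  have hi := (hd t ht).fderiv_comp_invFun x
  have h1 : ∀ u, fderiv ℝ (T t) (Function.invFun (T t) x) (fderiv ℝ (Function.invFun (T t)) x u) =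
      u := fun u => congrArg (fun A => A u) hi
  have h2 := h (Function.invFun (T t) x) (fderiv ℝ (Function.invFun (T t)) x u)
    (fderiv ℝ (Function.invFun (T t)) x w)
  rw [← fderiv_eulerVel_apply hT hd ht, ← fderiv_eulerVel_apply hT hd ht, h1, h1,
    (hd t ht).apply_invFun] at h2
  exact h2

end Flow

/-- A time-dependent potential from an initial potential and the Bernoulli function `g`. -/
theorem hasFDerivAt_sub_integral {t₀ : ℝ} {v dv : ℝ → E d → E d} {g : ℝ → E d → ℝ}
    {f : E d → ℝ}
    (hv : ∀ x, ∀ t ∈ Icc 0 t₀, HasDerivWithinAt (fun s => v s x) (dv t x) (Icc 0 t₀) t)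
    (hdv : ContinuousOn (fun q : ℝ × E d => dv q.1 q.2) (Icc 0 t₀ ×ˢ univ))
    (hg : ContinuousOn (fun q : ℝ × E d => g q.1 q.2) (Icc 0 t₀ ×ˢ univ))
    (hgd : ∀ t ∈ Icc 0 t₀, ∀ x, HasFDerivAt (g t) (-innerSL ℝ (dv t x)) x)
    (hf : ∀ x, HasFDerivAt f (innerSL ℝ (v 0 x)) x) {t : ℝ} (ht : t ∈ Icc 0 t₀) (x : E d) :
    HasFDerivAt (fun x => f x - ∫ τ in (0 : ℝ)..t, g τ x) (innerSL ℝ (v t x)) x := by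
  have hsub : Icc 0 t ⊆ Icc 0 t₀ := Icc_subset_Icc_right ht.2
  have hgx : ∀ x, ContinuousOn (fun τ => g τ x) (Icc 0 t) := fun x =>
    hg.comp (f := fun τ => (τ, x)) (by fun_prop) fun τ hτ => ⟨hsub hτ, mem_univ _⟩
  have hdx : ∀ x, ContinuousOn (fun τ => dv τ x) (Icc 0 t) := fun x =>
    hdv.comp (f := fun τ => (τ, x)) (by fun_prop) fun τ hτ => ⟨hsub hτ, mem_univ _⟩
  have hI : ∀ {W : Type} [NormedAddCommGroup W] {h : ℝ → W}, ContinuousOn h (Icc 0 t) →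
      IntervalIntegrable h volume 0 t := fun {W} _ h hh =>
    ContinuousOn.intervalIntegrable (by rwa [uIcc_of_le ht.1])
  have hmem : ∀ {τ}, τ ∈ uIoc 0 t → τ ∈ Icc 0 t := fun {τ} hτ => by
    rw [uIoc_of_le ht.1] at hτ
    exact Ioc_subset_Icc_self hτ
  have hL : ContinuousOn (fun τ => -innerSL ℝ (dv τ x)) (Icc 0 t) :=
    ((innerSL ℝ (E := E d)).continuous.comp_continuousOn (hdx x)).neg
  obtain ⟨C, hC⟩ := (isCompact_Icc.prod (isCompact_closedBall x 1)).exists_bound_of_continuousOn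
    (hdv.mono (prod_mono hsub (subset_univ _)))
  have h1 : HasFDerivAt (fun x => ∫ τ in (0 : ℝ)..t, g τ x)
      (∫ τ in (0 : ℝ)..t, -innerSL ℝ (dv τ x)) x := by
    refine intervalIntegral.hasFDerivAt_integral_of_dominated_of_fderiv_le (bound := fun _ => C)
      (F := fun x τ => g τ x) (F' := fun x τ => -innerSL ℝ (dv τ x))
      (Metric.closedBall_mem_nhds x one_pos) (Eventually.of_forall fun y => ?_) (hI (hgx x)) ?_
      (Eventually.of_forall fun τ hτ y hy => ?_) intervalIntegrable_const
      (Eventually.of_forall fun τ hτ y _ => hgd τ (hsub (hmem hτ)) y)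
    · rw [uIoc_of_le ht.1]
      exact (hI (hgx y)).1.aestronglyMeasurable
    · rw [uIoc_of_le ht.1]
      exact (hI hL).1.aestronglyMeasurable
    · rw [norm_neg, innerSL_apply_norm]
      exact hC (τ, y) ⟨hmem hτ, hy⟩
  -- The gradient of `g` is `-∂ₜ v`, so subtracting its time integral turns a gradient of `v 0` into
  -- one of `v t`.
  have h2 : ∫ τ in (0 : ℝ)..t, dv τ x = v t x - v 0 x := by
    refine intervalIntegral.integral_eq_sub_of_hasDeriv_right_of_le ht.1
      (fun s hs => (hv x s (hsub hs)).continuousWithinAt.mono hsub) (fun s hs => ?_) (hI (hdx x))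
    refine ((hv x s (hsub (Ioo_subset_Icc_self hs))).hasDerivAt ?_).hasDerivWithinAt
    exact Icc_mem_nhds hs.1 (hs.2.trans_le ht.2)
  have h3 : ∫ τ in (0 : ℝ)..t, -innerSL ℝ (dv τ x) = -innerSL ℝ (v t x - v 0 x) := by
    rw [intervalIntegral.integral_neg, ← h2]
    congr 1
    exact (innerSL ℝ (E := E d)).intervalIntegral_comp_comm (hI (hdx x))
  rw [h3] at h1
  refine ((hf x).sub h1).congr_fderiv ?_
  rw [map_sub]
  abel

theorem hasDerivWithinAt_sub_integral {t₀ : ℝ} {g : ℝ → E d → ℝ} {f : E d → ℝ}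
    (hg : ContinuousOn (fun q : ℝ × E d => g q.1 q.2) (Icc 0 t₀ ×ˢ univ)) {t : ℝ}
    (ht : t ∈ Icc 0 t₀) (x : E d) :
    HasDerivWithinAt (fun t => f x - ∫ τ in (0 : ℝ)..t, g τ x) (-g t x) (Icc 0 t₀) t := by
  have hgx : ContinuousOn (fun τ => g τ x) (Icc 0 t₀) :=
    hg.comp (f := fun τ => (τ, x)) (by fun_prop) fun τ hτ => ⟨hτ, mem_univ _⟩
  have : Fact (t ∈ Icc 0 t₀) := ⟨ht⟩
  have hi : IntervalIntegrable (fun τ => g τ x) volume 0 t := by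
    refine ContinuousOn.intervalIntegrable ?_
    rw [uIcc_of_le ht.1]
    exact hgx.mono (Icc_subset_Icc_right ht.2)
  have h1 := intervalIntegral.integral_hasDerivWithinAt_right (s := Icc 0 t₀) (t := Icc 0 t₀) hi
    (hgx.stronglyMeasurableAtFilter_nhdsWithin measurableSet_Icc t) (hgx t ht)
  exact h1.const_sub (f x)

/-! ### The continuity equation -/

section Continuity

variable {T : ℝ → E d → E d} {t₀ : ℝ} (ht₀ : 0 < t₀)
  (hT : ContDiff ℝ ∞ fun q : ℝ × E d => T q.1 q.2) (hd : ∀ t ∈ Icc 0 t₀, IsDiffeo (T t))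
  {lam : E d → ℝ} (hlam : ContDiff ℝ ∞ lam)

include hT hd

/-- The functions `f ∘ T_s` are all supported in the compact set swept by the preimages of the
support of `f`. -/
theorem hasDerivAt_integral_comp_flow (hlam : Continuous lam) {t : ℝ} (ht : t ∈ Ioo 0 t₀)
    {f : E d → ℝ} (hf : ContDiff ℝ ∞ f) (hs : HasCompactSupport f) :
    HasDerivAt (fun s => ∫ z, f (T s z) * lam z)
      (∫ z, fderiv ℝ f (T t z) (vel T t z) * lam z) t := by
  have hTs : ∀ s, Continuous (T s) := fun s =>
    hT.continuous.comp (by fun_prop : Continuous fun z : E d => (s, z))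
  have hfc := hf.continuous
  have hf'c : Continuous (fderiv ℝ f) := hf.continuous_fderiv (by simp)
  set K : Set (E d) := (fun q : ℝ × E d => Function.invFun (T q.1) q.2) '' (Icc 0 t₀ ×ˢ tsupport f)
    with hKdef
  have hK : IsCompact K := (isCompact_Icc.prod hs).image_of_continuousOn
    ((contDiffOn_invFun hT hd).continuousOn.mono (prod_mono subset_rfl (subset_univ _)))
  have hoff : ∀ s ∈ Ioo 0 t₀, ∀ z ∉ K, T s z ∉ tsupport f := fun s hs z hz hm =>
    hz ⟨(s, T s z), ⟨Ioo_subset_Icc_self hs, hm⟩, (hd s (Ioo_subset_Icc_self hs)).invFun_apply z⟩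
  have hc : ∀ s, Continuous fun z => f (T s z) * lam z := fun s =>
    (hfc.comp (hTs s)).mul hlam
  refine hasDerivAt_integral_of_eq_off_compact hK (isOpen_Ioo.mem_nhds ht)
    (f := fun s z => f (T s z) * lam z) (f' := fun s z => fderiv ℝ f (T s z) (vel T s z) * lam z)
    (fun s _ => (hc s).continuousOn) ?_ (fun s _ z _ => ?_) ?_ (fun s hs z hz => ?_)
    fun z hz => ?_
  · have h1 : Continuous fun q : ℝ × E d => fderiv ℝ f (T q.1 q.2) (vel T q.1 q.2) :=
      (hf'c.comp hT.continuous).clm_apply (contDiff_vel hT).continuous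
    exact (h1.mul (hlam.comp continuous_snd)).continuousOn
  · have h1 := (hf.contDiffAt.differentiableAt (x := T s z) (by simp)).hasFDerivAt.comp_hasDerivAt s
      (hasDerivAt_vel hT s z)
    exact h1.mul_const (lam z)
  · refine (hc t).integrable_of_hasCompactSupport (HasCompactSupport.intro hK fun z hz => ?_)
    rw [image_eq_zero_of_notMem_tsupport (hoff t ht z hz), zero_mul]
  · simp only [image_eq_zero_of_notMem_tsupport (hoff s hs z hz),
      image_eq_zero_of_notMem_tsupport (hoff t ht z hz)]
  · have h1 : fderiv ℝ f (T t z) = 0 := image_eq_zero_of_notMem_tsupport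
      fun h => hoff t ht z hz (tsupport_fderiv_subset ℝ h)
    simp [h1]

theorem integral_fderiv_comp_flow (hlam : ContDiff ℝ ∞ lam) {t : ℝ} (ht : t ∈ Icc 0 t₀)
    {f : E d → ℝ} (hf : ContDiff ℝ ∞ f) (hs : HasCompactSupport f) :
    ∫ z, fderiv ℝ f (T t z) (vel T t z) * lam z =
      -∫ x, f x * divergence (fun y => push (T t) lam y • eulerVel T t y) x := by
  have hw : ContDiff ℝ ∞ fun y => push (T t) lam y • eulerVel T t y :=
    ((hd t ht).contDiff_push hlam).smul (contDiff_eulerVel hT hd ht)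
  rw [← integral_fderiv_apply_eq (hf.of_le (by simp)) (hw.of_le (by simp)) (Or.inl hs)]
  have h1 := (hd t ht).integral_mul_push lam fun x => fderiv ℝ f x (eulerVel T t x)
  simp only [eulerVel_apply hd ht] at h1
  rw [← h1]
  simp only [map_smul, smul_eq_mul, mul_comm]

include ht₀ in
theorem continuousOn_divergence_push_smul (hlam : ContDiff ℝ ∞ lam) :
    ContinuousOn (fun q : ℝ × E d =>
      divergence (fun y => push (T q.1) lam y • eulerVel T q.1 y) q.2) (Icc 0 t₀ ×ˢ univ) := by
  have h1 := (WHF.contDiffOn_push hlam (uniqueDiffOn_Icc ht₀) hT hd).smul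
    (contDiffOn_eulerVel hT hd)
  have h2 := (contDiffOn_fderiv_snd (uniqueDiffOn_Icc ht₀) h1).continuousOn
  simp only [divergence_eq_sum]
  exact continuousOn_finsetSum _ fun i _ =>
    ContinuousOn.inner continuousOn_const (h2.clm_apply continuousOn_const)

include ht₀ in
/-- The continuity equation for the push-forward densities along a flow. -/
theorem hasDerivWithinAt_push (hlam : ContDiff ℝ ∞ lam) {t : ℝ} (ht : t ∈ Icc 0 t₀) (x : E d) :
    HasDerivWithinAt (fun s => push (T s) lam x)
      (-divergence (fun y => push (T t) lam y • eulerVel T t y) x) (Icc 0 t₀) t := by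
  have hU := uniqueDiffOn_Icc ht₀
  have hp := WHF.contDiffOn_push hlam hU hT hd
  set r : ℝ → E d → ℝ := fun t x => derivWithin (fun s => push (T s) lam x) (Icc 0 t₀) t with hr
  have hrd : ∀ t ∈ Icc 0 t₀, ∀ x,
      HasDerivWithinAt (fun s => push (T s) lam x) (r t x) (Icc 0 t₀) t := fun t ht x =>
    (hasDerivWithinAt_fst_of_prod_univ hp (q := (t, x))
      ⟨ht, mem_univ _⟩).differentiableWithinAt.hasDerivWithinAt
  have hrc : ContinuousOn (fun q : ℝ × E d => r q.1 q.2) (Icc 0 t₀ ×ˢ univ) :=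
    (contDiffOn_derivWithin_fst hU hp).continuousOn
  have hDc := continuousOn_divergence_push_smul ht₀ hT hd hlam
  have hslice : ∀ {h : ℝ × E d → ℝ}, ContinuousOn h (Icc 0 t₀ ×ˢ univ) → ∀ t ∈ Icc 0 t₀,
      Continuous fun x => h (t, x) := fun {h} hh t ht =>
    hh.comp_continuous (by fun_prop : Continuous fun x : E d => (t, x))
      fun x => ⟨ht, mem_univ _⟩
  -- At interior times the equation is first obtained weakly, by differentiating `∫ f ρ dx = ∫ f(T)
  -- λ dz`. Both terms are continuous in space, so it holds pointwise.
  have hint : ∀ t ∈ Ioo 0 t₀, ∀ x,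
      r t x + divergence (fun y => push (T t) lam y • eulerVel T t y) x = 0 := by
    intro t ht
    have ht' := Ioo_subset_Icc_self ht
    have hrt : Continuous (r t) := hslice hrc t ht'
    have hDt : Continuous fun x => divergence (fun y => push (T t) lam y • eulerVel T t y) x :=
      hslice hDc t ht'
    refine fun x => eq_zero_of_integral_mul_eq_zero (hrt.add hDt) (fun f hf hs => ?_) x
    have hf0 : ∀ x ∉ tsupport f, f x = 0 := fun x hx => image_eq_zero_of_notMem_tsupport hx
    have hfc := hf.continuous
    have h1 : HasDerivAt (fun s => ∫ x, f x * push (T s) lam x) (∫ x, f x * r t x) t := by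
      have hpc : ∀ s ∈ Icc 0 t₀, Continuous (push (T s) lam) := fun s hs =>
        ((hd s hs).contDiff_push hlam).continuous
      refine hasDerivAt_integral_of_eq_off_compact (K := tsupport f) hs (isOpen_Ioo.mem_nhds ht)
        (f := fun s x => f x * push (T s) lam x) (f' := fun s x => f x * r s x)
        (fun s hs => (hfc.mul (hpc s (Ioo_subset_Icc_self hs))).continuousOn) ?_
        (fun s hs x _ => ?_) ?_ (fun s _ x hx => by simp [hf0 x hx]) fun x hx => by simp [hf0 x hx]
      · exact (hfc.comp continuous_snd).continuousOn.mul
          (hrc.mono (prod_mono Ioo_subset_Icc_self (subset_univ _)))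
      · exact ((hrd s (Ioo_subset_Icc_self hs) x).hasDerivAt (Icc_mem_nhds hs.1 hs.2)).const_mul _
      · exact (hfc.mul (hpc t ht')).integrable_of_hasCompactSupport hs.mul_right
    have h2 := hasDerivAt_integral_comp_flow hT hd hlam.continuous ht hf hs
    have h3 : (fun s => ∫ x, f x * push (T s) lam x) =ᶠ[𝓝 t] fun s => ∫ z, f (T s z) * lam z := by
      filter_upwards [isOpen_Ioo.mem_nhds ht] with s hs
      exact (hd s (Ioo_subset_Icc_self hs)).integral_mul_push lam f
    have h4 := (h1.congr_of_eventuallyEq h3.symm).unique h2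
    rw [integral_fderiv_comp_flow hT hd hlam ht' hf hs] at h4
    simp only [Pi.add_apply, mul_add]
    have i1 : Integrable fun x => f x * r t x :=
      (hfc.mul hrt).integrable_of_hasCompactSupport hs.mul_right
    have i2 : Integrable fun x =>
        f x * divergence (fun y => push (T t) lam y • eulerVel T t y) x :=
      (hfc.mul hDt).integrable_of_hasCompactSupport hs.mul_right
    rw [integral_add i1 i2, h4, neg_add_cancel]
  have hx : ∀ {h : ℝ × E d → ℝ}, ContinuousOn h (Icc 0 t₀ ×ˢ univ) →
      ContinuousOn (fun t => h (t, x)) (Icc 0 t₀) := fun {h} hh =>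
    hh.comp (f := fun t => (t, x)) (by fun_prop) fun t ht => ⟨ht, mem_univ _⟩
  -- The endpoints of the time interval follow by continuity up to the boundary.
  have hall : EqOn (fun t => r t x)
      (fun t => -divergence (fun y => push (T t) lam y • eulerVel T t y) x) (Icc 0 t₀) := by
    refine EqOn.of_subset_closure (s := Ioo 0 t₀) (fun t ht => eq_neg_of_add_eq_zero_left
      (hint t ht x)) (hx hrc) (hx hDc).neg Ioo_subset_Icc_self ?_
    rw [closure_Ioo ht₀.ne]
  exact (hrd t ht x).congr_deriv (hall ht)

end Continuity

/-! ### The potential of a critical path -/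

section Critical

variable {D : Set (E d → ℝ)} {F : (E d → ℝ) → ℝ} {δF : (E d → ℝ) → E d → ℝ} {lam : E d → ℝ}
  {t₀ : ℝ} {ρ₀ ρ₁ : E d → ℝ} {T : ℝ → E d → E d}

/-- Symmetry of the velocity gradient gives a potential at each time only up to a function of time.
Choosing it at time zero and evolving it by the Hamilton–Jacobi equation fixes this freedom and the
regularity in time. -/
theorem IsCritical.exists_potential (hT : IsCritical D F lam t₀ ρ₀ ρ₁ T)
    (hF : IsEnergy D F δF) (ht₀ : 0 < t₀) (hlam : ContDiff ℝ ∞ lam) (hpos : ∀ z, 0 < lam z)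
    (hint : Integrable lam) :
    ∃ Φ : ℝ → E d → ℝ, ∀ t ∈ Icc 0 t₀, ∀ x,
      HasFDerivAt (Φ t) (innerSL ℝ (eulerVel T t x)) x ∧
      HasDerivWithinAt (fun s => Φ s x)
        (-(1 / 2 * ‖eulerVel T t x‖ ^ 2 + δF (push (T t) lam) x)) (Icc 0 t₀) t := by
  have hP := hT.1
  have hd : ∀ t ∈ Icc 0 t₀, IsDiffeo (T t) := fun t ht => (hP.inO t ht).1
  have h2 := hT.solvesSecondOrder hF ht₀ hlam hpos hint
  have hφ : ∀ t ∈ Icc 0 t₀, Differentiable ℝ (δF (push (T t) lam)) := fun t ht =>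
    (hF.contDiff _ (hP.finite t ht)).differentiable (by simp)
  -- The first variation is only `C¹` by assumption, but along a solution its gradient is `-T̈ ∘
  -- T⁻¹`, hence smooth.
  have hgrad : ∀ t ∈ Icc 0 t₀, ∀ x, ∇ (δF (push (T t) lam)) x =
      -vel (vel T) t (Function.invFun (T t) x) := fun t ht x => by
    rw [h2 t ht, (hd t ht).apply_invFun, neg_neg]
  have hg : ∀ t ∈ Icc 0 t₀, ContDiff ℝ ∞ (∇ (δF (push (T t) lam))) := fun t ht => by
    rw [funext (hgrad t ht)]
    exact ((contDiff_vel_time (contDiff_vel hP.smooth) t).comp (hd t ht).contDiff_invFun).neg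
  have hsymm : ∀ t ∈ Icc 0 t₀, ∀ x u w, ⟪fderiv ℝ (eulerVel T t) x u, w⟫ =
      ⟪fderiv ℝ (eulerVel T t) x w, u⟫ := fun t ht =>
    inner_fderiv_eulerVel_symm hP.smooth hd ht (inner_fderiv_vel_symm_of_gradient hP.smooth hφ hg h2
      (hT.inner_fderiv_vel_symm hF ht₀ hlam hpos hint) ht)
  have hvs : ∀ t ∈ Icc 0 t₀, ContDiff ℝ ∞ (eulerVel T t) := fun t ht =>
    contDiff_eulerVel hP.smooth hd ht
  have hvd : ∀ t ∈ Icc 0 t₀, ∀ x, HasFDerivAt (eulerVel T t) (fderiv ℝ (eulerVel T t) x) x :=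
    fun t ht x => ((hvs t ht).contDiffAt.differentiableAt (by simp)).hasFDerivAt
  have h0 : (0 : ℝ) ∈ Icc 0 t₀ := ⟨le_rfl, ht₀.le⟩
  have hω : DifferentiableOn ℝ (fun x => innerSL ℝ (eulerVel T 0 x)) univ :=
    (((innerSL ℝ (E := E d)).contDiff.comp (hvs 0 h0)).differentiable (by simp)).differentiableOn
  -- Poincaré lemma at time zero.
  obtain ⟨f, hf⟩ := convex_univ.exists_forall_hasFDerivAt_of_fderiv_symmetric isOpen_univ hω
    (fun x _ u w => by
      have h := ((innerSL ℝ (E := E d)).hasFDerivAt.comp x (hvd 0 h0 x)).fderiv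
      have h' : fderiv ℝ (fun x => innerSL ℝ (eulerVel T 0 x)) x = _ := h
      rw [h']
      exact hsymm 0 h0 x u w)
  set g : ℝ → E d → ℝ := fun t x => 1 / 2 * ‖eulerVel T t x‖ ^ 2 + δF (push (T t) lam) x with hgdef
  have hgc : ContinuousOn (fun q : ℝ × E d => g q.1 q.2) (Icc 0 t₀ ×ˢ univ) := by
    have h3 := (contDiffOn_eulerVel hP.smooth hd).continuousOn
    have h4 : ContinuousOn (fun t => ∫ x, ‖x‖ ^ 2 * push (T t) lam x) (Icc 0 t₀) :=
      (hP.continuousOn_moment ht₀ hlam hpos).congr fun t ht =>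
        (hd t ht).integral_mul_push lam fun x => ‖x‖ ^ 2
    exact (continuousOn_const.mul (h3.norm.pow 2)).add
      (hF.continuousOn_variation (uniqueDiffOn_Icc ht₀)
        (WHF.contDiffOn_push hlam (uniqueDiffOn_Icc ht₀) hP.smooth hd) hP.finite h4)
  -- By symmetry of `Dv`, the gradient of `½ |v|²` is `Dv v`; adding `∇ δF = -T̈ ∘ T⁻¹` gives `-∂ₜ
  -- v`.
  have hgd : ∀ t ∈ Icc 0 t₀, ∀ x, HasFDerivAt (g t) (-innerSL ℝ (eulerVelDeriv T t x)) x := by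
    intro t ht x
    have h3 := ((hvd t ht x).norm_sq.const_mul (1 / 2)).add (hasFDerivAt_of_gradient (hφ t ht) x)
    refine h3.congr_fderiv (ContinuousLinearMap.ext fun u => ?_)
    have h4 := hsymm t ht x u (eulerVel T t x)
    rw [real_inner_comm] at h4
    simp [eulerVelDeriv, hgrad t ht, h4]
    ring
  exact ⟨fun t x => f x - ∫ τ in (0 : ℝ)..t, g τ x, fun t ht x =>
    ⟨hasFDerivAt_sub_integral (fun x t ht => hasDerivWithinAt_eulerVel ht₀ hP.smooth hd ht x)
      (continuousOn_eulerVelDeriv ht₀ hP.smooth hd) hgc hgd (fun x => hf x (mem_univ _)) ht x,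
    hasDerivWithinAt_sub_integral hgc ht x⟩⟩

end Critical

/-! ### The Wasserstein Hamiltonian flow and the Madelung system -/

/-- For positive `σ` one has `Δσ/σ = Δ log σ + |∇ log σ|²`; take `σ = √ρ`, for which `log σ = ½ log
ρ`. -/
theorem laplacian_sqrt_div {ρ : E d → ℝ} (hρ : ContDiff ℝ ∞ ρ) (hpos : ∀ x, 0 < ρ x) (x : E d) :
    1 / 2 * (Laplacian.laplacian (fun y => √(ρ y)) x / √(ρ x)) = -(1 / 8 * fisherVariation ρ x) := by
  have hσ : ContDiff ℝ ∞ fun y => √(ρ y) := hρ.sqrt fun x => (hpos x).ne'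
  have hσpos : ∀ x, 0 < √(ρ x) := fun x => Real.sqrt_pos.2 (hpos x)
  have hl : (fun y => Real.log (√(ρ y))) = (1 / 2 : ℝ) • fun y => Real.log (ρ y) := by
    funext y
    rw [Real.log_sqrt (hpos y).le, Pi.smul_apply, smul_eq_mul]
    ring
  have hld := contDiff_log hρ hpos
  have h1 := laplacian_log hσ hσpos x
  have h2 : ‖∇ (fun y => √(ρ y)) x‖ ^ 2 / √(ρ x) ^ 2 =
      1 / 4 * ‖∇ (fun y => Real.log (ρ y)) x‖ ^ 2 := by
    have h3 := gradient_log (hσ.contDiffAt.differentiableAt (x := x) (by simp)) (hσpos x).ne'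
    have h4 : ∇ (fun y => Real.log (√(ρ y))) x = (1 / 2 : ℝ) • ∇ (fun y => Real.log (ρ y)) x := by
      have h5 := (hld.contDiffAt.differentiableAt (x := x) (by simp)).hasFDerivAt.const_smul
        (1 / 2 : ℝ)
      rw [hl, h5.hasGradientAt.gradient, map_smul]
      rfl
    rw [h4] at h3
    have h6 := congrArg (fun v => ‖v‖ ^ 2) h3
    simp only [norm_smul, mul_pow, norm_inv, Real.norm_of_nonneg (hσpos x).le] at h6
    rw [div_eq_inv_mul, ← inv_pow, ← h6]
    norm_num
  rw [hl, InnerProductSpace.laplacian_smul _ (hld.contDiffAt.of_le two_le_infty), h2,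
    smul_eq_mul] at h1
  rw [fisherVariation]
  linarith

theorem hasGradientAt_of_innerSL {f : E d → ℝ} {v x : E d} (h : HasFDerivAt f (innerSL ℝ v) x) :
    ∇ f x = v :=
  HasGradientAt.gradient (f' := v) h

theorem contDiff_of_hasFDerivAt_innerSL {f : E d → ℝ} {v : E d → E d} (hv : ContDiff ℝ ∞ v)
    (h : ∀ x, HasFDerivAt f (innerSL ℝ (v x)) x) : ContDiff ℝ ∞ f := by
  refine contDiff_infty_iff_fderiv.2 ⟨fun x => (h x).differentiableAt, ?_⟩
  rw [funext fun x => (h x).fderiv]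
  exact (innerSL ℝ (E := E d)).contDiff.comp hv

theorem isFirstVariation_potential (F : (E d → ℝ) → ℝ) {ρ Φ : E d → ℝ} (hρ : ContDiff ℝ ∞ ρ)
    (hΦ : ContDiff ℝ ∞ Φ) (hint : Integrable fun x => ‖∇ Φ x‖ ^ 2 * ρ x) :
    IsFirstVariation (testFun d) (fun φ => densityHamiltonian F ρ φ) Φ
      (fun x => -divergence (fun y => ρ y • ∇ Φ y) x) := by
  rintro h ⟨hh, hs⟩
  have hgΦ : ContDiff ℝ ∞ (∇ Φ) := contDiff_gradient hΦ (by simp)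
  have hgh : ContDiff ℝ ∞ (∇ h) := contDiff_gradient hh (by simp)
  have hgΦc := hgΦ.continuous
  have hghc := hgh.continuous
  have hρc := hρ.continuous
  have hoff : ∀ x ∉ tsupport h, ∇ h x = 0 := fun x hx => by
    rw [gradient, image_eq_zero_of_notMem_tsupport fun hm => hx (tsupport_fderiv_subset ℝ hm),
      map_zero]
  have h1 : HasDerivAt (fun ε : ℝ => ∫ x, 1 / 2 * ‖∇ Φ x + ε • ∇ h x‖ ^ 2 * ρ x)
      (∫ x, ⟪∇ Φ x + (0 : ℝ) • ∇ h x, ∇ h x⟫ * ρ x) 0 := by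
    refine hasDerivAt_integral_of_eq_off_compact (K := tsupport h) hs univ_mem
      (f := fun ε x => 1 / 2 * ‖∇ Φ x + ε • ∇ h x‖ ^ 2 * ρ x)
      (f' := fun ε x => ⟪∇ Φ x + ε • ∇ h x, ∇ h x⟫ * ρ x)
      (fun ε _ => by fun_prop) (by fun_prop) (fun ε _ x _ => ?_) ?_
      (fun ε _ x hx => by simp [hoff x hx]) (fun x hx => by simp [hoff x hx])
    · have h2 : HasDerivAt (fun ε : ℝ => ∇ Φ x + ε • ∇ h x) (∇ h x) ε := by
        simpa using ((hasDerivAt_id ε).smul_const (∇ h x)).const_add (∇ Φ x)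
      refine ((h2.norm_sq.const_mul (1 / 2)).mul_const (ρ x)).congr_deriv ?_
      ring
    · refine (hint.const_mul (1 / 2)).congr (Eventually.of_forall fun x => ?_)
      simp only [zero_smul, add_zero]
      ring
  have h2 : (fun ε : ℝ => densityHamiltonian F ρ fun x => Φ x + ε * h x) =
      fun ε => (∫ x, 1 / 2 * ‖∇ Φ x + ε • ∇ h x‖ ^ 2 * ρ x) + F ρ := by
    funext ε
    simp only [densityHamiltonian, gradient_add_mul hΦ hh]
  have h3 := integral_fderiv_apply_eq (f := h) (w := fun y => ρ y • ∇ Φ y) (hh.of_le (by simp))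
    ((hρ.smul hgΦ).of_le (by simp)) (Or.inl hs)
  rw [h2]
  refine (h1.add_const (F ρ)).congr_deriv ?_
  have h4 : ∫ x, -divergence (fun y => ρ y • ∇ Φ y) x * h x =
      -∫ x, h x * divergence (fun y => ρ y • ∇ Φ y) x := by
    rw [← integral_neg]
    exact integral_congr_ae (Eventually.of_forall fun x => by simp only; ring)
  rw [h4, ← h3]
  refine integral_congr_ae (Eventually.of_forall fun x => ?_)
  simp only [zero_smul, add_zero, map_smul, smul_eq_mul]
  rw [← inner_gradient_left, real_inner_comm, mul_comm]

/-- The kinetic term is linear in the density, so its variation is the integrand itself. -/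
theorem isFirstVariation_density {F : (E d → ℝ) → ℝ} {ρ Φ g : E d → ℝ}
    (hΦ : Continuous (∇ Φ)) (hg : Continuous g) (hint : Integrable fun x => ‖∇ Φ x‖ ^ 2 * ρ x)
    (hF : IsFirstVariation (testFunZero d) F ρ g) :
    IsFirstVariation (testFunZero d) (fun r => densityHamiltonian F r Φ) ρ
      (fun x => 1 / 2 * ‖∇ Φ x‖ ^ 2 + g x) := by
  intro h hh
  have hc := hh.1.1.continuous
  have hs := hh.1.2
  have i1 : Integrable fun x => 1 / 2 * ‖∇ Φ x‖ ^ 2 * ρ x :=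
    (hint.const_mul (1 / 2)).congr (Eventually.of_forall fun x => by simp only; ring)
  have i2 : Integrable fun x => 1 / 2 * ‖∇ Φ x‖ ^ 2 * h x :=
    (by fun_prop : Continuous fun x => 1 / 2 * ‖∇ Φ x‖ ^ 2 * h x).integrable_of_hasCompactSupport
      hs.mul_left
  have i3 : Integrable fun x => g x * h x :=
    (hg.mul hc).integrable_of_hasCompactSupport hs.mul_left
  have h2 : (fun ε : ℝ => densityHamiltonian F (fun x => ρ x + ε * h x) Φ) =
      fun ε => ((∫ x, 1 / 2 * ‖∇ Φ x‖ ^ 2 * ρ x) + ε * ∫ x, 1 / 2 * ‖∇ Φ x‖ ^ 2 * h x) +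
        F fun x => ρ x + ε * h x := by
    funext ε
    rw [densityHamiltonian, ← integral_const_mul, ← integral_add i1 (i2.const_mul ε)]
    congr 1
    exact integral_congr_ae (Eventually.of_forall fun x => by simp only; ring)
  have h3 : ∫ x, (1 / 2 * ‖∇ Φ x‖ ^ 2 + g x) * h x =
      (∫ x, 1 / 2 * ‖∇ Φ x‖ ^ 2 * h x) + ∫ x, g x * h x := by
    rw [← integral_add i2 i3]
    simp only [add_mul]
  rw [h2, h3]
  have h4 : HasDerivAt (fun ε : ℝ => (∫ x, 1 / 2 * ‖∇ Φ x‖ ^ 2 * ρ x) +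
      ε * ∫ x, 1 / 2 * ‖∇ Φ x‖ ^ 2 * h x) (∫ x, 1 / 2 * ‖∇ Φ x‖ ^ 2 * h x) 0 := by
    simpa using ((hasDerivAt_id (0 : ℝ)).mul_const (∫ x, 1 / 2 * ‖∇ Φ x‖ ^ 2 * h x)).const_add
      (∫ x, 1 / 2 * ‖∇ Φ x‖ ^ 2 * ρ x)
  exact h4.add (hF h hh)

theorem IsCritical.exists_solvesWHF {D : Set (E d → ℝ)} {FR : (E d → ℝ) → ℝ}
    {δFR : (E d → ℝ) → E d → ℝ} {lam : E d → ℝ} {t₀ : ℝ} {ρ₀ ρ₁ : E d → ℝ} {T : ℝ → E d → E d}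
    (hT : IsCritical D (energy FR) lam t₀ ρ₀ ρ₁ T)
    (hF : IsEnergy D (energy FR) (energyVariation δFR)) (ht₀ : 0 < t₀) (hlam : ContDiff ℝ ∞ lam)
    (hpos : ∀ z, 0 < lam z) (hint : Integrable lam) :
    ∃ Φ : ℝ → E d → ℝ, (∀ t ∈ Icc 0 t₀, ContDiff ℝ ∞ (Φ t)) ∧
      (∀ t ∈ Icc 0 t₀, ∀ z, vel T t z = ∇ (Φ t) (T t z)) ∧
      SolvesWHF (densityHamiltonian (energy FR)) t₀ (fun t => push (T t) lam) Φ ∧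
      SolvesMadelung δFR t₀ (fun t => push (T t) lam) Φ := by
  have hP := hT.1
  have hd : ∀ t ∈ Icc 0 t₀, IsDiffeo (T t) := fun t ht => (hP.inO t ht).1
  obtain ⟨Φ, hΦ⟩ := hT.exists_potential hF ht₀ hlam hpos hint
  have hgrad : ∀ t ∈ Icc 0 t₀, ∇ (Φ t) = eulerVel T t := fun t ht =>
    funext fun x => hasGradientAt_of_innerSL (hΦ t ht x).1
  have hvs : ∀ t ∈ Icc 0 t₀, ContDiff ℝ ∞ (eulerVel T t) := fun t ht =>
    contDiff_eulerVel hP.smooth hd ht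
  have hΦs : ∀ t ∈ Icc 0 t₀, ContDiff ℝ ∞ (Φ t) := fun t ht =>
    contDiff_of_hasFDerivAt_innerSL (hvs t ht) fun x => (hΦ t ht x).1
  have hki : ∀ t ∈ Icc 0 t₀, Integrable fun x => ‖∇ (Φ t) x‖ ^ 2 * push (T t) lam x :=
    fun t ht => by
      rw [hgrad t ht, (hd t ht).integrable_mul_push lam fun x => ‖eulerVel T t x‖ ^ 2]
      simpa only [eulerVel_apply hd ht] using (hP.tangent t ht).2
  have hρ' := fun t (ht : t ∈ Icc 0 t₀) x => hasDerivWithinAt_push ht₀ hP.smooth hd hlam ht x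
  refine ⟨Φ, hΦs, fun t ht z => ?_, fun t ht => ?_, fun t ht x => ⟨?_, ?_⟩⟩
  · rw [hgrad t ht, eulerVel_apply hd ht]
  · refine ⟨_, _, hρ' t ht, fun x => (hΦ t ht x).2, ?_, ?_⟩
    · have h1 := isFirstVariation_potential (energy FR) ((hd t ht).contDiff_push hlam) (hΦs t ht)
        (hki t ht)
      rwa [hgrad t ht] at h1
    · have h1 := isFirstVariation_density (F := energy FR) (Φ := Φ t)
        (by rw [hgrad t ht]; exact (hvs t ht).continuous)
        (hF.contDiff _ (hP.finite t ht)).continuous (hki t ht) (hF.variation _ (hP.finite t ht))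
      simpa only [hgrad t ht, neg_neg] using h1
  · rw [hgrad t ht]
    exact hρ' t ht x
  · refine (hΦ t ht x).2.congr_deriv ?_
    rw [laplacian_sqrt_div ((hd t ht).contDiff_push hlam) ((hd t ht).push_pos hpos), hgrad t ht,
      energyVariation]
    ring

end WHF

end

/-! ### Assembly of the six statements -/

theorem mainTheorem1 (d : ℕ) (lam : E d → ℝ)
    (hlam : ContDiff ℝ ∞ lam) (hpos : ∀ z, 0 < lam z) (hmass : ∫ z, lam z = 1)
    (D : Set (E d → ℝ)) (FR : (E d → ℝ) → ℝ) (δFR : (E d → ℝ) → E d → ℝ)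
    (hFR : WHF.IsEnergy D FR δFR) (t₀ : ℝ) (ht₀ : 0 < t₀) (ρ₀ ρ₁ : E d → ℝ) :
    -- the first variation of the full energy
    WHF.IsEnergy (D ∩ WHF.finiteFisher d) (WHF.energy FR) (WHF.energyVariation δFR) ∧
    -- a critical point satisfies the second order equation
    (∀ T : ℝ → E d → E d, WHF.IsCritical (D ∩ WHF.finiteFisher d) (WHF.energy FR) lam t₀ ρ₀ ρ₁ T →
      WHF.SolvesSecondOrder (WHF.energyVariation δFR) lam t₀ T) ∧
    -- equivalence with the first order system for the momentum
    (∀ T : ℝ → E d → E d, WHF.IsPath (D ∩ WHF.finiteFisher d) (WHF.energy FR) lam t₀ ρ₀ ρ₁ T →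
      ∀ Λ : ℝ → E d → E d,
        WHF.SolvesFirstOrder (WHF.energyVariation δFR) lam t₀ T Λ ↔
          (∀ t ∈ Icc 0 t₀, ∀ z, Λ t z = lam z • WHF.vel T t z) ∧
            WHF.SolvesSecondOrder (WHF.energyVariation δFR) lam t₀ T) ∧
    -- the momentum is the derivative of the Lagrangian in the velocity, and the Hamiltonian is
    -- its Legendre transform
    (∀ T σ : E d → E d, WHF.InO lam T → WHF.IsTangent lam σ →
      (∀ τ : E d → E d, WHF.IsTangent lam τ →
        HasDerivAt (fun ε : ℝ => WHF.lagrangian (WHF.energy FR) lam T (fun z => σ z + ε • τ z))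
          (∫ z, ⟪lam z • σ z, τ z⟫) 0) ∧
      WHF.hamiltonian (WHF.energy FR) lam T (fun z => lam z • σ z) =
        WHF.metric lam σ σ - WHF.lagrangian (WHF.energy FR) lam T σ) ∧
    -- the first order system is the canonical system of the Hamiltonian:
    -- the derivative in `Λ` is `Λ / λ`, the one in `T` is `λ ∇ (δF/δρ)(T_♯ λ) ∘ T`
    (∀ T Λ : E d → E d, WHF.InO lam T → WHF.push T lam ∈ D ∩ WHF.finiteFisher d →
      WHF.IsTangent lam (fun z => (lam z)⁻¹ • Λ z) →
      (∀ M : E d → E d, WHF.IsTangent lam (fun z => (lam z)⁻¹ • M z) →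
        HasDerivAt
          (fun ε : ℝ => WHF.hamiltonian (WHF.energy FR) lam T (fun z => Λ z + ε • M z))
          (∫ z, ⟪(lam z)⁻¹ • Λ z, M z⟫) 0) ∧
      (∀ S : E d → E d, ContDiff ℝ ∞ S → HasCompactSupport S →
        HasDerivAt
          (fun ε : ℝ => WHF.hamiltonian (WHF.energy FR) lam (fun z => T z + ε • S z) Λ)
          (∫ z, ⟪lam z • ∇ (WHF.energyVariation δFR (WHF.push T lam)) (T z), S z⟫) 0)) ∧
    -- for a critical point the push-forward density solves the Wasserstein Hamiltonian flow
    (∀ T : ℝ → E d → E d, WHF.IsCritical (D ∩ WHF.finiteFisher d) (WHF.energy FR) lam t₀ ρ₀ ρ₁ T →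
      ∃ Φ : ℝ → E d → ℝ, (∀ t ∈ Icc 0 t₀, ContDiff ℝ ∞ (Φ t)) ∧
        (∀ t ∈ Icc 0 t₀, ∀ z, WHF.vel T t z = ∇ (Φ t) (T t z)) ∧
        WHF.SolvesWHF (WHF.densityHamiltonian (WHF.energy FR)) t₀
          (fun t => WHF.push (T t) lam) Φ ∧
        WHF.SolvesMadelung δFR t₀ (fun t => WHF.push (T t) lam) Φ) := by
  -- The integral of a non-integrable function is zero by convention, so unit mass entails
  -- integrability.
  have hint : Integrable lam := by
    by_contra h
    rw [integral_undef h] at hmass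
    exact zero_ne_one hmass
  have hF : WHF.IsEnergy (D ∩ WHF.finiteFisher d) (WHF.energy FR) (WHF.energyVariation δFR) :=
    hFR.add_fisher
  refine ⟨hF, fun T hT => hT.solvesSecondOrder hF ht₀ hlam hpos hint,
    fun T hT Λ => WHF.solvesFirstOrder_iff hT ht₀ hpos Λ,
    fun T σ _ hσ => ⟨fun τ hτ => WHF.hasDerivAt_lagrangian hlam hpos hσ hτ,
      WHF.hamiltonian_smul hpos T σ⟩,
    fun T Λ hT hD hΛ => ⟨fun M hM => WHF.hasDerivAt_hamiltonian_momentum hlam hpos hΛ hM,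
      fun S hS hs => WHF.hasDerivAt_hamiltonian_position hF hlam hpos hint hT hD hS hs⟩,
    fun T hT => hT.exists_solvesWHF hF ht₀ hlam hpos hint⟩
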